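/- **Subset Sum.** Given a sequence of $n$ integers and a target integer $t$ (of arbitrary size), decide whether some subsequence (possibly empty) sums up to $t$. Instances are written as bit strings $x\in\{0,1\}^*$, the target first and then the $n$ given integers, each integer as a sign bit and the binary digits of its absolute value in a self-delimiting code, so that the input size $|x|$ is linear in the total bit length of the integers. Let $n(x)$ denote the number of given integers of the instance $x$. **The class $\mathsf{AM}[s,t]$.** For functions $s,t$ of the input $x$, a language $L\subseteq\{0,1\}^*$ belongs to $\mathsf{AM}[s,t]$ if there is a deterministic verifier $V$, a single program for a random access machine with logarithmic cost, such that for every $x\in\{0,1\}^*$: 1. for all public coins $\omega\in\{0,1\}^{\mathbb N}$ and every proof $\pi\in\{0,1\}^*$ with $|\pi|\le s(x)$, the computation $V(x,\omega,\pi)$ halts and takes time at most $t(x)$ and space at most $t(x)$; 2. if $x\in L$, then with probability at least $2/3$ over independent fair coins $\omega$ there is a proof $\pi$ (which may depend on $\omega$) with $|\pi|\le s(x)$ such that $V(x,\omega,\pi)$ accepts; 3. if $x\notin L$, then $V(x,\omega,\pi)$ rejects for all $\omega$ and all $\pi$ with $|\pi|\le s(x)$. Here the machine works on registers $R_0,R_1,\dots$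 that hold integers (initially $0$); its instructions are loading a constant, addition, subtraction, indirect load and store, reading a chosen cell of one of the three read-only tapes $x,\omega,\pi$, a jump conditional on a register being positive, and halting. A step costs one plus the bit lengths of the integers that it handles, and the space is the maximal total bit length of the indices and contents of the nonzero registers. **Theorem.** $\text{Subset Sum}\in\mathsf{AM}\left[n/4,\;O^*(2^{n/4})\right]$. That is, there are a function $t$, a constant $C$ and an exponent $k$ with $t(x)\le C\,(|x|+1)^k\,2^{n(x)/4}$ for all $x\in\{0,1\}^*$, such that $\text{Subset Sum}\in\mathsf{AM}[s,t]$ for $s(x)=n(x)/4$. -/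

import Mathlib

namespace AMProtocol

/-! ### Random access machines with logarithmic cost

A program is a finite list of instructions. It works on registers `R 0, R 1, …` that hold integers
and are initially `0`, and it has three read-only tapes of bits with random access: the input `x`,
the public coins and the message of the prover. -/

/-- The three read-only tapes. -/
inductive Tape where
  | input
  | coins
  | proof

/-- Instructions. Register indices `r a b` and jump targets `l` are constants of the program. -/
inductive Instr where
  /-- `R r := c` -/
  | const (r : ℕ) (c : ℤ)
  /-- `R r := R a + R b` -/
  | add (r a b : ℕ)
  /-- `R r := R a - R b` -/
  | sub (r a b : ℕ)
  /-- `R r := R (R a)` -/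
  | load (r a : ℕ)
  /-- `R (R a) := R b` -/
  | store (a b : ℕ)
  /-- `R r :=` the symbol in cell number `R a` of a read-only tape -/
  | read (t : Tape) (r a : ℕ)
  /-- if `R a > 0`, go to instruction `l` -/
  | jpos (a l : ℕ)
  /-- stop and accept (`true`) or reject (`false`) -/
  | halt (b : Bool)

/-- A program. Leaving the list of instructions means to stop and reject. -/
abbrev Program := List Instr

/-- The contents of the read-only tapes; there is an unlimited supply of coins. -/
structure Tapes where
  input : List Bool
  coins : ℕ → Bool
  proof : List Bool

/-- A bit as an integer. -/
def bitVal (b : Bool) : ℤ := if b then 1 else 0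

/-- The symbol in cell `k` of a finite tape; `-1` is read in all cells beyond the end. -/
def cellVal (l : List Bool) (k : ℕ) : ℤ := (l[k]?).elim (-1) bitVal

/-- The symbol in cell `k` of the tape `t`. -/
def Tapes.symbol (τ : Tapes) (t : Tape) (k : ℕ) : ℤ :=
  match t with
  | .input => cellVal τ.input k
  | .coins => bitVal (τ.coins k)
  | .proof => cellVal τ.proof k

/-- A configuration: the number of the next instruction and the contents of the registers. -/
structure Config where
  pc : ℕ
  mem : ℕ →₀ ℤ

/-- `R r := v`, and go on to the next instruction. -/
noncomputable def Config.write (c : Config) (r : ℕ) (v : ℤ) : Config :=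
  ⟨c.pc + 1, c.mem.update r v⟩

/-- One step of the program `P`; a configuration in which the program has stopped is a fixed
point. An indirect access through a negative integer is an access to cell `0`. -/
noncomputable def step (P : Program) (τ : Tapes) (c : Config) : Config :=
  match P[c.pc]? with
  | none => c
  | some (.const r v) => c.write r v
  | some (.add r a b) => c.write r (c.mem a + c.mem b)
  | some (.sub r a b) => c.write r (c.mem a - c.mem b)
  | some (.load r a) => c.write r (c.mem (c.mem a).toNat)
  | some (.store a b) => c.write (c.mem a).toNat (c.mem b)
  | some (.read t r a) => c.write r (τ.symbol t (c.mem a).toNat)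
  | some (.jpos a l) => ⟨if 0 < c.mem a then l else c.pc + 1, c.mem⟩
  | some (.halt _) => c

/-- The number of bits of (the absolute value of) an integer. -/
def bitLen (z : ℤ) : ℕ := z.natAbs.size

/-- The logarithmic cost of the next step: one plus the bit lengths of all the integers it handles,
addresses of indirect accesses included. -/
noncomputable def stepCost (P : Program) (c : Config) : ℕ :=
  match P[c.pc]? with
  | none => 0
  | some (.const _ v) => 1 + bitLen v
  | some (.add _ a b) => 1 + bitLen (c.mem a) + bitLen (c.mem b)
  | some (.sub _ a b) => 1 + bitLen (c.mem a) + bitLen (c.mem b)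
  | some (.load _ a) => 1 + bitLen (c.mem a) + bitLen (c.mem (c.mem a).toNat)
  | some (.store a b) => 1 + bitLen (c.mem a) + bitLen (c.mem b)
  | some (.read _ _ a) => 1 + bitLen (c.mem a)
  | some (.jpos a _) => 1 + bitLen (c.mem a)
  | some (.halt _) => 0

/-- The space that a configuration occupies: the number of bits needed to write down the indices and
the contents of all nonzero registers. The read-only tapes are not counted. -/
noncomputable def Config.space (c : Config) : ℕ :=
  c.mem.sum fun i v => Nat.size i + bitLen v

/-- The configuration after `m` steps, from instruction `0` and with all registers `0`. -/
noncomputable def configAt (P : Program) (τ : Tapes) (m : ℕ) : Config :=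
  (step P τ)^[m] ⟨0, 0⟩

/-- In the configuration `c` the program has stopped. -/
def Halted (P : Program) (c : Config) : Prop :=
  P[c.pc]? = none ∨ ∃ b, P[c.pc]? = some (.halt b)

/-- The program stops; the total cost of its steps is at most `T`, and it never occupies more than
`S` bits of space. -/
def RunsWithin (P : Program) (τ : Tapes) (T S : ℝ) : Prop :=
  ∃ m : ℕ, Halted P (configAt P τ m) ∧
    ((∑ j ∈ Finset.range m, stepCost P (configAt P τ j) : ℕ) : ℝ) ≤ T ∧
    ∀ j ≤ m, ((configAt P τ j).space : ℝ) ≤ S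

/-- The program stops and accepts. -/
def Accepts (P : Program) (τ : Tapes) : Prop :=
  ∃ m : ℕ, P[(configAt P τ m).pc]? = some (.halt true)

/-! ### Arthur–Merlin protocols -/

/-- The law of an infinite sequence of independent fair coins. -/
noncomputable def coinLaw : MeasureTheory.Measure (ℕ → Bool) :=
  MeasureTheory.Measure.infinitePi fun _ : ℕ => (PMF.uniformOfFintype Bool).toMeasure

/-- The class `AM[s, t]` of languages `L ⊆ {0,1}*`. The bounds may depend on the whole input `x`, so
that they can be expressed in parameters of `x`. The coins `ω` are tossed in public; then the prover,
who knows `x` and `ω`, sends a proof `π` of at most `s x` bits; then the verifier, a deterministic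
machine that is given `x`, `ω` and `π`, decides in time and space at most `t x`. If `x ∈ L`, then with
probability at least `2/3` over `ω` some proof is accepted; if `x ∉ L`, then no proof is ever
accepted. -/
def AM (s t : List Bool → ℝ) : Set (Set (List Bool)) :=
  {L | ∃ V : Program, ∀ x : List Bool,
    (∀ (ω : ℕ → Bool) (π : List Bool), (π.length : ℝ) ≤ s x →
      RunsWithin V ⟨x, ω, π⟩ (t x) (t x)) ∧
    (x ∈ L → 2 / 3 ≤ coinLaw {ω | ∃ π : List Bool, (π.length : ℝ) ≤ s x ∧ Accepts V ⟨x, ω, π⟩}) ∧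
    (x ∉ L → ∀ (ω : ℕ → Bool) (π : List Bool), (π.length : ℝ) ≤ s x → ¬ Accepts V ⟨x, ω, π⟩)}

/-- `f = O*(g)`: `f` is at most `g` times a polynomial in the size of the input. -/
def IsOStar (f g : List Bool → ℝ) : Prop :=
  ∃ (C : ℝ) (k : ℕ), ∀ x : List Bool, f x ≤ C * ((x.length : ℝ) + 1) ^ k * g x

/-! ### Subset Sum as a language

An integer is written as a sign bit (`1` for negative) followed by the binary digits of its absolute
value, most significant first. To make this self-delimiting, every bit `b` is written as `1 b`, and
the end of the integer as `0`. An instance is the target followed by the given integers. Every string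
is read as a sequence of integers; an unfinished integer at its end is ignored. -/

/-- Splits a string into its self-delimiting blocks. -/
def blocks : List Bool → List (List Bool)
  | [] => []
  | [true] => []
  | false :: l => [] :: blocks l
  | true :: b :: l =>
    match blocks l with
    | [] => []
    | w :: ws => (b :: w) :: ws

/-- The natural number with the given binary digits, most significant first. -/
def natOfBits (l : List Bool) : ℕ := l.foldl (fun v b => 2 * v + b.toNat) 0

/-- The integer that a block stands for. -/
def intOfBlock : List Bool → ℤ
  | [] => 0
  | s :: l => if s then -(natOfBits l : ℤ) else (natOfBits l : ℤ)

/-- The sequence of integers that a string stands for. -/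
def decode (x : List Bool) : List ℤ := (blocks x).map intOfBlock

/-- The number `n` of given integers of the Subset Sum instance `x` (the target is not counted). -/
def itemCount (x : List Bool) : ℕ := (decode x).length - 1

/-- Subset Sum: does some subsequence of the given integers sum up to the target? -/
def subsetSum : Set (List Bool) :=
  {x | ∃ (t : ℤ) (A : List ℤ), decode x = t :: A ∧ ∃ B : List ℤ, B.Sublist A ∧ B.sum = t}

/-- The block of an integer. -/
def blockOfInt (z : ℤ) : List Bool := decide (z < 0) :: z.natAbs.bits.reverse

/-- The string that stands for a sequence of integers. -/
def encode (A : List ℤ) : List Bool :=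
  A.flatMap fun z => (blockOfInt z).flatMap (fun b => [true, b]) ++ [false]

theorem blocks_append (w l : List Bool) :
    blocks (w.flatMap (fun b => [true, b]) ++ false :: l) = w :: blocks l := by
  induction w with
  | nil => simp [blocks]
  | cons b w ih => simp [blocks, ih]

theorem natOfBits_bits (n : ℕ) : natOfBits n.bits.reverse = n := by
  unfold natOfBits
  rw [List.foldl_reverse]
  induction n using Nat.binaryRec' with
  | zero => simp
  | bit b n h ih =>
    rw [Nat.bits_append_bit n b h, List.foldr_cons, ih]
    cases b <;> simp [Nat.bit]

theorem intOfBlock_blockOfInt (z : ℤ) : intOfBlock (blockOfInt z) = z := by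
  unfold blockOfInt
  simp only [intOfBlock, natOfBits_bits]
  by_cases h : z < 0
  · simp only [h, decide_true, if_true]
    omega
  · simp only [h, decide_false, Bool.false_eq_true, if_false]
    omega

/-- Every sequence of integers has a code. -/
theorem decode_encode (A : List ℤ) : decode (encode A) = A := by
  unfold decode
  induction A with
  | nil => simp [encode, blocks]
  | cons z A ih =>
    have h : encode (z :: A)
        = (blockOfInt z).flatMap (fun b => [true, b]) ++ false :: encode A := by
      simp [encode]
    rw [h, blocks_append, List.map_cons, ih, intOfBlock_blockOfInt]

/-- The size of the code is linear in the total bit length of the integers. -/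
theorem length_encode (A : List ℤ) :
    (encode A).length = (A.map fun z => 2 * bitLen z + 3).sum := by
  induction A with
  | nil => simp [encode]
  | cons z A ih =>
    have h : encode (z :: A)
        = (blockOfInt z).flatMap (fun b => [true, b]) ++ false :: encode A := by
      simp [encode]
    have h2 : ∀ w : List Bool, (w.flatMap (fun b => [true, b])).length = 2 * w.length := by
      intro w
      induction w with
      | nil => simp
      | cons b w ihw => simp [ihw]; omega
    rw [h, List.length_append, h2, List.length_cons, ih, List.map_cons, List.sum_cons]
    simp only [blockOfInt, bitLen, List.length_cons, List.length_reverse, Nat.size_eq_bits_len]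
    omega

end AMProtocol

set_option linter.constructorNameAsVariable false
set_option linter.unusedSimpArgs false

namespace AMProtocol

/-! ### Resources of runs of a random access machine -/

/-! Write `X` for the input length and `k` for the length of the message; the honest prover takes `k
= ⌊n/4⌋`. The items are dealt into four groups by their index modulo 4, so each group has at most `k
+ 1` items and at most `2 ^ (k + 1)` subset sums. A solution is a choice of subset sums with `v₀ +
v₁ + v₂ + v₃ = T`. All partial sums have absolute value at most `2 ^ X`. Meet in the middle would
have to list about `2 ^ (n/2)` sums `v₀ + v₁`; the message cuts this down to about `2 ^ (n/4)`.

The public coins form a multiplier `r` with `k + X` bits. The bucket of `v` is `r * v` modulo `2 ^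
(k + X)`, rounded down to a multiple of `2 ^ X`, so there are only `2 ^ k` buckets. The prover sends
the sum `s` of the buckets of `v₀` and `v₁` modulo `2 ^ (k + X)`, which takes `k` bits
(`exists_message`). The verifier sorts one list of the first half into buckets, enumerates the pairs
whose buckets add up to `s`, and marks their sums in a table. Rounding down destroys additivity only
by a carry: the buckets of `v₂` and `v₃` add up to the bucket of `T` minus `s` minus `c * 2 ^ X`
with `c < 4` (`exists_candidate`). The pairs of the second half are enumerated for all four
candidates, and each sum is checked for a marked complement.

Soundness never depends on `r` or on the message: every marked or checked number is a true sum of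
two groups, and the groups are disjoint. The time bound is just as unconditional, since each
enumeration gets a fuel of `64 * 2 ^ (k + 1)` rounds and is cut off there.

Completeness needs that the fuel suffices for the right pairs. Fix a solution before the coins are
tossed and let `V = v₀ + v₁`. Duplicates are removed from the sorted list, so each entry of the
other list has at most one partner with sum exactly `V`. A pair with another sum in the same
enumeration forces `r * d`, with `d ≠ 0` the difference of the sums, to be within `2 ^ (X + 1)` of a
multiple of `2 ^ (k + X)`. At most `2 ^ (X + 2)` of the `2 ^ (k + X)` multipliers do this
(`card_small_residue_le`), so the expected number of collisions is at most `8 * 2 ^ (k + 1)`. By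
Markov's inequality it exceeds `62 * 2 ^ (k + 1)` with probability at most `1/6`
(`card_many_collisions_le`). The same holds for `v₂ + v₃`, and the union bound leaves probability
`2/3` (`two_thirds_le_coinLaw_accepts`).

The remaining work is to realize this on the machine. The verifier is written as a sequence of loops
with loop-free bodies, compiled by `compileProgram` and analysed by loop invariants
(`verifierStages_ends`). Since integers grow by at most one bit per step, it is enough to bound the
values between rounds; `compileProgram_correct` turns a number of rounds into logarithmic time and
space. -/

/-- A bound for the constants and the register indices that occur in an instruction. -/
def Instr.magnitude : Instr → ℕ
  | .const r c => r + c.natAbs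
  | .add r _ _ => r
  | .sub r _ _ => r
  | .load r _ => r
  | .store _ _ => 0
  | .read _ r _ => r
  | .jpos _ _ => 0
  | .halt _ => 0

/-- All registers hold integers of absolute value at most `2 ^ β`. -/
def Config.Bounded (β : ℕ) (c : Config) : Prop :=
  ∀ i, |c.mem i| ≤ 2 ^ β

theorem bitLen_le {z : ℤ} {β : ℕ} (h : |z| ≤ 2 ^ β) : bitLen z ≤ β + 1 := by
  unfold bitLen
  rw [Nat.size_le]
  zify
  rw [pow_succ]
  have : (0 : ℤ) < 2 ^ β := by positivity
  linarith

theorem size_toNat_le {z : ℤ} {β : ℕ} (h : |z| ≤ 2 ^ β) : Nat.size z.toNat ≤ β + 1 := by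
  rw [Nat.size_le]
  have h1 : (z.toNat : ℤ) ≤ |z| := by
    rw [Int.toNat_eq_max]
    exact max_le (le_abs_self z) (abs_nonneg z)
  zify
  rw [pow_succ]
  have : (0 : ℤ) < 2 ^ β := by positivity
  linarith

theorem space_write_le (c : Config) (r : ℕ) (v : ℤ) :
    (c.write r v).space ≤ c.space + (Nat.size r + bitLen v) := by
  unfold Config.space Config.write
  have h0 : ∀ a : ℕ, Nat.size a + bitLen 0 = Nat.size a := by intro a; simp [bitLen]
  classical
  -- Writing zero removes the register from the support instead of adding it.
  by_cases hv : v = 0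
  · subst hv
    have : c.mem.update r 0 = c.mem.erase r := by
      ext i
      by_cases hi : i = r
      · subst hi; simp
      · simp [hi]
    simp only [this]
    unfold Finsupp.sum
    rw [Finsupp.support_erase]
    refine le_trans ?_ (Nat.le_add_right _ _)
    calc _ = ∑ i ∈ c.mem.support.erase r, (Nat.size i + bitLen (c.mem i)) := by
          apply Finset.sum_congr rfl
          intro i hi
          rw [Finsupp.erase_ne (Finset.ne_of_mem_erase hi)]
      _ ≤ _ := Finset.sum_le_sum_of_subset (Finset.erase_subset _ _)
  · unfold Finsupp.sum
    have hs : (c.mem.update r v).support = insert r (c.mem.support.erase r) := by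
      ext i
      by_cases hi : i = r
      · subst hi; simp [hv]
      · simp [hi]
    simp only [hs]
    rw [Finset.sum_insert (by simp)]
    rw [add_comm]
    gcongr ?_ + ?_
    · calc _ = ∑ i ∈ c.mem.support.erase r, (Nat.size i + bitLen (c.mem i)) := by
            apply Finset.sum_congr rfl
            intro i hi
            rw [Finsupp.update_apply, if_neg (Finset.ne_of_mem_erase hi)]
        _ ≤ _ := Finset.sum_le_sum_of_subset (Finset.erase_subset _ _)
    · simp

theorem Config.Bounded.write {β : ℕ} {c : Config} (h : c.Bounded β) {v : ℤ} (r : ℕ)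
    (hv : |v| ≤ 2 ^ β) : (c.write r v).Bounded β := by
  intro i
  simp only [Config.write, Finsupp.update_apply]
  split_ifs
  · exact hv
  · exact h i

theorem Config.Bounded.mono {β γ : ℕ} {c : Config} (h : c.Bounded β) (hβ : β ≤ γ) :
    c.Bounded γ := fun i => (h i).trans (pow_le_pow_right₀ (by norm_num) hβ)

theorem abs_symbol_le (τ : Tapes) (t : Tape) (k : ℕ) : |τ.symbol t k| ≤ 1 := by
  have hb : ∀ b, |bitVal b| ≤ 1 := by intro b; cases b <;> simp [bitVal]
  have hc : ∀ l : List Bool, |cellVal l k| ≤ 1 := by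
    intro l
    unfold cellVal
    cases l[k]? with
    | none => simp
    | some b => simpa using hb b
  cases t <;> simp [Tapes.symbol, hb, hc]

section
variable {P : Program} {τ : Tapes} {c : Config} {β : ℕ}

/-- An addition or subtraction at most doubles the largest absolute value, so a step lengthens
integers by at most one bit. This is why a piece of code with boundedly many steps needs a bound on
the values only at its beginning. -/
theorem step_resources (hP : ∀ i ∈ P, i.magnitude ≤ β) (h : c.Bounded β) :
    (step P τ c).Bounded (β + 1) ∧ stepCost P c ≤ 2 * β + 4 ∧
      (step P τ c).space ≤ c.space + (2 * β + 4) := by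
  have hpow : (2 : ℤ) ^ (β + 1) = 2 ^ β + 2 ^ β := by ring
  have hone : (1 : ℤ) ≤ 2 ^ β := one_le_pow₀ (by norm_num)
  have hb : c.Bounded (β + 1) := h.mono (Nat.le_succ β)
  have hsz : ∀ r, r ≤ β → Nat.size r ≤ β := fun r hr =>
    Nat.size_le.2 (hr.trans_lt Nat.lt_two_pow_self)
  have hbit : ∀ a, bitLen (c.mem a) ≤ β + 1 := fun a => bitLen_le (h a)
  have main : ∀ r v, |v| ≤ 2 ^ (β + 1) → Nat.size r ≤ β + 1 →
      Nat.size r + bitLen v ≤ 2 * β + 4 → (c.write r v).Bounded (β + 1) ∧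
      (c.write r v).space ≤ c.space + (2 * β + 4) := fun r v hv _ hs =>
    ⟨hb.write r hv, (space_write_le c r v).trans (by omega)⟩
  unfold step stepCost
  cases hi : P[c.pc]? with
  | none => exact ⟨hb, by simp, by simp⟩
  | some i =>
    have hmem := hP i (List.mem_of_getElem? hi)
    cases i with
    | const r v =>
      simp only [Instr.magnitude] at hmem
      have hv : |v| ≤ 2 ^ β := by
        rw [Int.abs_eq_natAbs]
        have : v.natAbs < 2 ^ β := lt_of_le_of_lt (by omega) (Nat.lt_two_pow_self (n := β))
        exact_mod_cast this.le
      have h1 := bitLen_le hv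
      have h2 := hsz r (by omega)
      obtain ⟨h3, h4⟩ := main r v (by linarith) (by omega) (by omega)
      exact ⟨h3, by simp only; omega, h4⟩
    | add r a b =>
      simp only [Instr.magnitude] at hmem
      have hv : |c.mem a + c.mem b| ≤ 2 ^ (β + 1) := by
        rw [hpow]; exact (abs_add_le _ _).trans (add_le_add (h a) (h b))
      have h1 := bitLen_le hv
      have h2 := hsz r (by omega)
      have h5 := hbit a
      have h6 := hbit b
      obtain ⟨h3, h4⟩ := main r _ hv (by omega) (by omega)
      exact ⟨h3, by simp only; omega, h4⟩
    | sub r a b =>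
      simp only [Instr.magnitude] at hmem
      have hv : |c.mem a - c.mem b| ≤ 2 ^ (β + 1) := by
        rw [hpow]; exact (abs_sub _ _).trans (add_le_add (h a) (h b))
      have h1 := bitLen_le hv
      have h2 := hsz r (by omega)
      have h5 := hbit a
      have h6 := hbit b
      obtain ⟨h3, h4⟩ := main r _ hv (by omega) (by omega)
      exact ⟨h3, by simp only; omega, h4⟩
    | load r a =>
      simp only [Instr.magnitude] at hmem
      have h2 := hsz r (by omega)
      have h5 := hbit a
      have h6 := hbit (c.mem a).toNat
      obtain ⟨h3, h4⟩ := main r _ (hb (c.mem a).toNat) (by omega) (by omega)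
      exact ⟨h3, by simp only; omega, h4⟩
    | store a b =>
      have h5 := hbit a
      have h6 := hbit b
      have h2 := size_toNat_le (h a)
      obtain ⟨h3, h4⟩ := main (c.mem a).toNat _ (hb b) (by omega) (by omega)
      exact ⟨h3, by simp only; omega, h4⟩
    | read t r a =>
      simp only [Instr.magnitude] at hmem
      have hv := abs_symbol_le τ t (c.mem a).toNat
      have h2 := hsz r (by omega)
      have h5 := hbit a
      have h6 : bitLen (τ.symbol t (c.mem a).toNat) ≤ 0 + 1 := bitLen_le (by simpa using hv)
      obtain ⟨h3, h4⟩ := main r (τ.symbol t (c.mem a).toNat) (by linarith) (by omega) (by omega)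
      exact ⟨h3, by simp only; omega, h4⟩
    | jpos a l =>
      have h5 := hbit a
      refine ⟨hb, by simp only; omega, ?_⟩
      simp only [Config.space]
      omega
    | halt b => exact ⟨hb, by simp, by simp⟩

/-- The run of `P` from `c` leads to `c'` with cost and additional space at most `R`. -/
def Reach (P : Program) (τ : Tapes) (c c' : Config) (R : ℕ) : Prop :=
  ∃ m, (step P τ)^[m] c = c' ∧ ∑ j ∈ Finset.range m, stepCost P ((step P τ)^[j] c) ≤ R ∧
    ∀ j ≤ m, ((step P τ)^[j] c).space ≤ c.space + R

theorem Reach.refl (P : Program) (τ : Tapes) (c : Config) : Reach P τ c c 0 :=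
  ⟨0, rfl, by simp, fun j hj => by
    obtain rfl : j = 0 := by omega
    simp⟩

theorem Reach.mono {c' : Config} {R R' : ℕ} (h : Reach P τ c c' R) (hR : R ≤ R') :
    Reach P τ c c' R' := by
  obtain ⟨m, h1, h2, h3⟩ := h
  exact ⟨m, h1, h2.trans hR, fun j hj => (h3 j hj).trans (by omega)⟩

theorem Reach.trans {c' c'' : Config} {R R' : ℕ} (h : Reach P τ c c' R)
    (h' : Reach P τ c' c'' R') : Reach P τ c c'' (R + R') := by
  obtain ⟨m, h1, h2, h3⟩ := h
  obtain ⟨m', h1', h2', h3'⟩ := h'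
  have key : ∀ j, (step P τ)^[m + j] c = (step P τ)^[j] c' := by
    intro j
    rw [add_comm, Function.iterate_add_apply, h1]
  have hc' : c'.space ≤ c.space + R := by
    rw [← h1]; exact h3 m le_rfl
  refine ⟨m + m', by rw [key, h1'], ?_, ?_⟩
  · rw [Finset.sum_range_add]
    refine add_le_add h2 ?_
    simpa only [key] using h2'
  · intro j hj
    by_cases hjm : j ≤ m
    · exact (h3 j hjm).trans (by omega)
    · obtain ⟨i, rfl⟩ : ∃ i, j = m + i := ⟨j - m, by omega⟩
      rw [key]
      exact (h3' i (by omega)).trans (by omega)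

theorem iterate_bounded (hP : ∀ i ∈ P, i.magnitude ≤ β) (h : c.Bounded β) (m : ℕ) :
    ((step P τ)^[m] c).Bounded (β + m) := by
  induction m with
  | zero => simpa using h
  | succ m ih =>
    rw [Function.iterate_succ_apply']
    exact (step_resources (fun i hi => (hP i hi).trans (by omega)) ih).1

/-- Few steps from a configuration with small integers are cheap. -/
theorem reach_of_iterate (hP : ∀ i ∈ P, i.magnitude ≤ β) (h : c.Bounded β) {m n : ℕ}
    (hm : m ≤ n) : Reach P τ c ((step P τ)^[m] c) (n * (2 * (β + n) + 4)) := by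
  have hres : ∀ j, j ≤ m → _ := fun j hj =>
    step_resources (τ := τ) (fun i hi => (hP i hi).trans (Nat.le_add_right β j))
      (iterate_bounded (τ := τ) hP h j)
  refine ⟨m, rfl, ?_, ?_⟩
  · calc _ ≤ ∑ j ∈ Finset.range m, (2 * (β + n) + 4) := by
          apply Finset.sum_le_sum
          intro j hj
          have hj := Finset.mem_range.1 hj
          exact (hres j hj.le).2.1.trans (by omega)
      _ = m * (2 * (β + n) + 4) := by simp
      _ ≤ _ := Nat.mul_le_mul_right _ hm
  · have key : ∀ j ≤ m, ((step P τ)^[j] c).space ≤ c.space + j * (2 * (β + n) + 4) := by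
      intro j
      induction j with
      | zero => simp
      | succ j ih =>
        intro hj
        rw [Function.iterate_succ_apply', Nat.succ_mul]
        have h1 := (hres j (by omega)).2.2
        have h2 := ih (by omega)
        omega
    intro j hj
    refine (key j hj).trans ?_
    gcongr
    omega

end

/-- A halting configuration is a fixed point of `step`. Two halting configurations of the same run,
at times `m` and `m'`, therefore both equal the one at time `m + m'`. -/
theorem accepts_iff_of_halt {P : Program} {τ : Tapes} {m : ℕ} {b : Bool}
    (h : P[(configAt P τ m).pc]? = some (.halt b)) : Accepts P τ ↔ b = true := by
  constructor
  · rintro ⟨m', h'⟩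
    have fix : ∀ {m : ℕ} {b : Bool}, P[(configAt P τ m).pc]? = some (.halt b) →
        ∀ j, configAt P τ (m + j) = configAt P τ m := by
      intro m b hm j
      unfold configAt at *
      rw [add_comm, Function.iterate_add_apply]
      apply Function.iterate_fixed
      simp [step, hm]
    have h1 := fix h m'
    have h2 := fix h' m
    rw [add_comm m' m, h1] at h2
    rw [← h2, h] at h'
    simpa using h'
  · rintro rfl
    exact ⟨m, h⟩

/-! ### A small language with named registers and arrays, and its compilation -/

/-- The names of the scalar variables. -/
inductive Reg where
  | zero | one | four | N | D | L | r | rl | sg | pos | p | c0 | c1 | ck | v | xv | yv | sgn | st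
  | cnt | go | j | i | pw | t | a | b | F | q | flag
  deriving DecidableEq

/-- The names of the arrays. -/
inductive Arr where
  | A | XA | YA | V | X | Y | hd0 | nx0 | hd1 | nx1 | mark
  deriving DecidableEq

/-- A store: the values of the variables and of the cells of the arrays. -/
@[ext] structure Store where
  S : Reg → ℤ
  A : Arr → ℕ → ℤ

/-- Loop-free code. -/
inductive Code where
  | skip
  | const (r : Reg) (v : ℤ)
  | add (r a b : Reg)
  | sub (r a b : Reg)
  | load (r : Reg) (k : Arr) (i : Reg)
  | store (k : Arr) (i b : Reg)
  | read (t : Tape) (r i : Reg)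
  | seq (c₁ c₂ : Code)
  | ifpos (a : Reg) (c₁ c₂ : Code)

/-- Assignment to a variable. -/
def Store.set (σ : Store) (r : Reg) (v : ℤ) : Store := ⟨Function.update σ.S r v, σ.A⟩

/-- Assignment to a cell of an array. -/
def Store.put (σ : Store) (k : Arr) (e : ℕ) (v : ℤ) : Store :=
  ⟨σ.S, Function.update σ.A k (Function.update (σ.A k) e v)⟩

/-- The effect of loop-free code on a store. -/
def Code.eval (τ : Tapes) : Code → Store → Store
  | skip, σ => σ
  | const r v, σ => σ.set r v
  | add r a b, σ => σ.set r (σ.S a + σ.S b)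
  | sub r a b, σ => σ.set r (σ.S a - σ.S b)
  | load r k i, σ => σ.set r (σ.A k (σ.S i).toNat)
  | store k i b, σ => σ.put k (σ.S i).toNat (σ.S b)
  | read t r i, σ => σ.set r (τ.symbol t (σ.S i).toNat)
  | seq c₁ c₂, σ => eval τ c₂ (eval τ c₁ σ)
  | ifpos a c₁ c₂, σ => if 0 < σ.S a then eval τ c₁ σ else eval τ c₂ σ

/-- The register of a variable. -/
def Reg.idx (r : Reg) : ℕ := r.ctorIdx

/-- The number of an array. -/
def Arr.idx (k : Arr) : ℕ := k.ctorIdx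

theorem Reg.idx_injective : Function.Injective Reg.idx :=
  Function.LeftInverse.injective (g := Reg.ofNat) fun r => Reg.ofNat_ctorIdx r

theorem Arr.idx_injective : Function.Injective Arr.idx :=
  Function.LeftInverse.injective (g := Arr.ofNat) fun r => Arr.ofNat_ctorIdx r

theorem Reg.idx_lt (r : Reg) : r.idx < 30 := by cases r <;> decide

theorem Arr.idx_lt (k : Arr) : k.idx < 16 := by cases k <;> decide

open Classical in
/-- The contents of the registers of the machine that represent a store. -/
noncomputable def Store.flat (σ : Store) (n : ℕ) : ℤ :=
  if n < 32 then if h : ∃ r : Reg, r.idx = n then σ.S h.choose else 0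
  else if h : ∃ k : Arr, k.idx = (n - 32) % 16 then σ.A h.choose ((n - 32) / 16) else 0

theorem Store.flat_reg (σ : Store) (r : Reg) : σ.flat r.idx = σ.S r := by
  have h : ∃ r' : Reg, r'.idx = r.idx := ⟨r, rfl⟩
  unfold Store.flat
  rw [if_pos (r.idx_lt.trans (by norm_num)), dif_pos h, Reg.idx_injective h.choose_spec]

/-- The arrays are interleaved above register 32 with period 16. Each of them is thus unbounded, and
an address is computed from an index with a few additions. -/
theorem Store.flat_arr (σ : Store) (k : Arr) (e : ℕ) :
    σ.flat (16 * e + (32 + k.idx)) = σ.A k e := by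
  have hk := k.idx_lt
  have h1 : (16 * e + (32 + k.idx) - 32) % 16 = k.idx := by omega
  have h2 : (16 * e + (32 + k.idx) - 32) / 16 = e := by omega
  have h : ∃ k' : Arr, k'.idx = k.idx := ⟨k, rfl⟩
  unfold Store.flat
  rw [if_neg (by omega), h1, h2, dif_pos h, Arr.idx_injective h.choose_spec]

/-- Registers 30 and 31 belong to no variable. They hold zero between pieces of code, so that the
memory is exactly the image of a store. -/
theorem Store.flat_scratch (σ : Store) {n : ℕ} (h30 : 30 ≤ n) (h32 : n < 32) :
    σ.flat n = 0 := by
  unfold Store.flat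
  rw [if_pos h32, dif_neg]
  rintro ⟨r, rfl⟩
  exact absurd r.idx_lt (by omega)

theorem Store.flat_set (σ : Store) (r : Reg) (v : ℤ) :
    (σ.set r v).flat = Function.update σ.flat r.idx v := by
  funext n
  by_cases hn : n = r.idx
  · subst hn; simp [Store.flat_reg, Store.set]
  · rw [Function.update_of_ne hn]
    unfold Store.flat
    by_cases h32 : n < 32
    · simp only [h32, if_true]
      by_cases h : ∃ r : Reg, r.idx = n
      · rw [dif_pos h, dif_pos h]
        refine Function.update_of_ne ?_ _ _
        intro heq
        exact hn (by rw [← h.choose_spec, heq])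
      · rw [dif_neg h, dif_neg h]
    · simp only [h32, if_false, Store.set]

theorem Store.flat_put (σ : Store) (k : Arr) (e : ℕ) (v : ℤ) :
    (σ.put k e v).flat = Function.update σ.flat (16 * e + (32 + k.idx)) v := by
  funext n
  by_cases hn : n = 16 * e + (32 + k.idx)
  · subst hn; simp [Store.flat_arr, Store.put]
  · rw [Function.update_of_ne hn]
    unfold Store.flat
    by_cases h32 : n < 32
    · simp only [h32, if_true, Store.put]
    · simp only [h32, if_false, Store.put]
      by_cases h : ∃ k' : Arr, k'.idx = (n - 32) % 16
      · rw [dif_pos h, dif_pos h]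
        by_cases hk : h.choose = k
        · have hs := h.choose_spec
          rw [hk] at hs
          rw [hk, Function.update_self, Function.update_of_ne]
          omega
        · rw [Function.update_of_ne hk]
      · rw [dif_neg h, dif_neg h]

/-- Puts the address of the cell of the array `k` with the index in `i` into register 31. -/
def addressCode (s : ℕ) (k : Arr) (i : Reg) : List Instr :=
  [.const 31 0, .add 31 31 i.idx, .jpos 31 (s + 4), .const 31 0, .add 31 31 31, .add 31 31 31,
    .add 31 31 31, .add 31 31 31, .const 30 (32 + k.idx), .add 31 31 30]

/-- The instructions for loop-free code that begins at position `s` of a program. -/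
def Code.compile : Code → ℕ → List Instr
  | skip, _ => []
  | const r v, _ => [.const r.idx v]
  | add r a b, _ => [.add r.idx a.idx b.idx]
  | sub r a b, _ => [.sub r.idx a.idx b.idx]
  | load r k i, s => addressCode s k i ++ [.load r.idx 31, .const 31 0, .const 30 0]
  | store k i b, s => addressCode s k i ++ [.store 31 b.idx, .const 31 0, .const 30 0]
  | read t r i, _ => [.read t r.idx i.idx]
  | seq c₁ c₂, s => compile c₁ s ++ compile c₂ (s + (compile c₁ s).length)
  | ifpos a c₁ c₂, s =>
    let l₂ := compile c₂ (s + 1)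
    let l₁ := compile c₁ (s + 3 + l₂.length)
    .jpos a.idx (s + 3 + l₂.length) :: (l₂ ++ (.const 31 1 ::
      .jpos 31 (s + 3 + l₂.length + l₁.length) :: (l₁ ++ [.const 31 0])))

/-- At most `n` steps lead from `c` to `c'`. -/
def Steps (P : Program) (τ : Tapes) (n : ℕ) (c c' : Config) : Prop :=
  ∃ m ≤ n, (step P τ)^[m] c = c'

theorem Steps.refl (P : Program) (τ : Tapes) (c : Config) : Steps P τ 0 c c := ⟨0, le_rfl, rfl⟩

theorem Steps.trans {P : Program} {τ : Tapes} {n n' : ℕ} {c c' c'' : Config}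
    (h : Steps P τ n c c') (h' : Steps P τ n' c' c'') : Steps P τ (n + n') c c'' := by
  obtain ⟨m, hm, rfl⟩ := h
  obtain ⟨m', hm', rfl⟩ := h'
  exact ⟨m' + m, by omega, by rw [Function.iterate_add_apply]⟩

theorem Steps.mono {P : Program} {τ : Tapes} {n n' : ℕ} {c c' : Config}
    (h : Steps P τ n c c') (hn : n ≤ n') : Steps P τ n' c c' := by
  obtain ⟨m, hm, h⟩ := h
  exact ⟨m, hm.trans hn, h⟩

theorem Steps.one (P : Program) (τ : Tapes) (c : Config) : Steps P τ 1 c (step P τ c) :=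
  ⟨1, le_rfl, rfl⟩

/-- The list `l` stands in `P` from position `s` on. -/
def At (P : Program) (s : ℕ) (l : List Instr) : Prop :=
  ∀ i < l.length, P[s + i]? = l[i]?

theorem At.left {P : Program} {s : ℕ} {l l' : List Instr} (h : At P s (l ++ l')) : At P s l := by
  intro i hi
  rw [h i (by simp; omega), List.getElem?_append_left hi]

theorem At.right {P : Program} {s : ℕ} {l l' : List Instr} (h : At P s (l ++ l')) :
    At P (s + l.length) l' := by
  intro i hi
  rw [add_assoc, h _ (by simp; omega), List.getElem?_append_right (by omega)]
  simp

theorem At.head {P : Program} {s : ℕ} {x : Instr} {l : List Instr} (h : At P s (x :: l)) :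
    P[s]? = some x := by simpa using h 0 (by simp)

theorem At.tail {P : Program} {s : ℕ} {x : Instr} {l : List Instr} (h : At P s (x :: l)) :
    At P (s + 1) l := by
  have := At.right (l := [x]) (l' := l) h
  simpa using this

/-- The machine is at position `s` with registers `f`. -/
def AtMem (s : ℕ) (f : ℕ → ℤ) (c : Config) : Prop := c.pc = s ∧ ⇑c.mem = f

section
variable {P : Program} {τ : Tapes} {s : ℕ} {f : ℕ → ℤ} {c : Config}

theorem AtMem.write (h : AtMem s f c) (r : ℕ) (v : ℤ) :
    AtMem (s + 1) (Function.update f r v) (c.write r v) := by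
  obtain ⟨h1, h2⟩ := h
  refine ⟨by simp [Config.write, h1], ?_⟩
  simp only [Config.write, Finsupp.coe_update, h2]

theorem AtMem.step_const {r : ℕ} {v : ℤ} (h : AtMem s f c) (hP : P[s]? = some (.const r v)) :
    AtMem (s + 1) (Function.update f r v) (step P τ c) := by
  have := h.write r v
  unfold step
  rw [h.1, hP]
  exact this

theorem AtMem.step_add {r a b : ℕ} (h : AtMem s f c) (hP : P[s]? = some (.add r a b)) :
    AtMem (s + 1) (Function.update f r (f a + f b)) (step P τ c) := by
  have := h.write r (f a + f b)
  unfold step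
  rw [h.1, hP, h.2]
  exact this

theorem AtMem.step_sub {r a b : ℕ} (h : AtMem s f c) (hP : P[s]? = some (.sub r a b)) :
    AtMem (s + 1) (Function.update f r (f a - f b)) (step P τ c) := by
  have := h.write r (f a - f b)
  unfold step
  rw [h.1, hP, h.2]
  exact this

theorem AtMem.step_load {r a : ℕ} (h : AtMem s f c) (hP : P[s]? = some (.load r a)) :
    AtMem (s + 1) (Function.update f r (f (f a).toNat)) (step P τ c) := by
  have := h.write r (f (f a).toNat)
  unfold step
  rw [h.1, hP, h.2]
  exact this

theorem AtMem.step_store {a b : ℕ} (h : AtMem s f c) (hP : P[s]? = some (.store a b)) :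
    AtMem (s + 1) (Function.update f (f a).toNat (f b)) (step P τ c) := by
  have := h.write (f a).toNat (f b)
  unfold step
  rw [h.1, hP, h.2]
  exact this

theorem AtMem.step_read {t : Tape} {r a : ℕ} (h : AtMem s f c)
    (hP : P[s]? = some (.read t r a)) :
    AtMem (s + 1) (Function.update f r (τ.symbol t (f a).toNat)) (step P τ c) := by
  have := h.write r (τ.symbol t (f a).toNat)
  unfold step
  rw [h.1, hP, h.2]
  exact this

theorem AtMem.step_jpos {a l : ℕ} (h : AtMem s f c) (hP : P[s]? = some (.jpos a l)) :
    AtMem (if 0 < f a then l else s + 1) f (step P τ c) := by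
  obtain ⟨h1, h2⟩ := h
  unfold step
  rw [h1, hP]
  exact ⟨by simp only [h2], h2⟩

/-- There is no multiplication: four doublings turn the index into its 16-fold. The jump replaces a
negative index by zero, in agreement with `Int.toNat` in `Code.eval`. -/
theorem addressCode_correct {k : Arr} {i : Reg} (hA : At P s (addressCode s k i))
    (h : AtMem s f c) :
    ∃ c', Steps P τ 10 c c' ∧ AtMem (s + 10) (Function.update (Function.update f 30 (32 + k.idx)) 31
      (16 * (f i.idx).toNat + (32 + k.idx))) c' := by
  have hi : i.idx ≠ 31 := by have := i.idx_lt; omega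
  have h0 := hA.head
  have t1 := hA.tail
  have h1 := t1.head
  have t2 := t1.tail
  have h2 := t2.head
  have t3 := t2.tail
  have h3 := t3.head
  have t4 := t3.tail
  have h4 := t4.head
  have t5 := t4.tail
  have h5 := t5.head
  have t6 := t5.tail
  have h6 := t6.head
  have t7 := t6.tail
  have h7 := t7.head
  have t8 := t7.tail
  have h8 := t8.head
  have h9 := t8.tail.head
  have e1 := h.step_const (τ := τ) h0
  have e2 := e1.step_add (τ := τ) h1
  have e3 := e2.step_jpos (τ := τ) h2
  -- Both paths meet at position `s + 4`: a positive index jumps over the instruction that resets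
  -- register 31 to zero.
  have key : ∃ c', Steps P τ 4 c c' ∧
      AtMem (s + 4) (Function.update f 31 ((f i.idx).toNat : ℤ)) c' := by
    by_cases hpos : 0 < f i.idx
    · refine ⟨_, ((((Steps.one P τ c).trans (Steps.one P τ _)).trans (Steps.one P τ _)).mono
        (by norm_num)), ?_⟩
      have hpos' : ((f i.idx).toNat : ℤ) = f i.idx := Int.toNat_of_nonneg hpos.le
      simpa [hi, hpos, hpos'] using e3
    · have e4 : AtMem (s + 3) (Function.update f 31 (f i.idx))
          (step P τ (step P τ (step P τ c))) := by
        simpa [hi, hpos, add_assoc] using e3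
      have e5 := e4.step_const (τ := τ) h3
      refine ⟨_, ((((Steps.one P τ c).trans (Steps.one P τ _)).trans (Steps.one P τ _)).trans
        (Steps.one P τ _)), ?_⟩
      have hz : (f i.idx).toNat = 0 := Int.toNat_of_nonpos (not_lt.1 hpos)
      simpa [hz] using e5
  obtain ⟨c', hc', e4⟩ := key
  have e5 := e4.step_add (τ := τ) h4
  have e6 := e5.step_add (τ := τ) h5
  have e7 := e6.step_add (τ := τ) h6
  have e8 := e7.step_add (τ := τ) h7
  have e9 := e8.step_const (τ := τ) h8
  have e10 := e9.step_add (τ := τ) h9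
  refine ⟨_, (((((((hc'.trans (Steps.one P τ _)).trans (Steps.one P τ _)).trans
    (Steps.one P τ _)).trans (Steps.one P τ _)).trans (Steps.one P τ _)).trans
    (Steps.one P τ _))), ?_⟩
  convert e10 using 1
  funext n
  simp only [Function.update_apply]
  by_cases h31 : n = 31
  · subst h31; simp; ring
  · by_cases h30 : n = 30
    · subst h30; simp
    · simp [h31, h30]

/-- All jumps lead forward, so the number of steps is at most the number of instructions. Each piece
clears the scratch registers at its end, hence pieces can be composed through `Store.flat`. -/
theorem Code.compile_correct (k : Code) : ∀ {s : ℕ} {c : Config} {σ : Store},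
    At P s (k.compile s) → AtMem s σ.flat c →
    ∃ c', Steps P τ (k.compile s).length c c' ∧
      AtMem (s + (k.compile s).length) (k.eval τ σ).flat c' := by
  induction k with
  | skip => intro s c σ _ h; exact ⟨c, Steps.refl _ _ _, h⟩
  | const r v =>
    intro s c σ hA h
    refine ⟨_, Steps.one _ _ _, ?_⟩
    have := h.step_const (τ := τ) hA.head
    simpa [Code.eval, Code.compile, Store.flat_set] using this
  | add r a b =>
    intro s c σ hA h
    refine ⟨_, Steps.one _ _ _, ?_⟩
    have := h.step_add (τ := τ) hA.head
    simpa [Code.eval, Code.compile, Store.flat_set, Store.flat_reg] using this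
  | sub r a b =>
    intro s c σ hA h
    refine ⟨_, Steps.one _ _ _, ?_⟩
    have := h.step_sub (τ := τ) hA.head
    simpa [Code.eval, Code.compile, Store.flat_set, Store.flat_reg] using this
  | read t r a =>
    intro s c σ hA h
    refine ⟨_, Steps.one _ _ _, ?_⟩
    have := h.step_read (τ := τ) hA.head
    simpa [Code.eval, Code.compile, Store.flat_set, Store.flat_reg] using this
  | load r k i =>
    intro s c σ hA h
    have hr := r.idx_lt
    obtain ⟨c', hc', e0⟩ := addressCode_correct (τ := τ) hA.left h
    have hR := hA.right
    have e1 := e0.step_load (τ := τ) hR.head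
    have e2 := e1.step_const (τ := τ) hR.tail.head
    have e3 := e2.step_const (τ := τ) hR.tail.tail.head
    refine ⟨_, ((hc'.trans (Steps.one P τ _)).trans (Steps.one P τ _)).trans (Steps.one P τ _), ?_⟩
    refine ⟨e3.1, ?_⟩
    rw [e3.2]
    funext n
    have hk : (16 * ((σ.S i).toNat : ℤ) + (32 + (k.idx : ℤ))).toNat
        = 16 * (σ.S i).toNat + (32 + k.idx) := by omega
    simp only [Code.eval, Store.flat_set, Function.update_apply, Store.flat_reg, if_true, hk]
    by_cases h30 : n = 30
    · subst h30
      rw [if_pos rfl, if_neg (by omega), Store.flat_scratch _ (by norm_num) (by norm_num)]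
    · by_cases h31 : n = 31
      · subst h31
        rw [if_neg (by omega), if_pos rfl, if_neg (by omega),
          Store.flat_scratch _ (by norm_num) (by norm_num)]
      · simp only [h30, h31, if_false]
        by_cases hnr : n = r.idx
        · rw [if_pos hnr, if_pos hnr, if_neg (by omega), if_neg (by omega), Store.flat_arr]
        · rw [if_neg hnr, if_neg hnr]
  | store k i b =>
    intro s c σ hA h
    have hb := b.idx_lt
    obtain ⟨c', hc', e0⟩ := addressCode_correct (τ := τ) hA.left h
    have hR := hA.right
    have e1 := e0.step_store (τ := τ) hR.head
    have e2 := e1.step_const (τ := τ) hR.tail.head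
    have e3 := e2.step_const (τ := τ) hR.tail.tail.head
    refine ⟨_, ((hc'.trans (Steps.one P τ _)).trans (Steps.one P τ _)).trans (Steps.one P τ _), ?_⟩
    refine ⟨e3.1, ?_⟩
    rw [e3.2]
    funext n
    have hk : (16 * ((σ.S i).toNat : ℤ) + (32 + (k.idx : ℤ))).toNat
        = 16 * (σ.S i).toNat + (32 + k.idx) := by omega
    simp only [Code.eval, Store.flat_put, Function.update_apply, Store.flat_reg, if_true, hk]
    by_cases h30 : n = 30
    · subst h30
      rw [if_pos rfl, if_neg (by omega), Store.flat_scratch _ (by norm_num) (by norm_num)]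
    · by_cases h31 : n = 31
      · subst h31
        rw [if_neg (by omega), if_pos rfl, if_neg (by omega),
          Store.flat_scratch _ (by norm_num) (by norm_num)]
      · simp only [h30, h31, if_false]
        by_cases hna : n = 16 * (σ.S i).toNat + (32 + k.idx)
        · rw [if_pos hna, if_pos hna, if_neg (by omega), if_neg (by omega)]
        · rw [if_neg hna, if_neg hna]
  | seq k₁ k₂ ih₁ ih₂ =>
    intro s c σ hA h
    obtain ⟨c', hc', h'⟩ := ih₁ hA.left h
    obtain ⟨c'', hc'', h''⟩ := ih₂ hA.right h'
    refine ⟨c'', ?_, ?_⟩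
    · simpa [Code.compile] using hc'.trans hc''
    · simpa [Code.compile, Code.eval, add_assoc] using h''
  | ifpos a k₁ k₂ ih₁ ih₂ =>
    intro s c σ hA h
    set l₂ := k₂.compile (s + 1) with hl₂
    set l₁ := k₁.compile (s + 3 + l₂.length) with hl₁
    have hA' : At P s (.jpos a.idx (s + 3 + l₂.length) :: (l₂ ++ (.const 31 1 ::
      .jpos 31 (s + 3 + l₂.length + l₁.length) :: (l₁ ++ [.const 31 0])))) := hA
    have hlen : ((Code.ifpos a k₁ k₂).compile s).length = l₁.length + l₂.length + 4 := by
      simp [Code.compile, ← hl₂, ← hl₁]; omega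
    have hA₂ := hA'.tail.left
    have hA₃ := hA'.tail.right
    have hA₁ : At P (s + 3 + l₂.length) (l₁ ++ [.const 31 0]) := by
      have := hA₃.tail.tail
      rwa [show s + 1 + l₂.length + 1 + 1 = s + 3 + l₂.length by omega] at this
    have hend := hA₁.right.head
    have e1 := h.step_jpos (τ := τ) hA'.head
    rw [Store.flat_reg] at e1
    rw [hlen]
    by_cases hpos : 0 < σ.S a
    · rw [if_pos hpos] at e1
      obtain ⟨c', hc', h'⟩ := ih₁ (c := step P τ c) hA₁.left e1
      rw [← hl₁] at hc' h'
      have e2 := h'.step_const (τ := τ) hend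
      refine ⟨_, (((Steps.one P τ c).trans hc').trans (Steps.one P τ _)).mono (by omega), ?_⟩
      refine ⟨by rw [e2.1]; omega, ?_⟩
      rw [e2.2]
      simp only [Code.eval, hpos, if_true]
      rw [Function.update_eq_self_iff, Store.flat_scratch _ (by norm_num) (by norm_num)]
    · rw [if_neg hpos] at e1
      obtain ⟨c', hc', h'⟩ := ih₂ (c := step P τ c) hA₂ e1
      rw [← hl₂] at hc' h'
      have e2 := h'.step_const (τ := τ) hA₃.head
      have e3 := e2.step_jpos (τ := τ) hA₃.tail.head
      -- Register 31 has just been set to 1, so this jump is unconditional. It leads to the last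
      -- instruction, which both branches execute and which clears register 31.
      simp only [Function.update_self, zero_lt_one, if_true] at e3
      have e4 := e3.step_const (τ := τ) hend
      refine ⟨_, (((((Steps.one P τ c).trans hc').trans (Steps.one P τ _)).trans
        (Steps.one P τ _)).trans (Steps.one P τ _)).mono (by omega), ?_⟩
      refine ⟨by rw [e4.1]; omega, ?_⟩
      rw [e4.2]
      simp only [Code.eval, hpos, if_false, Function.update_idem]
      rw [Function.update_eq_self_iff, Store.flat_scratch _ (by norm_num) (by norm_num)]

end

/-! ### Programs as sequences of loops -/

/-- A stage `(k, r)` is the loop `do k while r > 0`. -/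
abbrev Stage := Code × Reg

/-- The instructions for a sequence of stages. -/
def compileStages : List Stage → ℕ → List Instr
  | [], _ => []
  | (k, r) :: l, s =>
    (k.compile s ++ [Instr.jpos r.idx s]) ++
      compileStages l (s + (k.compile s ++ [Instr.jpos r.idx s]).length)

/-- The machine program: the stages, and then acceptance if `flag > 0`. -/
def compileProgram (l : List Stage) : Program :=
  let p := compileStages l 0
  p ++ [.jpos Reg.flag.idx (p.length + 2), .halt false, .halt true]

/-- All values in the store have absolute value at most `B`. -/
def Store.Bdd (B : ℤ) (σ : Store) : Prop := (∀ r, |σ.S r| ≤ B) ∧ ∀ k e, |σ.A k e| ≤ B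

/-- The loop `do k while r > 0` turns `σ` into `σ'` in at most `n` rounds, and at the beginning of
each round and at the end all values are at most `B`. -/
def Stage.Runs (τ : Tapes) (B : ℤ) (g : Stage) (n : ℕ) (σ σ' : Store) : Prop :=
  ∃ m < n, (g.1.eval τ)^[m + 1] σ = σ' ∧ ¬ 0 < σ'.S g.2 ∧
    ∀ i < m, 0 < ((g.1.eval τ)^[i + 1] σ).S g.2 ∧ ((g.1.eval τ)^[i + 1] σ).Bdd B

/-- A sequence of loops with at most `n` rounds altogether. -/
inductive RunsAll (τ : Tapes) (B : ℤ) : List Stage → ℕ → Store → Store → Prop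
  | nil (σ : Store) : RunsAll τ B [] 0 σ σ
  | cons {g : Stage} {l : List Stage} {n n' : ℕ} {σ σ' σ'' : Store} (h : g.Runs τ B n σ σ')
      (hb : σ'.Bdd B) (h' : RunsAll τ B l n' σ' σ'') : RunsAll τ B (g :: l) (n + n') σ σ''

theorem RunsAll.append {τ : Tapes} {B : ℤ} {l l' : List Stage} {n n' : ℕ} {σ σ' σ'' : Store}
    (h : RunsAll τ B l n σ σ') (h' : RunsAll τ B l' n' σ' σ'') :
    RunsAll τ B (l ++ l') (n + n') σ σ'' := by
  induction h with
  | nil σ => simpa using h'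
  | cons h hb _ ih =>
    rw [add_assoc]
    exact RunsAll.cons h hb (ih h')

theorem Store.Bdd.bounded {β : ℕ} {σ : Store} {c : Config} (h : σ.Bdd (2 ^ β))
    (hc : ⇑c.mem = σ.flat) : c.Bounded β := by
  intro n
  rw [hc]
  unfold Store.flat
  split_ifs
  · exact h.1 _
  · simp
  · exact h.2 _ _
  · simp

section
variable {P : Program} {τ : Tapes} {β : ℕ}

/-- The cost of a round, if all values have at most `β` bits. -/
def roundCost (P : Program) (β : ℕ) : ℕ := (P.length + 1) * (2 * (β + (P.length + 1)) + 4)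

theorem length_le_of_at {s : ℕ} {l : List Instr} (h : At P s l) : l.length ≤ P.length := by
  rcases Nat.eq_zero_or_pos l.length with h0 | h0
  · omega
  · have := h (l.length - 1) (by omega)
    rw [List.getElem?_eq_getElem (by omega : l.length - 1 < l.length)] at this
    obtain ⟨h1, _⟩ := List.getElem?_eq_some_iff.1 this
    omega

/-- A round is loop-free and takes at most as many steps as the program has instructions. So
`reach_of_iterate` applies with a bound on the values at the start of the round alone. -/
theorem round_reach (hP : ∀ i ∈ P, i.magnitude ≤ β) {k : Code} {r : Reg} {s : ℕ} {σ : Store}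
    {c : Config} (hA : At P s (k.compile s ++ [Instr.jpos r.idx s])) (h : AtMem s σ.flat c)
    (hb : σ.Bdd (2 ^ β)) :
    ∃ c', Reach P τ c c' (roundCost P β) ∧
      AtMem (if 0 < (k.eval τ σ).S r then s else s + (k.compile s ++ [Instr.jpos r.idx s]).length)
        (k.eval τ σ).flat c' := by
  obtain ⟨c', hc', h'⟩ := k.compile_correct (τ := τ) hA.left h
  have e := h'.step_jpos (τ := τ) hA.right.head
  have hlen := length_le_of_at hA
  rw [List.length_append, List.length_singleton] at hlen
  obtain ⟨m, hm, hmc⟩ := hc'.trans (Steps.one P τ c')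
  refine ⟨step P τ c', ?_, ?_⟩
  · rw [← hmc]
    exact reach_of_iterate hP (hb.bounded h.2) (by omega)
  · rw [Store.flat_reg] at e
    simpa [add_assoc] using e

theorem stage_reach (hP : ∀ i ∈ P, i.magnitude ≤ β) {g : Stage} {s : ℕ} {n : ℕ} {σ σ' : Store}
    {c : Config} (hA : At P s (g.1.compile s ++ [Instr.jpos g.2.idx s])) (h : AtMem s σ.flat c)
    (hb : σ.Bdd (2 ^ β)) (hr : g.Runs τ (2 ^ β) n σ σ') :
    ∃ c', Reach P τ c c' (n * roundCost P β) ∧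
      AtMem (s + (g.1.compile s ++ [Instr.jpos g.2.idx s]).length) σ'.flat c' := by
  obtain ⟨m, hm, hσ', hend, hi⟩ := hr
  have key : ∀ i ≤ m, ∃ c', Reach P τ c c' (i * roundCost P β) ∧
      AtMem s ((g.1.eval τ)^[i] σ).flat c' ∧ ((g.1.eval τ)^[i] σ).Bdd (2 ^ β) := by
    intro i
    induction i with
    | zero => intro _; exact ⟨c, by simpa using Reach.refl P τ c, h, hb⟩
    | succ i ih =>
      intro him
      obtain ⟨c', h1, h2, h3⟩ := ih (by omega)
      obtain ⟨c'', h4, h5⟩ := round_reach (τ := τ) hP hA h2 h3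
      obtain ⟨h6, h7⟩ := hi i (by omega)
      rw [← Function.iterate_succ_apply' (g.1.eval τ), if_pos h6] at h5
      exact ⟨c'', by rw [Nat.succ_mul]; exact h1.trans h4, h5, h7⟩
  obtain ⟨c', h1, h2, h3⟩ := key m le_rfl
  obtain ⟨c'', h4, h5⟩ := round_reach (τ := τ) hP hA h2 h3
  rw [← Function.iterate_succ_apply' (g.1.eval τ), hσ', if_neg hend] at h5
  refine ⟨c'', (h1.trans h4).mono ?_, h5⟩
  rw [← Nat.succ_mul]
  exact Nat.mul_le_mul_right _ hm

theorem stages_reach (hP : ∀ i ∈ P, i.magnitude ≤ β) {l : List Stage} {n : ℕ} {σ σ' : Store}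
    (hr : RunsAll τ (2 ^ β) l n σ σ') : ∀ {s : ℕ} {c : Config}, At P s (compileStages l s) →
    AtMem s σ.flat c → σ.Bdd (2 ^ β) →
    ∃ c', Reach P τ c c' (n * roundCost P β) ∧
      AtMem (s + (compileStages l s).length) σ'.flat c' ∧ σ'.Bdd (2 ^ β) := by
  induction hr with
  | nil σ =>
    intro s c _ h hb
    exact ⟨c, by simpa using Reach.refl P τ c, h, hb⟩
  | cons h hb _ ih =>
    intro s c hA hc hb'
    obtain ⟨c', h1, h2⟩ := stage_reach (τ := τ) hP hA.left hc hb' h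
    obtain ⟨c'', h3, h4, h5⟩ := ih hA.right h2 hb
    refine ⟨c'', ?_, ?_, h5⟩
    · rw [Nat.add_mul]; exact h1.trans h3
    · simpa [compileStages, add_assoc, add_comm, add_left_comm] using h4

end

/-- The store of the beginning. -/
def Store.init : Store := ⟨fun _ => 0, fun _ _ => 0⟩

theorem Store.flat_init : Store.init.flat = 0 := by
  funext n
  unfold Store.flat Store.init
  simp

/-- A run of the stages yields a run of the compiled program. -/
theorem compileProgram_correct {l : List Stage} {τ : Tapes} {β n : ℕ} {σ : Store}
    (hβ : ∀ i ∈ compileProgram l, i.magnitude ≤ β)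
    (hr : RunsAll τ (2 ^ β) l n Store.init σ) :
    RunsWithin (compileProgram l) τ (((n + 1) * roundCost (compileProgram l) β : ℕ) : ℝ)
      (((n + 1) * roundCost (compileProgram l) β : ℕ) : ℝ) ∧
    (Accepts (compileProgram l) τ ↔ 0 < σ.S .flag) := by
  set P := compileProgram l with hPdef
  have hAP : At P 0 (compileStages l 0 ++
      [.jpos Reg.flag.idx ((compileStages l 0).length + 2), .halt false, .halt true]) := by
    intro i _
    simp [hPdef, compileProgram]
  obtain ⟨c, h1, h2, h3⟩ := stages_reach (τ := τ) hβ hr (c := ⟨0, 0⟩) hAP.left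
    ⟨rfl, by rw [Store.flat_init]; rfl⟩ ⟨fun r => by simp [Store.init], fun k e => by simp [Store.init]⟩
  have hR := hAP.right
  have e := h2.step_jpos (τ := τ) hR.head
  rw [Store.flat_reg] at e
  -- The final jump to one of the two halting instructions is charged as one more round, whence `n +
  -- 1`.
  have h4 : Reach P τ c (step P τ c) (roundCost P β) := by
    refine (reach_of_iterate (m := 1) (n := P.length + 1) hβ (h3.bounded h2.2) (by omega)).mono ?_
    rfl
  obtain ⟨m, hm, hcost, hspace⟩ := h1.trans h4
  have hpc : P[(configAt P τ m).pc]? = some (.halt (decide (0 < σ.S .flag))) := by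
    unfold configAt
    rw [hm, e.1]
    by_cases hf : 0 < σ.S .flag
    · have := hR.tail.tail.head
      simp only [hf, if_true, decide_true, ← this]
      congr 1
      omega
    · have := hR.tail.head
      simp only [hf, if_false, decide_false, ← this]
  refine ⟨⟨m, Or.inr ⟨_, hpc⟩, ?_, ?_⟩, ?_⟩
  · rw [Nat.succ_mul]
    exact_mod_cast hcost
  · intro j hj
    have := hspace j hj
    rw [Nat.succ_mul]
    have h0 : (⟨0, 0⟩ : Config).space = 0 := by simp [Config.space]
    rw [h0, zero_add] at this
    exact_mod_cast this
  · rw [accepts_iff_of_halt hpc]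
    simp

/-! ### Symbolic execution -/

theorem Store.set_S (σ : Store) (r q : Reg) (v : ℤ) :
    (σ.set r v).S q = if q = r then v else σ.S q := by
  simp [Store.set, Function.update_apply]

@[simp] theorem Store.set_S_self (σ : Store) (r : Reg) (v : ℤ) : (σ.set r v).S r = v := by
  simp [Store.set_S]

@[simp] theorem Store.set_A (σ : Store) (r : Reg) (v : ℤ) : (σ.set r v).A = σ.A := rfl

@[simp] theorem Store.put_S (σ : Store) (k : Arr) (e : ℕ) (v : ℤ) : (σ.put k e v).S = σ.S := rfl

@[simp] theorem Store.put_A_self (σ : Store) (k : Arr) (e : ℕ) (v : ℤ) :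
    (σ.put k e v).A k = Function.update (σ.A k) e v := by simp [Store.put]

theorem Store.put_A (σ : Store) (k k' : Arr) (e : ℕ) (v : ℤ) :
    (σ.put k e v).A k' = if k' = k then Function.update (σ.A k) e v else σ.A k' := by
  unfold Store.put
  by_cases h : k' = k
  · subst h; simp
  · simp [h]

/-- Consecutive execution. -/
def block : List Code → Code
  | [] => .skip
  | c :: l => .seq c (block l)

theorem Store.Bdd.set {B : ℤ} {σ : Store} (h : σ.Bdd B) {r : Reg} {v : ℤ} (hv : |v| ≤ B) :
    (σ.set r v).Bdd B :=
  ⟨fun q => by rw [Store.set_S]; split_ifs; exacts [hv, h.1 q], h.2⟩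

theorem Store.Bdd.put {B : ℤ} {σ : Store} (h : σ.Bdd B) {k : Arr} {e : ℕ} {v : ℤ}
    (hv : |v| ≤ B) : (σ.put k e v).Bdd B := by
  refine ⟨h.1, fun k' e' => ?_⟩
  rw [Store.put_A]
  split_ifs with hk
  · rw [Function.update_apply]
    split_ifs
    exacts [hv, h.2 k e']
  · exact h.2 k' e'

/-- The stores differ at most in the given variables and arrays. -/
def Frame (W : List Reg) (WA : List Arr) (σ₀ σ : Store) : Prop :=
  (∀ q, q ∉ W → σ.S q = σ₀.S q) ∧ ∀ k, k ∉ WA → σ.A k = σ₀.A k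

theorem Frame.refl (W : List Reg) (WA : List Arr) (σ : Store) : Frame W WA σ σ :=
  ⟨fun _ _ => rfl, fun _ _ => rfl⟩

theorem Frame.trans {W : List Reg} {WA : List Arr} {σ₀ σ₁ σ₂ : Store} (h : Frame W WA σ₀ σ₁)
    (h' : Frame W WA σ₁ σ₂) : Frame W WA σ₀ σ₂ :=
  ⟨fun q hq => (h'.1 q hq).trans (h.1 q hq), fun k hk => (h'.2 k hk).trans (h.2 k hk)⟩

theorem Frame.set {W : List Reg} {WA : List Arr} {σ₀ σ : Store} (h : Frame W WA σ₀ σ) {r : Reg}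
    {v : ℤ} (hr : r ∈ W) : Frame W WA σ₀ (σ.set r v) := by
  refine ⟨fun q hq => ?_, h.2⟩
  rw [Store.set_S, if_neg, h.1 q hq]
  rintro rfl
  exact hq hr

theorem Frame.put {W : List Reg} {WA : List Arr} {σ₀ σ : Store} (h : Frame W WA σ₀ σ) {k : Arr}
    {e : ℕ} {v : ℤ} (hk : k ∈ WA) : Frame W WA σ₀ (σ.put k e v) := by
  refine ⟨h.1, fun k' hk' => ?_⟩
  rw [Store.put_A, if_neg, h.2 k' hk']
  rintro rfl
  exact hk' hk

theorem Frame.mono {W W' : List Reg} {WA WA' : List Arr} {σ₀ σ : Store} (h : Frame W WA σ₀ σ)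
    (hW : W ⊆ W') (hWA : WA ⊆ WA') : Frame W' WA' σ₀ σ :=
  ⟨fun q hq => h.1 q fun h' => hq (hW h'), fun k hk => h.2 k fun h' => hk (hWA h')⟩

/-- `d := (a + b) mod m`, if `0 ≤ a + b < 2 m`. -/
def addMod (d a b m : Reg) : Code :=
  block [.add d a b, .sub .t m d, .ifpos .t .skip (.sub d d m), .const .t 0]

/-- `d := (a - b) mod m`, if `-m ≤ a - b < m`. -/
def subMod (d a b m : Reg) : Code :=
  block [.sub d a b, .sub .t .zero d, .ifpos .t (.add d d m) .skip, .const .t 0]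

/-- One conditional subtraction replaces a division. Clearing `t` makes the effect independent of
the branch taken, so that the code can be rewritten as two assignments. -/
theorem addMod_eval {τ : Tapes} {σ : Store} {d a b m : Reg} (hd : d ≠ .t) (hm : m ≠ .t)
    (hdm : d ≠ m) (h0 : 0 ≤ σ.S a + σ.S b) (h1 : σ.S a + σ.S b < 2 * σ.S m) :
    (addMod d a b m).eval τ σ = (σ.set d ((σ.S a + σ.S b) % σ.S m)).set .t 0 := by
  have hmd : m ≠ d := hdm.symm
  have ht : Reg.t ≠ d := hd.symm
  by_cases h : 0 < σ.S m - (σ.S a + σ.S b)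
  · have hv : (σ.S a + σ.S b) % σ.S m = σ.S a + σ.S b := Int.emod_eq_of_lt h0 (by omega)
    rw [hv]
    simp only [addMod, block, Code.eval]
    simp only [Store.set_S, hmd, hd, hm, h, ht, if_true, if_false]
    ext q
    · simp only [Store.set_S]; split_ifs <;> rfl
    · rfl
  · have hv : (σ.S a + σ.S b) % σ.S m = σ.S a + σ.S b - σ.S m := by
      rw [← Int.sub_emod_right, Int.emod_eq_of_lt (by linarith) (by linarith)]
    rw [hv]
    simp only [addMod, block, Code.eval]
    simp only [Store.set_S, hmd, hd, hm, h, ht, if_true, if_false]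
    ext q
    · simp only [Store.set_S]; split_ifs <;> rfl
    · rfl

theorem subMod_eval {τ : Tapes} {σ : Store} {d a b m : Reg} (hd : d ≠ .t) (hm : m ≠ .t)
    (hdm : d ≠ m) (hdz : d ≠ .zero) (hz : σ.S .zero = 0) (h0 : -σ.S m ≤ σ.S a - σ.S b)
    (h1 : σ.S a - σ.S b < σ.S m) :
    (subMod d a b m).eval τ σ = (σ.set d ((σ.S a - σ.S b) % σ.S m)).set .t 0 := by
  have hmd : m ≠ d := hdm.symm
  have ht : Reg.t ≠ d := hd.symm
  have hzd : Reg.zero ≠ d := hdz.symm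
  by_cases h : 0 < 0 - (σ.S a - σ.S b)
  · have hv : (σ.S a - σ.S b) % σ.S m = σ.S a - σ.S b + σ.S m := by
      rw [← Int.add_emod_right, Int.emod_eq_of_lt (by linarith) (by linarith)]
    rw [hv]
    simp only [subMod, block, Code.eval]
    simp only [Store.set_S, hmd, hd, hm, h, ht, hzd, hz, if_true, if_false]
    ext q
    · simp only [Store.set_S]; split_ifs <;> rfl
    · rfl
  · have hv : (σ.S a - σ.S b) % σ.S m = σ.S a - σ.S b := Int.emod_eq_of_lt (by linarith) h1
    rw [hv]
    simp only [subMod, block, Code.eval]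
    simp only [Store.set_S, hmd, hd, hm, h, ht, hzd, hz, if_true, if_false]
    ext q
    · simp only [Store.set_S]; split_ifs <;> rfl
    · rfl

/-! ### Rules for stages -/

/-- Running `l` on `σ` takes at most `n` rounds and ends in a store with the property `Q`. -/
def Ends (τ : Tapes) (B : ℤ) (l : List Stage) (n : ℕ) (σ : Store) (Q : Store → Prop) : Prop :=
  ∃ σ', (∃ n' ≤ n, RunsAll τ B l n' σ σ') ∧ σ'.Bdd B ∧ Q σ'

section
variable {τ : Tapes} {B : ℤ} {n n' : ℕ} {l l' : List Stage} {σ : Store} {Q Q' : Store → Prop}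

theorem Ends.append (h : Ends τ B l n σ Q)
    (h' : ∀ σ', σ'.Bdd B → Q σ' → Ends τ B l' n' σ' Q') : Ends τ B (l ++ l') (n + n') σ Q' := by
  obtain ⟨σ', ⟨m, hm, h1⟩, h2, h3⟩ := h
  obtain ⟨σ'', ⟨m', hm', h4⟩, h5, h6⟩ := h' σ' h2 h3
  exact ⟨σ'', ⟨m + m', by omega, h1.append h4⟩, h5, h6⟩

theorem Ends.imp (h : Ends τ B l n σ Q) (h' : ∀ σ', Q σ' → Q' σ') : Ends τ B l n σ Q' := by
  obtain ⟨σ', h1, h2, h3⟩ := h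
  exact ⟨σ', h1, h2, h' σ' h3⟩

theorem Ends.mono (h : Ends τ B l n σ Q) (hn : n ≤ n') : Ends τ B l n' σ Q := by
  obtain ⟨σ', ⟨m, hm, h1⟩, h2⟩ := h
  exact ⟨σ', ⟨m, hm.trans hn, h1⟩, h2⟩

theorem Ends.single {g : Stage} {σ' : Store} (h : g.Runs τ B n σ σ') (hb : σ'.Bdd B) (hQ : Q σ') :
    Ends τ B [g] n σ Q :=
  ⟨σ', ⟨n, le_rfl, RunsAll.cons (n' := 0) h hb (RunsAll.nil _)⟩, hb, hQ⟩

/-- With the variable `zero` as its condition a loop is executed exactly once; this embeds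
straight-line code among the stages. -/
theorem Ends.code {c : Code} (hz : (c.eval τ σ).S .zero = 0) (hb : (c.eval τ σ).Bdd B)
    (hQ : Q (c.eval τ σ)) : Ends τ B [(c, .zero)] 1 σ Q :=
  Ends.single ⟨0, by norm_num, rfl, by simp [hz], by simp⟩ hb hQ

/-- The condition is tested after the body: `m` rounds continue and one more round leaves the loop.
-/
theorem Ends.loop {c : Code} {r : Reg} (I : ℕ → Store → Prop) (m : ℕ) (h0 : I 0 σ)
    (hb : σ.Bdd B)
    (hstep : ∀ i < m, ∀ σ, σ.Bdd B → I i σ →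
      (c.eval τ σ).Bdd B ∧ I (i + 1) (c.eval τ σ) ∧ 0 < (c.eval τ σ).S r)
    (hend : ∀ σ, σ.Bdd B → I m σ →
      (c.eval τ σ).Bdd B ∧ Q (c.eval τ σ) ∧ ¬ 0 < (c.eval τ σ).S r) :
    Ends τ B [(c, r)] (m + 1) σ Q := by
  have key : ∀ i ≤ m, ((c.eval τ)^[i] σ).Bdd B ∧ I i ((c.eval τ)^[i] σ) := by
    intro i
    induction i with
    | zero => intro _; exact ⟨hb, h0⟩
    | succ i ih =>
      intro hi
      obtain ⟨h1, h2⟩ := ih (by omega)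
      rw [Function.iterate_succ_apply']
      obtain ⟨h3, h4, -⟩ := hstep i (by omega) _ h1 h2
      exact ⟨h3, h4⟩
  obtain ⟨h1, h2⟩ := key m le_rfl
  obtain ⟨h3, h4, h5⟩ := hend _ h1 h2
  rw [← Function.iterate_succ_apply' (c.eval τ)] at h3 h4 h5
  refine Ends.single ⟨m, Nat.lt_succ_self m, rfl, h5, fun i hi => ?_⟩ h3 h4
  obtain ⟨h6, h7⟩ := key i hi.le
  obtain ⟨h8, -, h10⟩ := hstep i hi _ h6 h7
  rw [← Function.iterate_succ_apply' (c.eval τ)] at h8 h10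
  exact ⟨h10, h8⟩

end

/-! ### The program -/

/-- Sets the constants. -/
def initCode : Code :=
  block [.const .one 1, .const .four 4, .const .N 1, .const .D 1, .const .L 2]

/-- Reads a bit of the proof and a coin. -/
def proofBody : Code :=
  block [.read .proof .c0 .pos, .add .ck .c0 .one, .ifpos .ck
    (block [.add .N .N .N, .add .L .L .L, .add .sg .sg .sg, .add .sg .sg .c0,
      .read .coins .b .pos, .add .r .r .r, .add .r .r .b, .add .pos .pos .one]) .skip]

/-- Reads a coin for a cell of the input. -/
def scaleBody : Code :=
  block [.read .input .c0 .p, .add .ck .c0 .one, .ifpos .ck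
    (block [.add .N .N .N, .add .D .D .D, .add .sg .sg .sg, .read .coins .b .pos,
      .add .r .r .r, .add .r .r .b, .add .rl .rl .rl, .add .rl .rl .b,
      .add .pos .pos .one, .add .p .p .one]) .skip]

/-- Prepares decoding. -/
def decodeInit : Code := block [.const .p 0, .const .go 1]

/-- Processes a digit. -/
def digitCode : Code :=
  block [.ifpos .st
    (block [.add .v .v .v, .add .v .v .c1, addMod .xv .xv .xv .N, addMod .yv .yv .yv .D,
      .ifpos .c1 (block [addMod .xv .xv .r .N, addMod .yv .yv .rl .D]) .skip])
    (block [.add .sgn .c1 .zero, .const .st 1]), .add .p .p .one, .add .p .p .one]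

/-- Processes the end of an integer. -/
def finishCode : Code :=
  block [.ifpos .sgn (block [.sub .v .zero .v, subMod .xv .zero .xv .N, subMod .yv .zero .yv .D])
      .skip,
    .store .A .cnt .v, .store .XA .cnt .xv, .store .YA .cnt .yv, .const .v 0, .const .xv 0,
    .const .yv 0, .const .sgn 0, .const .st 0, .add .cnt .cnt .one, .add .p .p .one]

/-- Reads the next token of the input. -/
def decodeBody : Code :=
  block [.read .input .c0 .p, .add .a .p .one, .read .input .c1 .a, .ifpos .c0
    (block [.add .ck .c1 .one, .ifpos .ck digitCode (.const .go 0)])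
    (block [.add .ck .c0 .one, .ifpos .ck finishCode (.const .go 0)])]

/-- Prepares the list of the subset sums of group `g`. -/
def listInit (g : ℕ) : Code := block [.const .i (1 + g : ℕ), .const .pw 1, .const .j 1]

/-- Computes the next subset sum and its residues. -/
def listBody : Code :=
  block [.sub .t .j .pw, .load .b .V .t, .load .a .A .i, .add .a .a .b, .store .V .j .a,
    .load .b .X .t, .load .a .XA .i, addMod .a .a .b .N, .store .X .j .a,
    .sub .t .j .pw, .load .b .Y .t, .load .a .YA .i, addMod .a .a .b .D, .store .Y .j .a,
    .add .j .j .one, .add .a .pw .pw, .sub .a .a .j,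
    .ifpos .a .skip (block [.add .pw .pw .pw, .add .i .i .four]), .sub .ck .L .j]

/-- Inserts the next subset sum into its bucket. -/
def insertBody (hd nx : Arr) : Code :=
  block [.load .v .V .j, .add .v .v .D, .load .t nx .v, .ifpos .t .skip
      (block [.load .a .X .j, .load .b .Y .j, .sub .a .a .b, .load .b hd .a, .add .b .b .one,
        .store nx .v .b, .add .b .v .one, .store hd .a .b]),
    .add .j .j .one, .sub .ck .L .j]

/-- Prepares the enumeration of pairs. -/
def enumInit : Code :=
  block [.const .p 0, .const .j (-1), .add .F .L .L, .add .F .F .F, .add .F .F .F, .add .F .F .F,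
    .add .F .F .F, .add .F .F .F]

/-- Treats the next pair with the given action, or goes on to the next bucket. -/
def enumBody (hd nx : Arr) (action : Code) : Code :=
  block [.ifpos .p
      (block [.sub .v .p .one, .load .a .V .j, .add .a .a .v, action, .load .p nx .v,
        .sub .p .p .one])
      (block [.add .j .j .one, .load .a .X .j, .load .b .Y .j, .sub .a .a .b,
        subMod .q .sg .a .N, .load .p hd .q]),
    .sub .F .F .one]

/-- Marks a sum of the first half. -/
def markCode : Code := block [.add .a .a .one, .store .mark .a .one]

/-- Looks for the complement of a sum of the second half. -/
def checkCode : Code :=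
  block [.load .b .A .zero, .sub .b .b .a, .add .b .b .D, .add .b .b .D, .add .b .b .one,
    .load .a .mark .b, .ifpos .a (.const .flag 1) .skip]

/-- The bucket of the target minus that of the first half. -/
def complementCode : Code :=
  block [.load .a .XA .zero, .load .b .YA .zero, .sub .a .a .b, subMod .sg .a .sg .N]

/-- The preceding bucket. -/
def shiftCode : Code := subMod .sg .sg .D .N

/-- The stages that compute the list of the subset sums of group `g`. -/
def listStages (g : ℕ) : List Stage := [(listInit g, .zero), (listBody, .ck)]

/-- The stages that fill the buckets. -/
def insertStages (hd nx : Arr) : List Stage :=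
  [(.const .j 0, .zero), (insertBody hd nx, .ck)]

/-- The stages that enumerate pairs. -/
def enumStages (hd nx : Arr) (action : Code) : List Stage :=
  [(enumInit, .zero), (enumBody hd nx action, .F)]

/-- The stages that read the tapes. -/
def readStages : List Stage :=
  [(initCode, .zero), (proofBody, .ck)] ++ ([(scaleBody, .ck)] ++
    [(decodeInit, .zero), (decodeBody, .go)])

/-- The stages for the first half. -/
def firstStages : List Stage :=
  listStages 1 ++ (insertStages .hd0 .nx0 ++ (listStages 0 ++ enumStages .hd0 .nx0 markCode))

/-- The stages for the second half. -/
def secondStages : List Stage :=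
  listStages 3 ++ (insertStages .hd1 .nx1 ++ (listStages 2 ++
    ([(complementCode, .zero)] ++ (enumStages .hd1 .nx1 checkCode ++
      ([(shiftCode, .zero)] ++ (enumStages .hd1 .nx1 checkCode ++
        ([(shiftCode, .zero)] ++ (enumStages .hd1 .nx1 checkCode ++
          ([(shiftCode, .zero)] ++ enumStages .hd1 .nx1 checkCode)))))))))

/-- All stages of the verifier. -/
def verifierStages : List Stage :=
  readStages ++ (firstStages ++ (secondStages ++ [(.ifpos .cnt .skip (.const .flag 0), .zero)]))

/-- The verifier. -/
def verifier : Program := compileProgram verifierStages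

/-! ### Reading the proof and the coins -/

/-- The number with the first `m` coins as its binary digits. -/
def coinNum (ω : ℕ → Bool) : ℕ → ℕ
  | 0 => 0
  | m + 1 => 2 * coinNum ω m + (ω m).toNat

theorem coinNum_lt (ω : ℕ → Bool) (m : ℕ) : coinNum ω m < 2 ^ m := by
  induction m with
  | zero => simp [coinNum]
  | succ m ih =>
    have := Bool.toNat_le (ω m)
    rw [coinNum, pow_succ]
    omega

theorem natOfBits_append_singleton (l : List Bool) (b : Bool) :
    natOfBits (l ++ [b]) = 2 * natOfBits l + b.toNat := by
  simp [natOfBits]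

theorem natOfBits_lt (l : List Bool) : natOfBits l < 2 ^ l.length := by
  induction l using List.reverseRecOn with
  | nil => simp [natOfBits]
  | append_singleton l b ih =>
    have := Bool.toNat_le b
    rw [natOfBits_append_singleton, List.length_append, List.length_singleton, pow_succ]
    omega

theorem bitVal_eq (b : Bool) : bitVal b = b.toNat := by cases b <;> rfl

theorem cellVal_of_lt {l : List Bool} {i : ℕ} (h : i < l.length) : cellVal l i = bitVal l[i] := by
  simp [cellVal, h]

theorem cellVal_of_le {l : List Bool} {i : ℕ} (h : l.length ≤ i) : cellVal l i = -1 := by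
  simp [cellVal, h]

/-- The store after reading `i` bits of the proof and `j` cells of the input. -/
structure ReadInv (ω : ℕ → Bool) (π : List Bool) (i j : ℕ) (σ : Store) : Prop where
  zero : σ.S .zero = 0
  one : σ.S .one = 1
  four : σ.S .four = 4
  N : σ.S .N = 2 ^ (i + j)
  D : σ.S .D = 2 ^ j
  L : σ.S .L = 2 ^ (i + 1)
  sg : σ.S .sg = natOfBits (π.take i) * 2 ^ j
  r : σ.S .r = coinNum ω (i + j)
  rl : σ.S .rl = coinNum ω (i + j) % 2 ^ j
  pos : σ.S .pos = (i + j : ℕ)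
  p : σ.S .p = j
  frame : Frame [.one, .four, .N, .D, .L, .sg, .r, .rl, .pos, .p, .c0, .ck, .b] [] Store.init σ

theorem int_two_pow_le {e f : ℕ} (h : e ≤ f) : (2 : ℤ) ^ e ≤ 2 ^ f :=
  pow_le_pow_right₀ (by norm_num) h

theorem natCast_lt_two_pow {m e : ℕ} (h : m ≤ e) : (m : ℤ) < 2 ^ e := by
  exact_mod_cast lt_of_le_of_lt h (Nat.lt_two_pow_self (n := e))

/-- The verifier learns `k` only by running into the end of the message. A bit plus one is positive,
while the end symbol `-1` gives zero. Doubling `N` and `L` along the way produces `2 ^ k` and `2 ^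
(k + 1)`, and the `k` coins read meanwhile are the leading bits of the multiplier. -/
theorem readProof_ends {τ : Tapes} {X : ℕ} (hk : τ.proof.length ≤ X) :
    Ends τ (2 ^ (2 * X + 20)) [(initCode, .zero), (proofBody, .ck)]
      (1 + (τ.proof.length + 1)) Store.init (ReadInv τ.coins τ.proof τ.proof.length 0) := by
  have hB : (2 : ℤ) ^ 20 ≤ 2 ^ (2 * X + 20) := int_two_pow_le (by omega)
  norm_num at hB
  have h1 : Ends τ (2 ^ (2 * X + 20)) [(initCode, .zero)] 1 Store.init
      (ReadInv τ.coins τ.proof 0 0) := by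
    obtain ⟨σ', hσ'⟩ : ∃ σ', σ' = initCode.eval τ Store.init := ⟨_, rfl⟩
    have e := hσ'
    simp only [initCode, block, Code.eval] at e
    apply Ends.code
    · rw [← hσ', e]; simp [Store.set_S, Store.init]
    · rw [← hσ', e]
      refine Store.Bdd.set (Store.Bdd.set (Store.Bdd.set (Store.Bdd.set (Store.Bdd.set
        ⟨fun r => ?_, fun k e => ?_⟩ ?_) ?_) ?_) ?_) ?_ <;> norm_num [Store.init] <;> linarith
    · rw [← hσ', e]
      constructor
      case frame =>
        repeat' apply Frame.set
        · exact Frame.refl _ _ _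
        all_goals decide
      all_goals simp [Store.set_S, Store.init, coinNum, natOfBits]
  refine h1.append (l := [(initCode, .zero)]) fun σ hb hσ => ?_
  refine Ends.loop (fun i σ => ReadInv τ.coins τ.proof i 0 σ) τ.proof.length hσ hb ?_ ?_
  · intro i hi σ hb h
    obtain ⟨b, hbit⟩ : ∃ b, τ.proof[i] = b := ⟨_, rfl⟩
    have hc : cellVal τ.proof i = bitVal b := by rw [cellVal_of_lt hi, hbit]
    have hpos : 0 < bitVal b + 1 := by cases b <;> simp [bitVal]
    have hz := h.zero
    have h1 := h.one
    have hpc := h.pos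
    rw [add_zero] at hpc
    obtain ⟨σ', hσ'⟩ : ∃ σ', σ' = proofBody.eval τ σ := ⟨_, rfl⟩
    have e := hσ'
    simp only [proofBody, block, Code.eval, Store.set_S, h1, hpc, Tapes.symbol, reduceCtorEq,
      if_true, if_false, Int.toNat_natCast, hc, hpos] at e
    have hbv : 0 ≤ bitVal b ∧ bitVal b ≤ 1 := by cases b <;> simp [bitVal]
    have hcv : 0 ≤ bitVal (τ.coins i) ∧ bitVal (τ.coins i) ≤ 1 := by
      cases τ.coins i <;> simp [bitVal]
    have hsg : (natOfBits (τ.proof.take i) : ℤ) < 2 ^ i := by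
      have := natOfBits_lt (τ.proof.take i)
      rw [List.length_take, min_eq_left hi.le] at this
      exact_mod_cast this
    have hr : (coinNum τ.coins i : ℤ) < 2 ^ i := by exact_mod_cast coinNum_lt τ.coins i
    have hi2 : (i : ℤ) < 2 ^ i := natCast_lt_two_pow le_rfl
    have hbig : (2 : ℤ) ^ (i + 3) ≤ 2 ^ (2 * X + 20) := int_two_pow_le (by omega)
    rw [pow_add] at hbig
    have hNs := h.N
    have hLs := h.L
    have hss := h.sg
    have hrs := h.r
    simp only [add_zero, pow_zero, mul_one, pow_succ] at hNs hLs hss hrs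
    rw [← hσ', e]
    refine ⟨?_, ?_, ?_⟩
    · repeat' apply Store.Bdd.set
      · exact hb
      all_goals rw [abs_le]; constructor <;> linarith
    · constructor
      case frame =>
        repeat' apply Frame.set
        · exact h.frame
        all_goals decide
      case sg =>
        simp only [Store.set_S, reduceCtorEq, if_true, if_false, hss]
        rw [List.take_succ_eq_append_getElem hi, natOfBits_append_singleton, hbit, bitVal_eq]
        push_cast; ring
      case r =>
        simp only [Store.set_S, reduceCtorEq, if_true, if_false, hrs]
        rw [add_zero, coinNum, bitVal_eq]
        push_cast; ring
      case rl =>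
        simp only [Store.set_S, reduceCtorEq, if_false, h.rl]
        simp
      all_goals simp [Store.set_S, h.zero, h.one, h.four, h.p, h.D, hNs, hLs, pow_succ, mul_two]
    · simp [Store.set_S, hpos]
  · intro σ hb h
    have hc : cellVal τ.proof τ.proof.length = -1 := cellVal_of_le le_rfl
    have hz := h.zero
    have h1 := h.one
    have hpc := h.pos
    rw [add_zero] at hpc
    obtain ⟨σ', hσ'⟩ : ∃ σ', σ' = proofBody.eval τ σ := ⟨_, rfl⟩
    have e := hσ'
    simp only [proofBody, block, Code.eval, Store.set_S, h1, hpc, Tapes.symbol, reduceCtorEq,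
      if_true, if_false, Int.toNat_natCast, hc, neg_add_cancel, lt_irrefl] at e
    rw [← hσ', e]
    refine ⟨?_, ?_, ?_⟩
    · repeat' apply Store.Bdd.set
      · exact hb
      all_goals norm_num; try linarith
    · constructor
      case frame =>
        repeat' apply Frame.set
        · exact h.frame
        all_goals decide
      case rl =>
        simp only [Store.set_S, reduceCtorEq, if_false, h.rl]
      all_goals simp [Store.set_S, h.zero, h.one, h.four, h.p, h.D, h.N, h.L, h.sg, h.r, h.pos]
    · simp [Store.set_S]

/-- Appending a binary digit commutes with truncation to the low digits; this is the invariant of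
`rl`. -/
theorem two_mul_add_emod (c m : ℤ) (b : ℤ) (hb : 0 ≤ b ∧ b ≤ 1) (hm : 0 < m) :
    (2 * c + b) % (2 * m) = 2 * (c % m) + b := by
  have h1 := Int.emod_nonneg c hm.ne'
  have h2 := Int.emod_lt_of_pos c hm
  have h3 : 2 * c + b = (2 * (c % m) + b) + 2 * m * (c / m) := by
    have := Int.emod_add_mul_ediv c m
    linear_combination -2 * this
  rw [h3, Int.add_mul_emod_self_left, Int.emod_eq_of_lt (by linarith) (by linarith)]

/-- One coin is read for each cell of the input. These coins are the low `X` bits of the multiplier,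
and `rl` collects only them. Doubling the message in each round shifts it to the position of the
buckets, the multiples of `2 ^ X`. -/
theorem readCoins_ends {τ : Tapes} (hk : τ.proof.length ≤ τ.input.length) {σ : Store}
    (hσ : ReadInv τ.coins τ.proof τ.proof.length 0 σ)
    (hb : σ.Bdd (2 ^ (2 * τ.input.length + 20))) :
    Ends τ (2 ^ (2 * τ.input.length + 20)) [(scaleBody, .ck)] (τ.input.length + 1) σ
      (ReadInv τ.coins τ.proof τ.proof.length τ.input.length) := by
  set X := τ.input.length with hX
  set k := τ.proof.length with hkdef
  have hB : (2 : ℤ) ^ 20 ≤ 2 ^ (2 * X + 20) := int_two_pow_le (by omega)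
  norm_num at hB
  refine Ends.loop (fun i σ => ReadInv τ.coins τ.proof k i σ) X hσ hb ?_ ?_
  · intro i hi σ hb h
    obtain ⟨b, hbit⟩ : ∃ b, τ.input[i] = b := ⟨_, rfl⟩
    have hc : cellVal τ.input i = bitVal b := by rw [cellVal_of_lt hi, hbit]
    have hpos : 0 < bitVal b + 1 := by cases b <;> simp [bitVal]
    have h1 := h.one
    have hpp := h.p
    have hpc := h.pos
    obtain ⟨σ', hσ'⟩ : ∃ σ', σ' = scaleBody.eval τ σ := ⟨_, rfl⟩
    have e := hσ'
    simp only [scaleBody, block, Code.eval, Store.set_S, h1, hpc, hpp, Tapes.symbol, reduceCtorEq,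
      if_true, if_false, Int.toNat_natCast, hc, hpos] at e
    have hbv : 0 ≤ bitVal b ∧ bitVal b ≤ 1 := by cases b <;> simp [bitVal]
    have hcv : 0 ≤ bitVal (τ.coins (k + i)) ∧ bitVal (τ.coins (k + i)) ≤ 1 := by
      cases τ.coins (k + i) <;> simp [bitVal]
    have hpi : (0 : ℤ) < 2 ^ i := by positivity
    have hsg : (natOfBits (τ.proof.take k) : ℤ) * 2 ^ i < 2 ^ (k + i) := by
      have := natOfBits_lt (τ.proof.take k)
      rw [List.length_take, min_eq_left le_rfl] at this
      rw [pow_add]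
      exact mul_lt_mul_of_pos_right (by exact_mod_cast this) hpi
    have hsg0 : 0 ≤ (natOfBits (τ.proof.take k) : ℤ) * 2 ^ i :=
      mul_nonneg (Int.natCast_nonneg _) hpi.le
    have hr : (coinNum τ.coins (k + i) : ℤ) < 2 ^ (k + i) := by
      exact_mod_cast coinNum_lt τ.coins (k + i)
    have hi2 : (i : ℤ) < 2 ^ (k + i) := natCast_lt_two_pow (by omega)
    have hki2 : ((k + i : ℕ) : ℤ) < 2 ^ (k + i) := natCast_lt_two_pow le_rfl
    have hbig : (2 : ℤ) ^ (k + i + 3) ≤ 2 ^ (2 * X + 20) := int_two_pow_le (by omega)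
    rw [pow_add _ (k + i)] at hbig
    have hD : (2 : ℤ) ^ i ≤ 2 ^ (k + i) := int_two_pow_le (by omega)
    have hrl0 := Int.emod_nonneg (coinNum τ.coins (k + i) : ℤ) hpi.ne'
    have hrl1 := Int.emod_lt_of_pos (coinNum τ.coins (k + i) : ℤ) hpi
    have hNs := h.N
    have hDs := h.D
    have hss := h.sg
    have hrs := h.r
    have hrls := h.rl
    obtain ⟨M, hM⟩ : ∃ M : ℤ, M = 2 ^ (k + i) := ⟨_, rfl⟩
    rw [← hM] at hsg hr hi2 hki2 hbig hD hNs
    rw [← hDs] at hD hrl1 hrls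
    rw [← hss] at hsg hsg0
    have hr0 : (0 : ℤ) ≤ coinNum τ.coins (k + i) := Int.natCast_nonneg _
    rw [← hrs] at hr hr0
    have hrl : 0 ≤ σ.S .rl := by rw [hrls, hDs]; exact hrl0
    rw [← hrls] at hrl1
    have hki0 : (0 : ℤ) ≤ (k + i : ℕ) := Int.natCast_nonneg _
    have hi0 : (0 : ℤ) ≤ i := Int.natCast_nonneg _
    have hDp : 0 < σ.S .D := by rw [hDs]; exact hpi
    rw [← hσ', e]
    refine ⟨?_, ?_, ?_⟩
    · repeat' apply Store.Bdd.set
      · exact hb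
      all_goals
        rw [abs_le]
        constructor <;> linarith only [hbv, hcv, hsg, hsg0, hr, hr0, hrl, hrl1, hD, hDp, hNs, hbig,
          hki0, hki2, hi0, hi2]
    · constructor
      case frame =>
        repeat' apply Frame.set
        · exact h.frame
        all_goals decide
      case sg =>
        simp only [Store.set_S, reduceCtorEq, if_true, if_false, h.sg]
        rw [pow_succ]; ring
      case r =>
        simp only [Store.set_S, reduceCtorEq, if_true, if_false, h.r]
        rw [← add_assoc, coinNum, bitVal_eq]
        push_cast; ring
      case rl =>
        simp only [Store.set_S, reduceCtorEq, if_true, if_false, h.rl]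
        rw [← add_assoc, coinNum, pow_succ, mul_comm _ (2 : ℤ), Nat.cast_add, Nat.cast_mul,
          ← bitVal_eq, Nat.cast_ofNat, two_mul_add_emod _ _ _ hcv hpi]
        ring
      all_goals simp [Store.set_S, h.zero, h.one, h.four, h.N, h.D, h.L, pow_succ, ← add_assoc,
        mul_two]
    · simp [Store.set_S, hpos]
  · intro σ hb h
    have hc : cellVal τ.input X = -1 := cellVal_of_le le_rfl
    have h1 := h.one
    have hpp := h.p
    obtain ⟨σ', hσ'⟩ : ∃ σ', σ' = scaleBody.eval τ σ := ⟨_, rfl⟩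
    have e := hσ'
    simp only [scaleBody, block, Code.eval, Store.set_S, h1, hpp, Tapes.symbol, reduceCtorEq,
      if_true, if_false, Int.toNat_natCast, hc, neg_add_cancel, lt_irrefl] at e
    rw [← hσ', e]
    refine ⟨?_, ?_, ?_⟩
    · repeat' apply Store.Bdd.set
      · exact hb
      all_goals norm_num; try linarith
    · constructor
      case frame =>
        repeat' apply Frame.set
        · exact h.frame
        all_goals decide
      case rl =>
        simp only [Store.set_S, reduceCtorEq, if_false, h.rl]
      all_goals simp [Store.set_S, h.zero, h.one, h.four, h.p, h.D, h.N, h.L, h.sg, h.r, h.pos]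
    · simp [Store.set_S]

/-! ### Decoding the instance -/

theorem length_blocks_le (l : List Bool) : (blocks l).length ≤ l.length := by
  fun_induction blocks l with
  | case1 => simp
  | case2 => simp
  | case3 l ih => simpa using ih
  | case4 => simp
  | case5 b l w ws h ih => rw [h] at ih; simp at ih ⊢; omega

/-- A digit doubles one summand but occupies two cells, which quadruples the right side; an end
marker adds a summand 1 and doubles the right side. -/
theorem sum_two_pow_blocks_le (l : List Bool) :
    ((blocks l).map fun w => 2 ^ w.length).sum ≤ 2 ^ l.length := by
  fun_induction blocks l with
  | case1 => simp
  | case2 => simp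
  | case3 l ih =>
    have := Nat.one_le_two_pow (n := l.length)
    simp [pow_succ]; omega
  | case4 => simp
  | case5 b l w ws h ih =>
    rw [h] at ih
    simp [pow_succ] at ih ⊢; omega

theorem abs_intOfBlock_le (w : List Bool) : |intOfBlock w| ≤ 2 ^ w.length := by
  cases w with
  | nil => simp [intOfBlock]
  | cons s l =>
    have h := natOfBits_lt l
    have h' : (natOfBits l : ℤ) ≤ 2 ^ (s :: l).length := by
      rw [List.length_cons, pow_succ]
      zify at h
      have : (0 : ℤ) < 2 ^ l.length := by positivity
      linarith
    cases s <;> simpa [intOfBlock] using h'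

/-- The input length alone thus yields a bound `2 ^ X` for all partial sums at once, and the machine
can compute it before decoding anything. -/
theorem sum_abs_decode_le (x : List Bool) : ((decode x).map abs).sum ≤ 2 ^ x.length := by
  have h := sum_two_pow_blocks_le x
  zify at h
  refine le_trans ?_ h
  unfold decode
  generalize blocks x = l
  induction l with
  | nil => simp
  | cons w l ih =>
    have := abs_intOfBlock_le w
    simp only [List.map_cons, List.sum_cons, List.map_map]  at ih ⊢
    push_cast
    exact add_le_add this (by simpa using ih)

theorem length_decode_le (x : List Bool) : (decode x).length ≤ x.length := by
  simpa [decode] using length_blocks_le x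

/-- The blocks of a string whose first block has already been read up to `w`. -/
def blocksFrom (w l : List Bool) : List (List Bool) :=
  match blocks l with
  | [] => []
  | b :: bs => (w ++ b) :: bs

theorem blocksFrom_nil (l : List Bool) : blocksFrom [] l = blocks l := by
  unfold blocksFrom
  cases blocks l <;> simp

theorem blocksFrom_end (w l : List Bool) : blocksFrom w (false :: l) = w :: blocks l := by
  simp [blocksFrom, blocks]

theorem blocksFrom_digit (w l : List Bool) (b : Bool) :
    blocksFrom w (true :: b :: l) = blocksFrom (w ++ [b]) l := by
  unfold blocksFrom
  rw [blocks]
  cases blocks l <;> simp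

/-! ### Linear hash values and the invariant of decoding. -/

/-- The residue of `r * v` modulo `2 ^ m`. -/
def residue (r m : ℕ) (v : ℤ) : ℤ := (r * v) % 2 ^ m

theorem residue_nonneg (r m : ℕ) (v : ℤ) : 0 ≤ residue r m v :=
  Int.emod_nonneg _ (by positivity)

theorem residue_lt (r m : ℕ) (v : ℤ) : residue r m v < 2 ^ m :=
  Int.emod_lt_of_pos _ (by positivity)

theorem residue_zero (r m : ℕ) : residue r m 0 = 0 := by simp [residue]

theorem residue_add (r m : ℕ) (v w : ℤ) :
    residue r m (v + w) = (residue r m v + residue r m w) % 2 ^ m := by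
  simp [residue, mul_add, Int.add_emod]

theorem residue_neg (r m : ℕ) (v : ℤ) : residue r m (-v) = (0 - residue r m v) % 2 ^ m := by
  rw [residue, mul_neg, zero_sub]
  exact (Int.ModEq.neg (Int.mod_modEq _ _)).symm

theorem residue_one (r m : ℕ) : residue r m 1 = (r : ℤ) % 2 ^ m := by
  simp [residue]

/-- The store after decoding the instance with the numbers `a` (the target is `a 0`); the message
is the number `s`. -/
structure Env (X k r cnt : ℕ) (a : ℕ → ℤ) (σ : Store) : Prop where
  zero : σ.S .zero = 0
  one : σ.S .one = 1
  four : σ.S .four = 4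
  N : σ.S .N = 2 ^ (k + X)
  D : σ.S .D = 2 ^ X
  L : σ.S .L = 2 ^ (k + 1)
  cnt : σ.S .cnt = cnt
  A : σ.A .A = a
  XA : σ.A .XA = fun i => residue r (k + X) (a i)
  YA : σ.A .YA = fun i => residue r X (a i)

theorem Env.frame {X k r cnt : ℕ} {a : ℕ → ℤ} {σ σ' : Store} (h : Env X k r cnt a σ)
    {W : List Reg} {WA : List Arr} (hf : Frame W WA σ σ')
    (hW : ∀ q ∈ [Reg.zero, .one, .four, .N, .D, .L, .cnt], q ∉ W)
    (hWA : ∀ q ∈ [Arr.A, .XA, .YA], q ∉ WA) : Env X k r cnt a σ' := by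
  simp only [List.forall_mem_cons, List.not_mem_nil, false_implies, implies_true, and_true]
    at hW hWA
  obtain ⟨h1, h2, h3, h4, h5, h6, h7⟩ := hW
  obtain ⟨h8, h9, h10⟩ := hWA
  exact ⟨(hf.1 _ h1).trans h.zero, (hf.1 _ h2).trans h.one, (hf.1 _ h3).trans h.four,
    (hf.1 _ h4).trans h.N, (hf.1 _ h5).trans h.D, (hf.1 _ h6).trans h.L, (hf.1 _ h7).trans h.cnt,
    (hf.2 _ h8).trans h.A, (hf.2 _ h9).trans h.XA, (hf.2 _ h10).trans h.YA⟩

/-- The store while the instance is decoded: the numbers `acc` are complete, the beginning `w` of the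
next block has been read. -/
structure DecodeInv (x : List Bool) (k r : ℕ) (σ₀ : Store) (q : ℕ) (w : List Bool) (acc : List ℤ)
    (σ : Store) : Prop where
  env : Env x.length k r acc.length (fun i => acc.getD i 0) σ
  p : σ.S .p = q
  r_eq : σ.S .r = r
  rl_eq : σ.S .rl = (r : ℤ) % 2 ^ x.length
  v : σ.S .v = natOfBits w.tail
  xv : σ.S .xv = residue r (k + x.length) (natOfBits w.tail)
  yv : σ.S .yv = residue r x.length (natOfBits w.tail)
  sgn : σ.S .sgn = w.head?.elim 0 bitVal
  st : σ.S .st = if w = [] then 0 else 1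
  go : σ.S .go = 1
  q_le : q ≤ x.length
  w_le : w.length ≤ q
  decode : decode x = acc ++ (blocksFrom w (x.drop q)).map intOfBlock
  frame : Frame [.p, .go, .c0, .a, .c1, .ck, .v, .xv, .yv, .sgn, .st, .cnt, .t] [.A, .XA, .YA] σ₀ σ

/-- For loops whose number of rounds is not known in advance. Decoding consumes one or two cells per
round, and the number of unread cells serves as the measure. -/
theorem Ends.loop_measure {τ : Tapes} {B : ℤ} {c : Code} {r : Reg} {Q : Store → Prop}
    (I : ℕ → Store → Prop)
    (h : ∀ n σ, σ.Bdd B → I n σ → (c.eval τ σ).Bdd B ∧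
      ((0 < (c.eval τ σ).S r ∧ ∃ n' < n, I n' (c.eval τ σ)) ∨
        (¬ 0 < (c.eval τ σ).S r ∧ Q (c.eval τ σ)))) (n : ℕ) (σ : Store) (hb : σ.Bdd B)
    (h0 : I n σ) : Ends τ B [(c, r)] (n + 1) σ Q := by
  suffices key : ∃ σ', Stage.Runs τ B (c, r) (n + 1) σ σ' ∧ σ'.Bdd B ∧ Q σ' by
    obtain ⟨σ', h1, h2, h3⟩ := key
    exact Ends.single h1 h2 h3
  induction n using Nat.strong_induction_on generalizing σ with
  | _ n ih =>
    obtain ⟨hb', ⟨hpos, n', hn', hI⟩ | ⟨hpos, hQ⟩⟩ := h n σ hb h0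
    · obtain ⟨σ', ⟨m, hm, h1, h2, h3⟩, h4⟩ := ih n' hn' _ hb' hI
      refine ⟨σ', ⟨m + 1, by omega, by rw [Function.iterate_succ_apply]; exact h1, h2, ?_⟩, h4⟩
      intro i hi
      cases i with
      | zero => exact ⟨hpos, hb'⟩
      | succ i =>
        rw [Function.iterate_succ_apply]
        exact h3 i (by omega)
    · exact ⟨_, ⟨0, by omega, rfl, hpos, by simp⟩, hb', hQ⟩

section
variable {τ : Tapes} {k r : ℕ} {σ₀ σ : Store} {q : ℕ} {w : List Bool} {acc : List ℤ}

theorem getD_append_singleton (acc : List ℤ) (z : ℤ) :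
    (fun i => (acc ++ [z]).getD i 0) = Function.update (fun i => acc.getD i 0) acc.length z := by
  funext i
  by_cases hi : i = acc.length
  · subst hi; simp
  · rw [Function.update_of_ne hi]
    rcases Nat.lt_or_gt_of_ne hi with h | h
    · rw [List.getD_append _ _ _ _ h]
    · rw [List.getD_eq_default _ _ (by simpa using h), List.getD_eq_default _ _ h.le]

theorem comp_update {f : ℤ → ℤ} (a : ℕ → ℤ) (i : ℕ) (z : ℤ) :
    (fun j => f (Function.update a i z j)) = Function.update (fun j => f (a j)) i (f z) := by
  funext j
  by_cases h : j = i
  · subst h; simp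
  · simp [h]

/-- The arrays are written only at the end marker of an integer, so an unfinished integer at the end
of the input leaves no trace in them. -/
theorem decode_stop (hb : σ.Bdd (2 ^ (2 * τ.input.length + 20)))
    (h : DecodeInv τ.input k r σ₀ q w acc σ)
    (hfin : τ.input.drop q = [] ∨ τ.input.drop q = [true]) :
    (decodeBody.eval τ σ).Bdd (2 ^ (2 * τ.input.length + 20)) ∧
      ¬ 0 < (decodeBody.eval τ σ).S .go ∧
      (Env τ.input.length k r (decode τ.input).length (fun i => (decode τ.input).getD i 0)
        (decodeBody.eval τ σ) ∧
      Frame [.p, .go, .c0, .a, .c1, .ck, .v, .xv, .yv, .sgn, .st, .cnt, .t] [.A, .XA, .YA] σ₀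
        (decodeBody.eval τ σ)) := by
  have hB : (2 : ℤ) ^ 20 ≤ 2 ^ (2 * τ.input.length + 20) := int_two_pow_le (by omega)
  norm_num at hB
  have hq : (q : ℤ) < 2 ^ (2 * τ.input.length + 19) := natCast_lt_two_pow (by have := h.q_le; omega)
  have hB2 : (2 : ℤ) ^ (2 * τ.input.length + 20) = 2 ^ (2 * τ.input.length + 19) * 2 := pow_succ _ _
  have hdec : decode τ.input = acc := by
    rw [h.decode]
    rcases hfin with hs | hs <;> simp [hs, blocksFrom, blocks]
  obtain ⟨σ', hσ'⟩ : ∃ σ', σ' = decodeBody.eval τ σ := ⟨_, rfl⟩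
  have e := hσ'
  have h1 := h.env.one
  have hp := h.p
  have hqn : ((q : ℤ) + 1).toNat = q + 1 := by omega
  have fin : ∀ σ' : Store, Frame [.go, .c0, .a, .c1, .ck] [] σ σ' →
      (Env τ.input.length k r (decode τ.input).length (fun i => (decode τ.input).getD i 0) σ' ∧
      Frame [.p, .go, .c0, .a, .c1, .ck, .v, .xv, .yv, .sgn, .st, .cnt, .t] [.A, .XA, .YA] σ₀
        σ') := by
    intro σ' hf
    rw [hdec]
    exact ⟨h.env.frame hf (by decide) (by decide), h.frame.trans (hf.mono (by decide) (by simp))⟩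
  rcases hfin with hs | hs
  · have hc : cellVal τ.input q = -1 := cellVal_of_le (List.drop_eq_nil_iff.1 hs)
    have hc1 : cellVal τ.input (q + 1) = -1 :=
      cellVal_of_le ((List.drop_eq_nil_iff.1 hs).trans (Nat.le_succ q))
    simp only [decodeBody, block, Code.eval, Store.set_S, h1, hp, Tapes.symbol, reduceCtorEq,
      if_true, if_false, Int.toNat_natCast, hc, hc1, hqn, neg_add_cancel, lt_irrefl,
      show ¬ (0 : ℤ) < -1 by norm_num] at e
    rw [← hσ', e]
    refine ⟨?_, by simp, fin _ ?_⟩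
    · repeat' apply Store.Bdd.set
      · exact hb
      all_goals rw [abs_le]; constructor <;> linarith
    · repeat' apply Frame.set
      · exact Frame.refl _ _ _
      all_goals decide
  · have hlen : τ.input.length = q + 1 := by
      have := congrArg List.length hs
      simp at this
      have := h.q_le
      omega
    have hc : cellVal τ.input q = 1 := by
      have : (τ.input.drop q)[0]? = some true := by rw [hs]; rfl
      rw [List.getElem?_drop, add_zero] at this
      simp [cellVal, this, bitVal]
    have hc1 : cellVal τ.input (q + 1) = -1 := cellVal_of_le hlen.le
    simp only [decodeBody, block, Code.eval, Store.set_S, h1, hp, Tapes.symbol, reduceCtorEq,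
      if_true, if_false, Int.toNat_natCast, hc, hc1, hqn, neg_add_cancel, lt_irrefl,
      zero_lt_one] at e
    rw [← hσ', e]
    refine ⟨?_, by simp, fin _ ?_⟩
    · repeat' apply Store.Bdd.set
      · exact hb
      all_goals rw [abs_le]; constructor <;> linarith
    · repeat' apply Frame.set
      · exact Frame.refl _ _ _
      all_goals decide

/-- Horner's rule, run simultaneously in the integers and modulo `2 ^ (k + X)` and `2 ^ X`: a digit
doubles the value, and a digit 1 adds `1`, `r` or `rl`. The products `r * v` are obtained in this
way without multiplication. -/
theorem decode_digit (hkX : k ≤ τ.input.length) (hr : r < 2 ^ (k + τ.input.length))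
    (hb : σ.Bdd (2 ^ (2 * τ.input.length + 20))) (h : DecodeInv τ.input k r σ₀ q w acc σ)
    {d : Bool} {l : List Bool} (hs : τ.input.drop q = true :: d :: l) :
    (decodeBody.eval τ σ).Bdd (2 ^ (2 * τ.input.length + 20)) ∧
      DecodeInv τ.input k r σ₀ (q + 2) (w ++ [d]) acc (decodeBody.eval τ σ) := by
  set X := τ.input.length with hX
  have hlen : q + 2 ≤ X := by
    have := congrArg List.length hs
    simp at this
    omega
  have hdrop : τ.input.drop (q + 2) = l := by
    rw [← List.drop_drop, hs]; rfl
  have hc : cellVal τ.input q = 1 := by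
    have : (τ.input.drop q)[0]? = some true := by rw [hs]; rfl
    rw [List.getElem?_drop, add_zero] at this
    simp [cellVal, this, bitVal]
  have hc1 : cellVal τ.input (q + 1) = bitVal d := by
    have : (τ.input.drop q)[1]? = some d := by rw [hs]; rfl
    rw [List.getElem?_drop] at this
    simp [cellVal, this]
  have hB : (2 : ℤ) ^ 20 ≤ 2 ^ (2 * X + 20) := int_two_pow_le (by omega)
  norm_num at hB
  have hq : (q : ℤ) < 2 ^ (2 * X) := natCast_lt_two_pow (by omega)
  have hB2 : (2 : ℤ) ^ (2 * X + 20) = 2 ^ (2 * X) * 2 ^ 20 := pow_add _ _ _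
  have hNB : (2 : ℤ) ^ (k + X) ≤ 2 ^ (2 * X) := int_two_pow_le (by omega)
  have hDB : (2 : ℤ) ^ X ≤ 2 ^ (2 * X) := int_two_pow_le (by omega)
  have hqn : ((q : ℤ) + 1).toNat = q + 1 := by omega
  have hpos : 0 < bitVal d + 1 := by cases d <;> simp [bitVal]
  have hdv : 0 ≤ bitVal d ∧ bitVal d ≤ 1 := by cases d <;> simp [bitVal]
  have h1 := h.env.one
  have h0 := h.env.zero
  have hp := h.p
  have hN : σ.S .N = 2 ^ (k + X) := h.env.N
  have hD : σ.S .D = 2 ^ X := h.env.D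
  obtain ⟨σ', hσ'⟩ : ∃ σ', σ' = decodeBody.eval τ σ := ⟨_, rfl⟩
  have e := hσ'
  have hdec : decode τ.input
      = acc ++ (blocksFrom (w ++ [d]) (τ.input.drop (q + 2))).map intOfBlock := by
    rw [h.decode, hs, blocksFrom_digit, hdrop]
  have hwl : (w ++ [d]).length ≤ q + 2 := by
    have := h.w_le
    simp; omega
  -- The first digit of a block is the sign; it is stored apart and the value stays zero.
  rcases w with _ | ⟨s, w⟩
  · have hst : σ.S .st = 0 := by simpa using h.st
    simp only [decodeBody, digitCode, block, Code.eval, Store.set_S, h1, h0, hp, hst, Tapes.symbol,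
      reduceCtorEq, if_true, if_false, Int.toNat_natCast, hc, hc1, hqn, hpos, zero_lt_one,
      lt_irrefl] at e
    rw [← hσ', e]
    have hf : Frame [.p, .c0, .a, .c1, .ck, .sgn, .st] [] σ σ' := by
      rw [e]
      repeat' apply Frame.set
      · exact Frame.refl _ _ _
      all_goals decide
    refine ⟨?_, ?_⟩
    · clear hf e
      repeat' apply Store.Bdd.set
      · exact hb
      all_goals rw [abs_le]; constructor <;> linarith
    · rw [← e]
      have hu := fun q (hq : q ∉ [Reg.p, .c0, .a, .c1, .ck, .sgn, .st]) => hf.1 q hq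
      constructor
      case env => exact h.env.frame hf (by decide) (by decide)
      case frame => exact h.frame.trans (hf.mono (by decide) (by simp))
      case decode => exact hdec
      case w_le => exact hwl
      case q_le => exact hlen
      case r_eq => rw [hu _ (by decide), h.r_eq]
      case rl_eq => rw [hu _ (by decide), h.rl_eq]
      case go => rw [hu _ (by decide), h.go]
      case v => rw [hu _ (by decide), h.v]; rfl
      case xv => rw [hu _ (by decide), h.xv]; rfl
      case yv => rw [hu _ (by decide), h.yv]; rfl
      case p => rw [e]; simp [Store.set_S]; ring
      case sgn => rw [e]; simp [Store.set_S]
      case st => rw [e]; simp [Store.set_S]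
  · have hst : σ.S .st = 1 := by simpa using h.st
    have hv : σ.S .v = natOfBits w := h.v
    have hxv : σ.S .xv = residue r (k + X) (natOfBits w) := h.xv
    have hyv : σ.S .yv = residue r X (natOfBits w) := h.yv
    have hx0 := residue_nonneg r (k + X) (natOfBits w)
    have hx1 := residue_lt r (k + X) (natOfBits w)
    have hy0 := residue_nonneg r X (natOfBits w)
    have hy1 := residue_lt r X (natOfBits w)
    rw [← hxv] at hx0 hx1
    rw [← hyv] at hy0 hy1
    have hxx : (σ.S .xv + σ.S .xv) % 2 ^ (k + X) = residue r (k + X) (2 * natOfBits w) := by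
      rw [two_mul, residue_add, hxv]
    have hyy : (σ.S .yv + σ.S .yv) % 2 ^ X = residue r X (2 * natOfBits w) := by
      rw [two_mul, residue_add, hyv]
    have hx8 : 0 ≤ σ.S .xv + σ.S .xv := by linarith
    have hy8 : 0 ≤ σ.S .yv + σ.S .yv := by linarith
    have hN2 : σ.S .xv + σ.S .xv < 2 * 2 ^ (k + X) := by linarith
    have hD2 : σ.S .yv + σ.S .yv < 2 * 2 ^ X := by linarith
    have hx2 := residue_nonneg r (k + X) (2 * natOfBits w)
    have hx3 := residue_lt r (k + X) (2 * natOfBits w)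
    have hy2 := residue_nonneg r X (2 * natOfBits w)
    have hy3 := residue_lt r X (2 * natOfBits w)
    have hr1 : (r : ℤ) < 2 ^ (k + X) := by exact_mod_cast hr
    have hr0 : (0 : ℤ) ≤ r := Int.natCast_nonneg _
    have hl0 : (0 : ℤ) ≤ r % 2 ^ X := Int.emod_nonneg _ (by positivity)
    have hl1 : (r : ℤ) % 2 ^ X < 2 ^ X := Int.emod_lt_of_pos _ (by positivity)
    have hr_eq := h.r_eq
    have hrl_eq : σ.S .rl = (r : ℤ) % 2 ^ X := h.rl_eq
    have hvb : (natOfBits w : ℤ) < 2 ^ X := by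
      have h2 := natOfBits_lt w
      have h3 := h.w_le
      simp only [List.length_cons] at h3
      exact_mod_cast h2.trans_le (Nat.pow_le_pow_right (by norm_num) (by omega : w.length ≤ X))
    have hv0 : (0 : ℤ) ≤ natOfBits w := Int.natCast_nonneg _
    have hnat : natOfBits ((s :: w) ++ [d]).tail = 2 * natOfBits w + d.toNat := by
      simp [natOfBits_append_singleton]
    have hx4 : 0 ≤ residue r (k + X) (2 * natOfBits w) + r := by linarith
    have hx5 : residue r (k + X) (2 * natOfBits w) + r < 2 * 2 ^ (k + X) := by linarith
    have hy4 : 0 ≤ residue r X (2 * natOfBits w) + r % 2 ^ X := by linarith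
    have hy5 : residue r X (2 * natOfBits w) + r % 2 ^ X < 2 * 2 ^ X := by linarith
    have hxz : (residue r (k + X) (2 * natOfBits w) + r) % 2 ^ (k + X)
        = residue r (k + X) (2 * natOfBits w + 1) := by
      rw [residue_add, residue_one, Int.add_emod_emod]
    have hyz : (residue r X (2 * natOfBits w) + r % 2 ^ X) % 2 ^ X
        = residue r X (2 * natOfBits w + 1) := by
      rw [residue_add, residue_one]
    have hx6 := residue_nonneg r (k + X) (2 * natOfBits w + 1)
    have hx7 := residue_lt r (k + X) (2 * natOfBits w + 1)
    have hy6 := residue_nonneg r X (2 * natOfBits w + 1)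
    have hy7 := residue_lt r X (2 * natOfBits w + 1)
    have hq0 : (0 : ℤ) ≤ q := Int.natCast_nonneg _
    have hM := hB2
    generalize (2 : ℤ) ^ (2 * X) = M at hq hNB hDB hM
    have main : σ'.Bdd (2 ^ (2 * X + 20)) ∧
        Frame [.p, .c0, .a, .c1, .ck, .v, .xv, .yv, .t] [] σ σ' ∧
        σ'.S .v = (2 * natOfBits w + d.toNat : ℕ) ∧
        σ'.S .xv = residue r (k + X) (2 * natOfBits w + d.toNat : ℕ) ∧
        σ'.S .yv = residue r X (2 * natOfBits w + d.toNat : ℕ) ∧ σ'.S .p = (q + 2 : ℕ) := by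
      cases d with
      | false =>
        simp only [decodeBody, digitCode, block, Code.eval, Store.set_S, h1, hp, hst,
          Tapes.symbol, Int.toNat_natCast, reduceCtorEq, if_true, if_false, ne_eq,
          not_false_eq_true, Store.set_A, zero_lt_one, lt_irrefl, zero_add, Bool.false_eq_true,
          one_add_one_eq_two, zero_lt_two, hc, hc1, hqn, bitVal, addMod_eval, hN, hD, hx8, hy8,
          hN2, hD2, hxx, hyy] at e
        rw [e]
        refine ⟨?_, ?_, ?_, ?_, ?_, ?_⟩
        · clear e
          repeat' apply Store.Bdd.set
          · exact hb
          all_goals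
            rw [abs_le]
            constructor <;> linarith only [hM, hB, hq, hq0, hNB, hDB, hx0, hx1, hx2, hx3, hx6, hx7, hy0,
              hy1, hy2, hy3, hy6, hy7, hvb, hv0, hv]
        · repeat' apply Frame.set
          · exact Frame.refl _ _ _
          all_goals decide
        all_goals simp [Store.set_S, hv]; try ring
      | true =>
        simp only [decodeBody, digitCode, block, Code.eval, Store.set_S, h1, hp, hst,
          Tapes.symbol, Int.toNat_natCast, reduceCtorEq, if_true, if_false, ne_eq,
          not_false_eq_true, Store.set_A, zero_lt_one, lt_irrefl, zero_add, Bool.false_eq_true,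
          one_add_one_eq_two, zero_lt_two, hc, hc1, hqn, bitVal, addMod_eval, hN, hD, hx8, hy8,
          hN2, hD2, hxx, hyy, hr_eq, hrl_eq, hx4, hx5, hy4, hy5, hxz, hyz] at e
        rw [e]
        refine ⟨?_, ?_, ?_, ?_, ?_, ?_⟩
        · clear e
          repeat' apply Store.Bdd.set
          · exact hb
          all_goals
            rw [abs_le]
            constructor <;> linarith only [hM, hB, hq, hq0, hNB, hDB, hx0, hx1, hx2, hx3, hx6, hx7, hy0,
              hy1, hy2, hy3, hy6, hy7, hvb, hv0, hv]
        · repeat' apply Frame.set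
          · exact Frame.refl _ _ _
          all_goals decide
        all_goals simp [Store.set_S, hv]; try ring
    obtain ⟨m1, hf, m3, m4, m5, m6⟩ := main
    rw [← hσ']
    have hu := fun q (hq : q ∉ [Reg.p, .c0, .a, .c1, .ck, .v, .xv, .yv, .t]) => hf.1 q hq
    refine ⟨m1, ?_⟩
    constructor
    case env => exact h.env.frame hf (by decide) (by decide)
    case frame => exact h.frame.trans (hf.mono (by decide) (by simp))
    case decode => exact hdec
    case w_le => exact hwl
    case q_le => exact hlen
    case r_eq => rw [hu _ (by decide), h.r_eq]
    case rl_eq => rw [hu _ (by decide), h.rl_eq]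
    case go => rw [hu _ (by decide), h.go]
    case v => rw [hnat, m3]
    case xv => rw [hnat, m4]
    case yv => rw [hnat, m5]
    case p => exact m6
    case sgn => rw [hu _ (by decide), h.sgn]; rfl
    case st => rw [hu _ (by decide), h.st]; simp

end

section
variable {τ : Tapes} {k r : ℕ} {σ₀ σ : Store} {q : ℕ} {w : List Bool} {acc : List ℤ}

/-- The digits were accumulated as a natural number. Only now is the sign applied, to the value and,
by `residue_neg`, to both residues. -/
theorem decode_finish (hkX : k ≤ τ.input.length)
    (hb : σ.Bdd (2 ^ (2 * τ.input.length + 20))) (h : DecodeInv τ.input k r σ₀ q w acc σ)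
    {l : List Bool} (hs : τ.input.drop q = false :: l) :
    (decodeBody.eval τ σ).Bdd (2 ^ (2 * τ.input.length + 20)) ∧
      DecodeInv τ.input k r σ₀ (q + 1) [] (acc ++ [intOfBlock w]) (decodeBody.eval τ σ) := by
  obtain ⟨X, hX⟩ : ∃ X, X = τ.input.length := ⟨_, rfl⟩
  have hlen : q + 1 ≤ X := by
    have := congrArg List.length hs
    simp at this
    omega
  have hdrop : τ.input.drop (q + 1) = l := by
    rw [← List.drop_drop, hs]; rfl
  have hc : cellVal τ.input q = 0 := by
    have : (τ.input.drop q)[0]? = some false := by rw [hs]; rfl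
    rw [List.getElem?_drop, add_zero] at this
    simp [cellVal, this, bitVal]
  have hc1 : |cellVal τ.input (q + 1)| ≤ 1 := abs_symbol_le τ .input (q + 1)
  rw [abs_le] at hc1
  have hB : (2 : ℤ) ^ 20 ≤ 2 ^ (2 * X + 20) := int_two_pow_le (by omega)
  norm_num at hB
  have hq : (q : ℤ) < 2 ^ (2 * X) := natCast_lt_two_pow (by omega)
  have hq0 : (0 : ℤ) ≤ q := Int.natCast_nonneg _
  have hB2 : (2 : ℤ) ^ (2 * X + 20) = 2 ^ (2 * X) * 2 ^ 20 := pow_add _ _ _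
  have hNB : (2 : ℤ) ^ (k + X) ≤ 2 ^ (2 * X) := int_two_pow_le (by omega)
  have hDB : (2 : ℤ) ^ X ≤ 2 ^ (2 * X) := int_two_pow_le (by omega)
  have hqn : ((q : ℤ) + 1).toNat = q + 1 := by omega
  have h1 := h.env.one
  have h0 := h.env.zero
  have hp := h.p
  have hN : σ.S .N = 2 ^ (k + X) := by rw [hX]; exact h.env.N
  have hD : σ.S .D = 2 ^ X := by rw [hX]; exact h.env.D
  have hcnt := h.env.cnt
  have hdec : decode τ.input
      = (acc ++ [intOfBlock w]) ++ (blocksFrom [] (τ.input.drop (q + 1))).map intOfBlock := by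
    rw [h.decode, hs, blocksFrom_end, hdrop, blocksFrom_nil]
    simp
  have hcl : (acc.length : ℤ) < 2 ^ (2 * X) := by
    refine natCast_lt_two_pow ?_
    have h2 := length_decode_le τ.input
    rw [hdec] at h2
    simp at h2
    omega
  have hcl0 : (0 : ℤ) ≤ acc.length := Int.natCast_nonneg _
  obtain ⟨z, hz⟩ : ∃ z : ℤ, z = natOfBits w.tail := ⟨_, rfl⟩
  have hz0 : 0 ≤ z := by rw [hz]; exact Int.natCast_nonneg _
  have hz1 : z < 2 ^ X := by
    have h2 := natOfBits_lt w.tail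
    have h3 := h.w_le
    rw [hz]
    exact_mod_cast h2.trans_le (Nat.pow_le_pow_right (by norm_num)
      (by rw [List.length_tail]; omega : w.tail.length ≤ X))
  have hv : σ.S .v = z := by rw [hz]; exact h.v
  have hxv : σ.S .xv = residue r (k + X) z := by rw [hz, hX]; exact h.xv
  have hyv : σ.S .yv = residue r X z := by rw [hz, hX]; exact h.yv
  have hx0 := residue_nonneg r (k + X) z
  have hx1 := residue_lt r (k + X) z
  have hy0 := residue_nonneg r X z
  have hy1 := residue_lt r X z
  have hx2 := residue_nonneg r (k + X) (-z)
  have hx3 := residue_lt r (k + X) (-z)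
  have hy2 := residue_nonneg r X (-z)
  have hy3 := residue_lt r X (-z)
  have hx4 : -2 ^ (k + X) ≤ 0 - residue r (k + X) z := by linarith
  have hy4 : -2 ^ X ≤ 0 - residue r X z := by linarith
  have hx5 : 0 - residue r (k + X) z < 2 ^ (k + X) := by linarith
  have hy5 : 0 - residue r X z < 2 ^ X := by linarith
  have hx6 := (residue_neg r (k + X) z).symm
  have hy6 := (residue_neg r X z).symm
  obtain ⟨y, hy⟩ : ∃ y, y = intOfBlock w := ⟨_, rfl⟩
  obtain ⟨σ', hσ'⟩ : ∃ σ', σ' = decodeBody.eval τ σ := ⟨_, rfl⟩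
  have e := hσ'
  have main : σ'.Bdd (2 ^ (2 * X + 20)) ∧
      Frame [.p, .c0, .a, .c1, .ck, .v, .xv, .yv, .t, .sgn, .st, .cnt] [.A, .XA, .YA] σ σ' ∧
      σ'.S .v = 0 ∧ σ'.S .xv = 0 ∧ σ'.S .yv = 0 ∧ σ'.S .p = (q + 1 : ℕ) ∧ σ'.S .sgn = 0 ∧
      σ'.S .st = 0 ∧ σ'.S .cnt = (acc.length + 1 : ℕ) ∧
      σ'.A .A = Function.update (σ.A .A) acc.length y ∧
      σ'.A .XA = Function.update (σ.A .XA) acc.length (residue r (k + X) y) ∧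
      σ'.A .YA = Function.update (σ.A .YA) acc.length (residue r X y) := by
    by_cases hsg : 0 < σ.S .sgn
    · have hyz : y = -z := by
        have h2 := h.sgn
        rw [hy, hz]
        rcases w with _ | ⟨s, w⟩
        · rw [h2] at hsg; simp at hsg
        · rw [h2] at hsg
          cases s
          · simp [bitVal] at hsg
          · simp [intOfBlock]
      simp only [decodeBody, finishCode, block, Code.eval, Store.set_S, h1, h0, hp, hsg, hv, hxv, hyv,
        hcnt, Tapes.symbol, Int.toNat_natCast, reduceCtorEq, if_true, if_false, ne_eq,
        not_false_eq_true, Store.set_A, Store.put_S, zero_lt_one, lt_irrefl, zero_add, hc, hqn,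
        subMod_eval, hN, hD, hx4, hx5, hy4, hy5, hx6, hy6] at e
      rw [e]
      refine ⟨?_, ?_, ?_⟩
      · clear e
        repeat' first | apply Store.Bdd.set | apply Store.Bdd.put
        · rw [hX]; exact hb
        all_goals
          rw [abs_le]
          constructor <;> linarith only [hB2, hB, hq, hq0, hNB, hDB, hx2, hx3, hy2, hy3, hz0, hz1,
            hcl, hcl0, hc1]
      · repeat' first | apply Frame.set | apply Frame.put
        · exact Frame.refl _ _ _
        all_goals decide
      · simp [Store.set_S, Store.put_A, hyz]
    · have hyz : y = z := by
        have h2 := h.sgn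
        rw [hy, hz]
        rcases w with _ | ⟨s, w⟩
        · simp [intOfBlock, natOfBits]
        · rw [h2] at hsg
          cases s
          · simp [intOfBlock]
          · simp [bitVal] at hsg
      simp only [decodeBody, finishCode, block, Code.eval, Store.set_S, h1, h0, hp, hsg, hv, hxv, hyv,
        hcnt, Tapes.symbol, Int.toNat_natCast, reduceCtorEq, if_true, if_false, ne_eq,
        not_false_eq_true, Store.set_A, Store.put_S, zero_lt_one, lt_irrefl, zero_add, hc, hqn] at e
      rw [e]
      refine ⟨?_, ?_, ?_⟩
      · clear e
        repeat' first | apply Store.Bdd.set | apply Store.Bdd.put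
        · rw [hX]; exact hb
        all_goals
          rw [abs_le]
          constructor <;> linarith only [hB2, hB, hq, hq0, hNB, hDB, hx0, hx1, hy0, hy1, hz0, hz1,
            hcl, hcl0, hc1]
      · repeat' first | apply Frame.set | apply Frame.put
        · exact Frame.refl _ _ _
        all_goals decide
      · simp [Store.set_S, Store.put_A, hyz]
  obtain ⟨m1, hf, m3, m4, m5, m6, m7, m8, m9, m10, m11, m12⟩ := main
  rw [← hσ']
  have hu := fun q (hq : q ∉ [Reg.p, .c0, .a, .c1, .ck, .v, .xv, .yv, .t, .sgn, .st, .cnt]) =>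
    hf.1 q hq
  have hg := fun i => congrFun (getD_append_singleton acc (intOfBlock w)) i
  refine ⟨by rw [← hX]; exact m1, ?_⟩
  constructor
  case env =>
    constructor
    case zero => rw [hu _ (by decide), h.env.zero]
    case one => rw [hu _ (by decide), h.env.one]
    case four => rw [hu _ (by decide), h.env.four]
    case N => rw [hu _ (by decide), h.env.N]
    case D => rw [hu _ (by decide), h.env.D]
    case L => rw [hu _ (by decide), h.env.L]
    case cnt => rw [m9]; simp
    case A => rw [m10, h.env.A, getD_append_singleton, hy]
    case XA =>
      simp only [hg]
      rw [m11, h.env.XA, comp_update (f := residue r _), hy, hX]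
    case YA =>
      simp only [hg]
      rw [m12, h.env.YA, comp_update (f := residue r _), hy, hX]
  case frame => exact h.frame.trans (hf.mono (by decide) (by simp))
  case decode => exact hdec
  case w_le => simp
  case q_le => omega
  case r_eq => rw [hu _ (by decide), h.r_eq]
  case rl_eq => rw [hu _ (by decide), h.rl_eq]
  case go => rw [hu _ (by decide), h.go]
  case v => rw [m3]; simp [natOfBits]
  case xv => rw [m4]; simp [natOfBits, residue_zero]
  case yv => rw [m5]; simp [natOfBits, residue_zero]
  case p => exact m6
  case sgn => rw [m7]; rfl
  case st => rw [m8]; simp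

theorem decodeInit_inv (hσ : ReadInv τ.coins τ.proof τ.proof.length τ.input.length σ) :
    DecodeInv τ.input τ.proof.length (coinNum τ.coins (τ.proof.length + τ.input.length)) σ 0 [] []
      (decodeInit.eval τ σ) := by
  obtain ⟨σ', hσ'⟩ : ∃ σ', σ' = decodeInit.eval τ σ := ⟨_, rfl⟩
  have e := hσ'
  simp only [decodeInit, block, Code.eval] at e
  have hf : Frame [.p, .go] [] σ σ' := by
    rw [e]
    repeat' apply Frame.set
    · exact Frame.refl _ _ _
    all_goals decide
  have hi := fun q hq => hσ.frame.1 q hq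
  have hu := fun q (hq : q ∉ [Reg.p, .go]) => hf.1 q hq
  rw [← hσ']
  constructor
  case env =>
    have hA : ∀ q, σ'.A q = fun _ => 0 := by
      intro q
      rw [hf.2 q (by simp), hσ.frame.2 q (by simp)]; rfl
    constructor
    case zero => rw [hu _ (by decide), hσ.zero]
    case one => rw [hu _ (by decide), hσ.one]
    case four => rw [hu _ (by decide), hσ.four]
    case N => rw [hu _ (by decide), hσ.N]
    case D => rw [hu _ (by decide), hσ.D]
    case L => rw [hu _ (by decide), hσ.L]
    case cnt => rw [hu _ (by decide), hi _ (by decide)]; rfl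
    case A => rw [hA]; simp
    case XA => rw [hA]; simp [residue_zero]
    case YA => rw [hA]; simp [residue_zero]
  case frame => exact hf.mono (by decide) (by simp)
  case decode => simp [blocksFrom_nil, decode]
  case w_le => simp
  case q_le => simp
  case r_eq => rw [hu _ (by decide), hσ.r]
  case rl_eq => rw [hu _ (by decide), hσ.rl]
  case go => rw [e]; simp [Store.set_S]
  case v => rw [hu _ (by decide), hi _ (by decide)]; rfl
  case xv => rw [hu _ (by decide), hi _ (by decide)]; simp [natOfBits, residue_zero, Store.init]
  case yv => rw [hu _ (by decide), hi _ (by decide)]; simp [natOfBits, residue_zero, Store.init]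
  case p => rw [e]; simp [Store.set_S]
  case sgn => rw [hu _ (by decide), hi _ (by decide)]; rfl
  case st => rw [hu _ (by decide), hi _ (by decide)]; rfl

theorem decode_ends (hkX : τ.proof.length ≤ τ.input.length)
    (hσ : ReadInv τ.coins τ.proof τ.proof.length τ.input.length σ)
    (hb : σ.Bdd (2 ^ (2 * τ.input.length + 20))) :
    Ends τ (2 ^ (2 * τ.input.length + 20)) [(decodeInit, .zero), (decodeBody, .go)]
      (1 + (τ.input.length + 1)) σ fun σ' =>
      Env τ.input.length τ.proof.length (coinNum τ.coins (τ.proof.length + τ.input.length))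
        (decode τ.input).length (fun i => (decode τ.input).getD i 0) σ' ∧
      Frame [.p, .go, .c0, .a, .c1, .ck, .v, .xv, .yv, .sgn, .st, .cnt, .t] [.A, .XA, .YA] σ σ' := by
  obtain ⟨r, hr⟩ : ∃ r, r = coinNum τ.coins (τ.proof.length + τ.input.length) := ⟨_, rfl⟩
  have h0 := decodeInit_inv hσ
  rw [← hr] at h0 ⊢
  have hr' : r < 2 ^ (τ.proof.length + τ.input.length) := by rw [hr]; exact coinNum_lt _ _
  refine Ends.append (l := [(decodeInit, .zero)])
    (Q := fun σ' => DecodeInv τ.input τ.proof.length r σ 0 [] [] σ') ?_ ?_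
  · refine Ends.code h0.env.zero ?_ h0
    have hB : (1 : ℤ) ≤ 2 ^ (2 * τ.input.length + 20) := one_le_pow₀ (by norm_num)
    simp only [decodeInit, block, Code.eval]
    exact (hb.set (by simp)).set (by simpa using hB)
  · intro σ' hb' h'
    refine Ends.loop_measure (fun n s => ∃ q w acc, q + n = τ.input.length ∧
      DecodeInv τ.input τ.proof.length r σ q w acc s) ?_ _ σ' hb' ⟨0, [], [], by simp, h'⟩
    rintro n s hb ⟨q, w, acc, hqn, h⟩
    -- The cases are: end of the input, end marker as the last cell, end marker with more to follow,
    -- a single dangling `true`, and a digit.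
    rcases hs : τ.input.drop q with _ | ⟨_ | _, _ | ⟨d, l⟩⟩
    · obtain ⟨h1, h2, h3⟩ := decode_stop hb h (Or.inl hs)
      exact ⟨h1, Or.inr ⟨h2, h3⟩⟩
    · obtain ⟨h1, h2⟩ := decode_finish hkX hb h hs
      refine ⟨h1, Or.inl ⟨by rw [h2.go]; norm_num, n - 1, ?_, q + 1, _, _, ?_, h2⟩⟩ <;>
        have := h2.q_le <;> omega
    · obtain ⟨h1, h2⟩ := decode_finish hkX hb h hs
      refine ⟨h1, Or.inl ⟨by rw [h2.go]; norm_num, n - 1, ?_, q + 1, _, _, ?_, h2⟩⟩ <;>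
        have := h2.q_le <;> omega
    · obtain ⟨h1, h2, h3⟩ := decode_stop hb h (Or.inr hs)
      exact ⟨h1, Or.inr ⟨h2, h3⟩⟩
    · obtain ⟨h1, h2⟩ := decode_digit hkX hr' hb h hs
      refine ⟨h1, Or.inl ⟨by rw [h2.go]; norm_num, n - 2, ?_, q + 2, _, _, ?_, h2⟩⟩ <;>
        have := h2.q_le <;> omega

end

/-- Reading the tapes. -/
theorem readStages_ends {τ : Tapes} (hkX : τ.proof.length ≤ τ.input.length) :
    Ends τ (2 ^ (2 * τ.input.length + 20)) readStages (3 * τ.input.length + 5) Store.init fun σ =>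
      Env τ.input.length τ.proof.length (coinNum τ.coins (τ.proof.length + τ.input.length))
        (decode τ.input).length (fun i => (decode τ.input).getD i 0) σ ∧
      σ.S .sg = natOfBits τ.proof * 2 ^ τ.input.length ∧ σ.S .flag = 0 ∧
      ∀ q ∉ [Arr.A, .XA, .YA], σ.A q = fun _ => 0 := by
  have h := (readProof_ends hkX).append fun σ hb hσ =>
    (readCoins_ends hkX hσ hb).append fun σ' hb' hσ' =>
      Ends.imp (Q' := fun σ => Env τ.input.length τ.proof.length
        (coinNum τ.coins (τ.proof.length + τ.input.length))
        (decode τ.input).length (fun i => (decode τ.input).getD i 0) σ ∧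
        σ.S .sg = natOfBits τ.proof * 2 ^ τ.input.length ∧ σ.S .flag = 0 ∧
        ∀ q ∉ [Arr.A, .XA, .YA], σ.A q = fun _ => 0) (decode_ends hkX hσ' hb') (by
          rintro σ'' ⟨h1, h2⟩
          refine ⟨h1, ?_, ?_, fun q hq => ?_⟩
          · rw [h2.1 _ (by decide), hσ'.sg, List.take_length]
          · rw [h2.1 _ (by decide), hσ'.frame.1 _ (by decide)]; rfl
          · rw [h2.2 _ hq, hσ'.frame.2 _ (by simp)]; rfl)
  exact Ends.mono h (by omega)

/-! ### Lists of subset sums -/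

/-- The sum of the subset with number `j` of the group `g`, i.e. of the numbers
`a (1 + g), a (5 + g), …`. -/
def groupSum (a : ℕ → ℤ) (g j : ℕ) : ℤ := ∑ q ∈ j.bitIndices.toFinset, a (1 + g + 4 * q)

theorem groupSum_zero (a : ℕ → ℤ) (g : ℕ) : groupSum a g 0 = 0 := by simp [groupSum]

/-- The index `q` is the highest binary digit of `j`, and removing it gives an earlier index. Each
entry of a list thus costs one addition to an earlier entry. -/
theorem groupSum_eq_add (a : ℕ → ℤ) (g : ℕ) {j q : ℕ} (h1 : 2 ^ q ≤ j) (h2 : j < 2 ^ (q + 1)) :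
    groupSum a g j = a (1 + g + 4 * q) + groupSum a g (j - 2 ^ q) := by
  have hlt : j - 2 ^ q < 2 ^ q := by rw [pow_succ] at h2; omega
  have hq : q ∉ (j - 2 ^ q).bitIndices.toFinset := by
    intro h
    rw [List.mem_toFinset] at h
    exact absurd (Nat.two_pow_le_of_mem_bitIndices h) (by omega)
  have hj : j = ∑ i ∈ insert q (j - 2 ^ q).bitIndices.toFinset, 2 ^ i := by
    rw [Finset.sum_insert hq, Finset.sum_toFinset_bitIndices_two_pow]
    omega
  have hbits : j.bitIndices.toFinset = insert q (j - 2 ^ q).bitIndices.toFinset := by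
    conv_lhs => rw [hj]
    rw [Finset.toFinset_bitIndices_sum_two_pow]
  unfold groupSum
  rw [hbits, Finset.sum_insert hq]

theorem abs_groupSum_le {a : ℕ → ℤ} {B : ℤ} (ha : ∀ I : Finset ℕ, ∑ i ∈ I, |a i| ≤ B) (g j : ℕ) :
    |groupSum a g j| ≤ B := by
  refine (Finset.abs_sum_le_sum_abs _ _).trans ?_
  refine le_trans (le_of_eq ?_) (ha (j.bitIndices.toFinset.image fun q => 1 + g + 4 * q))
  rw [Finset.sum_image]
  intro x _ y _ h
  simp only at h
  omega

/-- The list of the subset sums of a group, followed by zeros. -/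
def listVal (a : ℕ → ℤ) (k g e : ℕ) : ℤ := if e < 2 ^ (k + 1) then groupSum a g e else 0

/-- The arrays hold the subset sums of group `g` and their residues. -/
structure Listed (X k r : ℕ) (a : ℕ → ℤ) (g : ℕ) (σ : Store) : Prop where
  V_eq : ∀ e, σ.A .V e = listVal a k g e
  X_eq : ∀ e, σ.A .X e = residue r (k + X) (listVal a k g e)
  Y_eq : ∀ e, σ.A .Y e = residue r X (listVal a k g e)

/-- The arrays hold zeros outside of the range of the lists. -/
def Outside (k : ℕ) (σ : Store) : Prop :=
  ∀ e, e = 0 ∨ 2 ^ (k + 1) ≤ e → σ.A .V e = 0 ∧ σ.A .X e = 0 ∧ σ.A .Y e = 0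

/-- Entry 0 is the empty sum, and the cells beyond the list are untouched zeros. So the arrays can
be reused for the next group without being cleared. -/
theorem Listed.outside {X k r : ℕ} {a : ℕ → ℤ} {g : ℕ} {σ : Store} (h : Listed X k r a g σ) :
    Outside k σ := by
  intro e he
  have : listVal a k g e = 0 := by
    unfold listVal
    rcases he with rfl | he
    · simp [groupSum_zero]
    · rw [if_neg (by omega)]
  rw [h.V_eq, h.X_eq, h.Y_eq, this]
  simp [residue_zero]

/-- The store when the subset sums with numbers less than `j` have been computed. -/
structure ListInv (X k r : ℕ) (a : ℕ → ℤ) (g : ℕ) (σ₀ : Store) (j q : ℕ) (σ : Store) : Prop where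
  outside : Outside k σ
  V_eq : ∀ e < j, σ.A .V e = groupSum a g e
  X_eq : ∀ e < j, σ.A .X e = residue r (k + X) (groupSum a g e)
  Y_eq : ∀ e < j, σ.A .Y e = residue r X (groupSum a g e)
  j_eq : σ.S .j = j
  i_eq : σ.S .i = (1 + g + 4 * q : ℕ)
  pw_eq : σ.S .pw = (2 ^ q : ℕ)
  le : 2 ^ q ≤ j
  lt : j < 2 ^ (q + 1)
  frame : Frame [.i, .pw, .j, .t, .b, .a, .ck] [.V, .X, .Y] σ₀ σ

section
variable {τ : Tapes} {X k r cnt : ℕ} {a : ℕ → ℤ} {σ₀ σ : Store} {g : ℕ}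

-- The loop keeps `pw = 2 ^ q` with `2 ^ q ≤ j < 2 ^ (q + 1)`. When `j + 1` reaches `2 ^ (q + 1)`,
-- the power is doubled and the item index advances by four, to the next item of the group.
set_option maxHeartbeats 1000000 in
theorem listBody_inv (hkX : k ≤ X) (hg : g < 4) (ha : ∀ I : Finset ℕ, ∑ i ∈ I, |a i| ≤ 2 ^ X)
    (he₀ : Env X k r cnt a σ₀) {j q : ℕ} (hj : j < 2 ^ (k + 1)) (hb : σ.Bdd (2 ^ (2 * X + 20)))
    (h : ListInv X k r a g σ₀ j q σ) :
    (listBody.eval τ σ).Bdd (2 ^ (2 * X + 20)) ∧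
      (∃ q', 2 ^ q' ≤ j + 1 ∧ ListInv X k r a g σ₀ (j + 1) q' (listBody.eval τ σ)) ∧
      (listBody.eval τ σ).S .ck = 2 ^ (k + 1) - (j + 1) := by
  have henv : Env X k r cnt a σ := he₀.frame h.frame (by decide) (by decide)
  have hqk : q < k + 1 := (Nat.pow_lt_pow_iff_right (by norm_num)).1 (h.le.trans_lt hj)
  have h1 := henv.one
  have h4 := henv.four
  have hN := henv.N
  have hD := henv.D
  have hL := henv.L
  have hA := congrFun henv.A (1 + g + 4 * q)
  have hXA := congrFun henv.XA (1 + g + 4 * q)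
  have hYA := congrFun henv.YA (1 + g + 4 * q)
  have hji := h.j_eq
  have hii := h.i_eq
  have hpw := h.pw_eq
  have hq2 : 0 < 2 ^ q := by positivity
  have hjle := h.le
  have hjlt := h.lt
  obtain ⟨w, hw⟩ : ∃ w, w = 2 ^ q := ⟨_, rfl⟩
  rw [← hw] at hpw hq2 hjle
  have hjw : j < w + w := by rw [hw]; rw [pow_succ] at hjlt; omega
  obtain ⟨d, hd⟩ : ∃ d, d = j - w := ⟨_, rfl⟩
  have hsub : (j : ℤ) - w = d := by omega
  have hdj : d < j := by omega
  have hV := h.V_eq d hdj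
  have hX := h.X_eq d hdj
  have hY := h.Y_eq d hdj
  have hsum : a (1 + g + 4 * q) + groupSum a g d = groupSum a g j := by
    rw [groupSum_eq_add a g h.le h.lt, hd, hw]
  have hx0 := residue_nonneg r (k + X) (a (1 + g + 4 * q))
  have hx1 := residue_lt r (k + X) (a (1 + g + 4 * q))
  have hx2 := residue_nonneg r (k + X) (groupSum a g d)
  have hx3 := residue_lt r (k + X) (groupSum a g d)
  have hx4 : 0 ≤ residue r (k + X) (a (1 + g + 4 * q)) + residue r (k + X) (groupSum a g d) := by
    linarith
  have hx5 : residue r (k + X) (a (1 + g + 4 * q)) + residue r (k + X) (groupSum a g d)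
      < 2 * 2 ^ (k + X) := by linarith
  have hy0 := residue_nonneg r X (a (1 + g + 4 * q))
  have hy1 := residue_lt r X (a (1 + g + 4 * q))
  have hy2 := residue_nonneg r X (groupSum a g d)
  have hy3 := residue_lt r X (groupSum a g d)
  have hy4 : 0 ≤ residue r X (a (1 + g + 4 * q)) + residue r X (groupSum a g d) := by linarith
  have hy5 : residue r X (a (1 + g + 4 * q)) + residue r X (groupSum a g d) < 2 * 2 ^ X := by
    linarith
  have hx6 := residue_add r (k + X) (a (1 + g + 4 * q)) (groupSum a g d)
  have hy6 := residue_add r X (a (1 + g + 4 * q)) (groupSum a g d)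
  rw [hsum] at hx6 hy6
  have hx7 := residue_nonneg r (k + X) (groupSum a g j)
  have hx8 := residue_lt r (k + X) (groupSum a g j)
  have hy7 := residue_nonneg r X (groupSum a g j)
  have hy8 := residue_lt r X (groupSum a g j)
  have ga := abs_le.1 (abs_groupSum_le ha g d)
  have gb := abs_le.1 (abs_groupSum_le ha g j)
  have hB : (2 : ℤ) ^ 20 ≤ 2 ^ (2 * X + 20) := int_two_pow_le (by omega)
  norm_num at hB
  have hB2 : (2 : ℤ) ^ (2 * X + 20) = 2 ^ (2 * X) * 2 ^ 20 := pow_add _ _ _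
  have hNB : (2 : ℤ) ^ (k + X) ≤ 2 ^ (2 * X) := int_two_pow_le (by omega)
  have hDB : (2 : ℤ) ^ X ≤ 2 ^ (2 * X) := int_two_pow_le (by omega)
  have hLB : (2 : ℤ) ^ (k + 1) ≤ 2 ^ (2 * X) * 2 := by
    rw [← pow_succ]; exact int_two_pow_le (by omega)
  have hiB : ((1 + g + 4 * q : ℕ) : ℤ) < 2 ^ (2 * X + 10) := by
    have h5 : k < 2 ^ k := Nat.lt_two_pow_self
    have h6 : 2 ^ k ≤ 2 ^ (2 * X) := Nat.pow_le_pow_right (by norm_num) (by omega)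
    have h7 : 0 < 2 ^ (2 * X) := by positivity
    have : 1 + g + 4 * q < 2 ^ (2 * X + 10) := by rw [pow_add]; omega
    exact_mod_cast this
  have hB3 : (2 : ℤ) ^ (2 * X + 10) = 2 ^ (2 * X) * 2 ^ 10 := pow_add _ _ _
  have hjB : (j : ℤ) < 2 ^ (k + 1) := by exact_mod_cast hj
  have hi0 : (0 : ℤ) ≤ (1 + g + 4 * q : ℕ) := Int.natCast_nonneg _
  obtain ⟨σ', hσ'⟩ : ∃ σ', σ' = listBody.eval τ σ := ⟨_, rfl⟩
  have e := hσ'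
  have hd0 : (0 : ℤ) ≤ d := Int.natCast_nonneg _
  have hw0 : (0 : ℤ) ≤ w := Int.natCast_nonneg _
  have hjz : (d : ℤ) < j := by exact_mod_cast hdj
  have hwj : (w : ℤ) ≤ j := by exact_mod_cast hjle
  rw [← hσ']
  generalize (2 : ℤ) ^ (2 * X + 20) = B at hb hB hB2 ⊢
  generalize (2 : ℤ) ^ (2 * X + 10) = B' at hiB hB3
  generalize (2 : ℤ) ^ (2 * X) = M at hB2 hB3 hNB hDB hLB
  generalize (2 : ℤ) ^ (k + X) = N at hN hx1 hx3 hx5 hx6 hx8 hNB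
  generalize (2 : ℤ) ^ X = D at hD hy1 hy3 hy5 hy6 hy8 hDB ga gb
  generalize (2 : ℤ) ^ (k + 1) = L at hL hLB hjB ⊢
  have main : σ'.Bdd (B) ∧ Frame [.i, .pw, .j, .t, .b, .a, .ck] [.V, .X, .Y] σ σ' ∧
      σ'.S .ck = L - (j + 1) ∧ σ'.S .j = (j + 1 : ℕ) ∧
      σ'.A .V = Function.update (σ.A .V) j (groupSum a g j) ∧
      σ'.A .X = Function.update (σ.A .X) j (residue r (k + X) (groupSum a g j)) ∧
      σ'.A .Y = Function.update (σ.A .Y) j (residue r X (groupSum a g j)) ∧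
      ∃ q', 2 ^ q' ≤ j + 1 ∧ j + 1 < 2 ^ (q' + 1) ∧ σ'.S .i = (1 + g + 4 * q' : ℕ) ∧
        σ'.S .pw = (2 ^ q' : ℕ) := by
    by_cases hpos : 0 < (w : ℤ) + w - (j + 1)
    · simp only [listBody, block, Code.eval, Store.set_S, h1, h4, hN, hD, hL, hji, hii, hpw, hsub,
        reduceCtorEq, if_true, if_false, ne_eq, not_false_eq_true, Store.set_A, Store.put_S,
        Store.put_A, Int.toNat_natCast, hV, hX, hY, hA, hXA, hYA, hsum, addMod_eval, hx4, hx5, hy4,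
        hy5, ← hx6, ← hy6, hpos] at e
      rw [e]
      refine ⟨?_, ?_, ?_, ?_, ?_, ?_, ?_, q, by omega, by rw [pow_succ]; omega, ?_, ?_⟩
      · clear e
        repeat' first | apply Store.Bdd.set | apply Store.Bdd.put
        · exact hb
        · rw [abs_le]; constructor <;> linarith only [hd0, hjz, hjB, hLB, hB2, hB]
        · rw [abs_le]; constructor <;> linarith only [ga, hDB, hB2, hB]
        · exact (hA ▸ hb.2 .A (1 + g + 4 * q))
        all_goals
          rw [abs_le]
          constructor <;> linarith only [hd0, hjz, hjB, hLB, hB2, hB, ga, gb, hDB, hNB, hx0, hx1, hx2,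
            hx3, hx7, hx8, hy0, hy1, hy2, hy3, hy7, hy8, hw0, hwj]
      · repeat' first | apply Frame.set | apply Frame.put
        · exact Frame.refl _ _ _
        all_goals decide
      all_goals simp [Store.set_S, Store.put_A, hii, hpw, hw]
    · simp only [listBody, block, Code.eval, Store.set_S, h1, h4, hN, hD, hL, hji, hii, hpw, hsub,
        reduceCtorEq, if_true, if_false, ne_eq, not_false_eq_true, Store.set_A, Store.put_S,
        Store.put_A, Int.toNat_natCast, hV, hX, hY, hA, hXA, hYA, hsum, addMod_eval, hx4, hx5, hy4,
        hy5, ← hx6, ← hy6, hpos] at e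
      rw [e]
      refine ⟨?_, ?_, ?_, ?_, ?_, ?_, ?_, q + 1, by rw [pow_succ]; omega,
        by rw [pow_succ, pow_succ]; omega, ?_, ?_⟩
      · clear e
        repeat' first | apply Store.Bdd.set | apply Store.Bdd.put
        · exact hb
        · rw [abs_le]; constructor <;> linarith only [hd0, hjz, hjB, hLB, hB2, hB]
        · rw [abs_le]; constructor <;> linarith only [ga, hDB, hB2, hB]
        · exact (hA ▸ hb.2 .A (1 + g + 4 * q))
        all_goals
          rw [abs_le]
          constructor <;> linarith only [hd0, hjz, hjB, hLB, hB2, hB, ga, gb, hDB, hNB, hx0, hx1, hx2,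
            hx3, hx7, hx8, hy0, hy1, hy2, hy3, hy7, hy8, hw0, hwj, hi0, hiB, hB3]
      · repeat' first | apply Frame.set | apply Frame.put
        · exact Frame.refl _ _ _
        all_goals decide
      all_goals simp [Store.set_S, Store.put_A, hw, pow_succ]; try ring
  obtain ⟨m1, hf, m3, m4, m5, m6, m7, q', m8, m9, m10, m11⟩ := main
  refine ⟨m1, ⟨q', m8, ?_⟩, m3⟩
  have hupd : ∀ (f : ℕ → ℤ) (F : ℕ → ℤ), (∀ e < j, f e = F e) →
      ∀ e < j + 1, Function.update f j (F j) e = F e := by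
    intro f F hF e hej
    by_cases hej' : e = j
    · subst hej'; simp
    · rw [Function.update_of_ne hej', hF e (by omega)]
  constructor
  case outside =>
    intro e he
    have hne : e ≠ j := by omega
    rw [m5, m6, m7, Function.update_of_ne hne, Function.update_of_ne hne, Function.update_of_ne hne]
    exact h.outside e he
  case V_eq => rw [m5]; exact hupd _ _ h.V_eq
  case X_eq => rw [m6]; exact hupd _ (fun e => residue r (k + X) (groupSum a g e)) h.X_eq
  case Y_eq => rw [m7]; exact hupd _ (fun e => residue r X (groupSum a g e)) h.Y_eq
  case j_eq => exact m4
  case i_eq => exact m10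
  case pw_eq => exact m11
  case le => exact m8
  case lt => exact m9
  case frame => exact h.frame.trans hf

theorem listStages_ends (hkX : k ≤ X) (hg : g < 4) (ha : ∀ I : Finset ℕ, ∑ i ∈ I, |a i| ≤ 2 ^ X)
    (henv : Env X k r cnt a σ) (ho : Outside k σ) (hb : σ.Bdd (2 ^ (2 * X + 20))) :
    Ends τ (2 ^ (2 * X + 20)) (listStages g) (2 ^ (k + 1)) σ fun σ' =>
      Listed X k r a g σ' ∧ Frame [.i, .pw, .j, .t, .b, .a, .ck] [.V, .X, .Y] σ σ' := by
  have hk2 : 2 ≤ 2 ^ (k + 1) := by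
    rw [pow_succ]
    have := Nat.one_le_two_pow (n := k)
    omega
  have hinit : ListInv X k r a g σ 1 0 ((listInit g).eval τ σ) := by
    have hf : Frame [.i, .pw, .j, .t, .b, .a, .ck] [.V, .X, .Y] σ ((listInit g).eval τ σ) := by
      simp only [listInit, block, Code.eval]
      repeat' apply Frame.set
      · exact Frame.refl _ _ _
      all_goals decide
    have h0 := ho 0 (Or.inl rfl)
    constructor
    case frame => exact hf
    case outside => exact ho
    case V_eq =>
      intro e he
      obtain rfl : e = 0 := by omega
      rw [groupSum_zero]; exact h0.1
    case X_eq =>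
      intro e he
      obtain rfl : e = 0 := by omega
      rw [groupSum_zero, residue_zero]; exact h0.2.1
    case Y_eq =>
      intro e he
      obtain rfl : e = 0 := by omega
      rw [groupSum_zero, residue_zero]; exact h0.2.2
    all_goals simp [listInit, block, Code.eval, Store.set_S]
  -- Entry 0 is already present as zero. The entries from `1` to `2 ^ (k + 1) - 1` take one round
  -- each, and the initialization takes one more.
  refine Ends.mono (n := 1 + ((2 ^ (k + 1) - 2) + 1)) ?_ (by omega)
  refine Ends.append (l := [(listInit g, .zero)])
    (Q := fun σ' => ListInv X k r a g σ 1 0 σ') (Ends.code ?_ ?_ hinit) ?_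
  · rw [hinit.frame.1 _ (by decide), henv.zero]
  · have hB : (2 : ℤ) ^ 20 ≤ 2 ^ (2 * X + 20) := int_two_pow_le (by omega)
    norm_num at hB
    simp only [listInit, block, Code.eval]
    refine ((hb.set ?_).set ?_).set ?_ <;> rw [abs_le] <;> constructor <;> push_cast <;> omega
  · intro σ₁ hb₁ h₁
    refine Ends.loop (fun i s => ∃ q, ListInv X k r a g σ (i + 1) q s) _ ⟨0, h₁⟩ hb₁ ?_ ?_
    · rintro i hi s hb ⟨q, h⟩
      obtain ⟨h2, ⟨q', -, h3⟩, h4⟩ := listBody_inv (τ := τ) hkX hg ha henv (by omega) hb h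
      refine ⟨h2, ⟨q', h3⟩, ?_⟩
      rw [h4]
      have : ((i + 1 + 1 : ℕ) : ℤ) < (2 ^ (k + 1) : ℕ) := by
        rw [Nat.cast_lt]; omega
      push_cast at this ⊢
      linarith
    · rintro s hb ⟨q, h⟩
      obtain ⟨h2, ⟨q', -, h3⟩, h4⟩ := listBody_inv (τ := τ) hkX hg ha henv (by omega) hb h
      have hj : 2 ^ (k + 1) - 2 + 1 + 1 = 2 ^ (k + 1) := by omega
      rw [hj] at h3
      refine ⟨h2, ⟨⟨?_, ?_, ?_⟩, h3.frame⟩, ?_⟩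
      · intro e
        unfold listVal
        split_ifs with he
        · exact h3.V_eq e he
        · exact (h3.outside e (Or.inr (by omega))).1
      · intro e
        unfold listVal
        split_ifs with he
        · exact h3.X_eq e he
        · rw [residue_zero]; exact (h3.outside e (Or.inr (by omega))).2.1
      · intro e
        unfold listVal
        split_ifs with he
        · exact h3.Y_eq e he
        · rw [residue_zero]; exact (h3.outside e (Or.inr (by omega))).2.2
      · rw [h4]
        have : ((2 ^ (k + 1) - 2 + 1 + 1 : ℕ) : ℤ) = (2 ^ (k + 1) : ℕ) := by rw [hj]
        push_cast at this ⊢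
        linarith

end

/-! ### Buckets -/

/-- The number `p` points to a linked list with the entries `l`; the pointer to an entry `v` is
`v + 1`, and `nx v` is the successor of the pointer to the next entry. -/
def Chained (nx : ℕ → ℤ) : ℤ → List ℕ → Prop
  | p, [] => p = 0
  | p, v :: l => p = v + 1 ∧ Chained nx (nx v - 1) l

theorem Chained.congr {nx nx' : ℕ → ℤ} {l : List ℕ} (h : ∀ v ∈ l, nx' v = nx v) :
    ∀ {p : ℤ}, Chained nx p l → Chained nx' p l := by
  induction l with
  | nil => exact fun h' => h'
  | cons v l ih =>
    rintro p ⟨h1, h2⟩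
    refine ⟨h1, ih (fun u hu => h u (List.mem_cons_of_mem _ hu)) ?_⟩
    rw [h v List.mem_cons_self]
    exact h2

theorem Chained.nonneg {nx : ℕ → ℤ} {p : ℤ} {l : List ℕ} (h : Chained nx p l) : 0 ≤ p := by
  cases l with
  | nil => exact h.ge
  | cons v l => rw [h.1]; positivity

theorem Chained.le {nx : ℕ → ℤ} {p : ℤ} {l : List ℕ} {K : ℤ} (h : Chained nx p l) (hK : 0 ≤ K)
    (hl : ∀ v ∈ l, (v : ℤ) ≤ K) : p ≤ K + 1 := by
  cases l with
  | nil => rw [h]; omega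
  | cons v l =>
    have := hl v List.mem_cons_self
    rw [h.1]; omega

/-- The arrays `hd` and `nx` hold linked lists `lst b` of the keys of the numbers `j < m`, for each
bucket `b`. -/
structure Bucketed (key bkt : ℕ → ℕ) (m : ℕ) (hd nx : ℕ → ℤ) (lst : ℕ → List ℕ) : Prop where
  chain : ∀ b, Chained nx (hd b) (lst b)
  mem_iff : ∀ b v, v ∈ lst b ↔ ∃ j < m, v = key j ∧ b = bkt j
  nodup : ∀ b, (lst b).Nodup
  nx_pos : ∀ b, ∀ v ∈ lst b, 0 < nx v
  nx_zero : ∀ v, (∀ b, v ∉ lst b) → nx v = 0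

theorem Bucketed.empty (key bkt : ℕ → ℕ) :
    Bucketed key bkt 0 (fun _ => 0) (fun _ => 0) (fun _ => []) := by
  constructor <;> simp [Chained]

section
variable {key bkt : ℕ → ℕ} {m : ℕ} {hd nx : ℕ → ℤ} {lst : ℕ → List ℕ}

/-- A positive `nx` entry says that the key is present. Equal keys lie in equal buckets, so the key
is already in the right list. -/
theorem Bucketed.insert_old (h : Bucketed key bkt m hd nx lst)
    (hkb : ∀ i j, key i = key j → bkt i = bkt j) (hm : 0 < nx (key m)) :
    Bucketed key bkt (m + 1) hd nx lst := by
  refine ⟨h.chain, fun b v => ?_, h.nodup, h.nx_pos, h.nx_zero⟩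
  rw [h.mem_iff]
  constructor
  · rintro ⟨j, hj, h'⟩
    exact ⟨j, by omega, h'⟩
  · rintro ⟨j, hj, rfl, rfl⟩
    obtain hj | rfl : j < m ∨ j = m := by omega
    · exact ⟨j, hj, rfl, rfl⟩
    · by_contra hno
      refine hm.ne' (h.nx_zero _ fun b hb => hno ?_)
      obtain ⟨i, hi, h1, -⟩ := (h.mem_iff b _).1 hb
      exact ⟨i, hi, h1, hkb _ _ h1⟩

/-- The entry `nx v` is the next pointer plus one, hence positive even at the end of a list. The
same array therefore serves as a membership table, and memory that is initially zero needs no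
preparation. -/
theorem Bucketed.insert_new (h : Bucketed key bkt m hd nx lst) (hm : ¬ 0 < nx (key m)) :
    Bucketed key bkt (m + 1) (Function.update hd (bkt m) (key m + 1))
      (Function.update nx (key m) (hd (bkt m) + 1))
      (Function.update lst (bkt m) (key m :: lst (bkt m))) := by
  have hnot : ∀ b, key m ∉ lst b := fun b hb => hm (h.nx_pos b _ hb)
  have hcongr : ∀ b, ∀ v ∈ lst b, Function.update nx (key m) (hd (bkt m) + 1) v = nx v := by
    intro b v hv
    rw [Function.update_of_ne]
    rintro rfl
    exact hnot b hv
  constructor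
  case chain =>
    intro b
    by_cases hb : b = bkt m
    · subst hb
      rw [Function.update_self, Function.update_self]
      refine ⟨rfl, ?_⟩
      rw [Function.update_self, add_sub_cancel_right]
      exact (h.chain _).congr (hcongr _)
    · rw [Function.update_of_ne hb, Function.update_of_ne hb]
      exact (h.chain _).congr (hcongr _)
  case mem_iff =>
    intro b v
    have : v ∈ Function.update lst (bkt m) (key m :: lst (bkt m)) b ↔
        v ∈ lst b ∨ (v = key m ∧ b = bkt m) := by
      by_cases hb : b = bkt m
      · subst hb; simp [or_comm]
      · simp [hb]
    rw [this, h.mem_iff]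
    constructor
    · rintro (⟨j, hj, h'⟩ | h')
      · exact ⟨j, by omega, h'⟩
      · exact ⟨m, by omega, h'⟩
    · rintro ⟨j, hj, h'⟩
      obtain hj | rfl : j < m ∨ j = m := by omega
      · exact Or.inl ⟨j, hj, h'⟩
      · exact Or.inr h'
  case nodup =>
    intro b
    by_cases hb : b = bkt m
    · subst hb
      rw [Function.update_self, List.nodup_cons]
      exact ⟨hnot _, h.nodup _⟩
    · rw [Function.update_of_ne hb]; exact h.nodup b
  case nx_pos =>
    intro b v hv
    by_cases hvm : v = key m
    · subst hvm
      rw [Function.update_self]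
      have := (h.chain (bkt m)).nonneg
      omega
    · rw [Function.update_of_ne hvm]
      apply h.nx_pos b v
      by_cases hb : b = bkt m
      · subst hb; simpa [hvm] using hv
      · rwa [Function.update_of_ne hb] at hv
  case nx_zero =>
    intro v hv
    have hvm : v ≠ key m := by
      rintro rfl
      exact hv (bkt m) (by simp)
    rw [Function.update_of_ne hvm]
    apply h.nx_zero
    intro b hb
    by_cases hbm : b = bkt m
    · subst hbm; exact hv (bkt m) (by simp [hb])
    · exact hv b (by rwa [Function.update_of_ne hbm])

end

/-! ### Buckets as high parts of hash values, and sorting into them. -/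

/-- The bucket of a number. -/
def bucket (r k X : ℕ) (v : ℤ) : ℕ := (residue r (k + X) v - residue r X v).toNat

/-- The smaller modulus divides the larger one. The bucket is therefore the residue modulo `2 ^ (k +
X)` rounded down to a multiple of `2 ^ X`. -/
theorem residue_emod (r k X : ℕ) (v : ℤ) : residue r (k + X) v % 2 ^ X = residue r X v := by
  unfold residue
  exact Int.emod_emod_of_dvd _ (pow_dvd_pow 2 (by omega))

theorem residue_le_residue (r k X : ℕ) (v : ℤ) : residue r X v ≤ residue r (k + X) v := by
  rw [← residue_emod r k X v]
  have h := Int.emod_add_mul_ediv (residue r (k + X) v) (2 ^ X)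
  have h' : 0 ≤ (2 : ℤ) ^ X * (residue r (k + X) v / 2 ^ X) :=
    mul_nonneg (by positivity) (Int.ediv_nonneg (residue_nonneg _ _ _) (by positivity))
  omega

theorem natCast_bucket (r k X : ℕ) (v : ℤ) :
    (bucket r k X v : ℤ) = residue r (k + X) v - residue r X v := by
  unfold bucket
  rw [Int.toNat_of_nonneg]
  have := residue_le_residue r k X v
  omega

theorem bucket_lt (r k X : ℕ) (v : ℤ) : (bucket r k X v : ℤ) < 2 ^ (k + X) := by
  have h1 := residue_nonneg r X v
  have h2 := residue_lt r (k + X) v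
  rw [natCast_bucket]
  omega

/-- The key of a number of absolute value at most `2 ^ X`. -/
def keyOf (X : ℕ) (v : ℤ) : ℕ := (v + 2 ^ X).toNat

theorem natCast_keyOf {X : ℕ} {v : ℤ} (h : |v| ≤ 2 ^ X) : (keyOf X v : ℤ) = v + 2 ^ X := by
  unfold keyOf
  have := abs_le.1 h
  rw [Int.toNat_of_nonneg]
  omega

theorem abs_listVal_le {a : ℕ → ℤ} {B : ℤ} (ha : ∀ I : Finset ℕ, ∑ i ∈ I, |a i| ≤ B)
    (k g e : ℕ) : |listVal a k g e| ≤ B := by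
  unfold listVal
  split_ifs
  · exact abs_groupSum_le ha g e
  · simpa using ha ∅

/-- The store when the subset sums with numbers less than `j` have been inserted. -/
structure InsertInv (X k r : ℕ) (a : ℕ → ℤ) (g : ℕ) (hd nx : Arr) (σ₀ : Store) (j : ℕ) (σ : Store) :
    Prop where
  bucketed : ∃ lst, Bucketed (fun e => keyOf X (listVal a k g e))
    (fun e => bucket r k X (listVal a k g e)) j (σ.A hd) (σ.A nx) lst
  j_eq : σ.S .j = j
  frame : Frame [.v, .t, .a, .b, .j, .ck] [hd, nx] σ₀ σ

section
variable {τ : Tapes} {X k r cnt : ℕ} {a : ℕ → ℤ} {σ₀ σ : Store} {g : ℕ} {hd nx : Arr}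

/-- Values that occur several times are inserted once. Without this, an entry of the other list
could have exponentially many partners with the same correct sum, and no choice of the multiplier
would help. -/
theorem insertBody_inv (hkX : k ≤ X) (ha : ∀ I : Finset ℕ, ∑ i ∈ I, |a i| ≤ 2 ^ X)
    (hhn : hd ≠ nx) (hhd : ∀ q ∈ [Arr.A, .XA, .YA, .V, .X, .Y], q ≠ hd)
    (hnx : ∀ q ∈ [Arr.A, .XA, .YA, .V, .X, .Y], q ≠ nx)
    (he₀ : Env X k r cnt a σ₀) (hl₀ : Listed X k r a g σ₀) {j : ℕ} (hj : j < 2 ^ (k + 1))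
    (hb : σ.Bdd (2 ^ (2 * X + 20))) (h : InsertInv X k r a g hd nx σ₀ j σ) :
    ((insertBody hd nx).eval τ σ).Bdd (2 ^ (2 * X + 20)) ∧
      InsertInv X k r a g hd nx σ₀ (j + 1) ((insertBody hd nx).eval τ σ) ∧
      ((insertBody hd nx).eval τ σ).S .ck = 2 ^ (k + 1) - (j + 1) := by
  have h1 : σ.S .one = 1 := by rw [h.frame.1 _ (by decide), he₀.one]
  have hD : σ.S .D = 2 ^ X := by rw [h.frame.1 _ (by decide), he₀.D]
  have hL : σ.S .L = 2 ^ (k + 1) := by rw [h.frame.1 _ (by decide), he₀.L]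
  have hout : ∀ q ∈ [Arr.A, .XA, .YA, .V, .X, .Y], q ∉ [hd, nx] := by
    intro q hq
    simp [hhd q hq, hnx q hq]
  have hjj := h.j_eq
  obtain ⟨v, hv⟩ : ∃ v, v = listVal a k g j := ⟨_, rfl⟩
  have hV : σ.A .V j = v := by rw [h.frame.2 _ (hout _ (by decide)), hl₀.V_eq, hv]
  have hX : σ.A .X j = residue r (k + X) v := by
    rw [h.frame.2 _ (hout _ (by decide)), hl₀.X_eq, hv]
  have hY : σ.A .Y j = residue r X v := by
    rw [h.frame.2 _ (hout _ (by decide)), hl₀.Y_eq, hv]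
  have hva : |v| ≤ 2 ^ X := hv ▸ abs_listVal_le ha k g j
  have hkey := natCast_keyOf hva
  have hbkt := natCast_bucket r k X v
  have hbkt' := bucket_lt r k X v
  obtain ⟨lst, hlst⟩ := h.bucketed
  have hle : ∀ b, ∀ u ∈ lst b, (u : ℤ) ≤ 2 * 2 ^ X := by
    intro b u hu
    obtain ⟨i, -, rfl, -⟩ := (hlst.mem_iff b u).1 hu
    have h2 := abs_listVal_le ha k g i
    have h3 := natCast_keyOf h2
    have h4 := abs_le.1 h2
    omega
  have hh0 := (hlst.chain (bucket r k X v)).nonneg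
  have hh1 := (hlst.chain (bucket r k X v)).le (by positivity) (hle _)
  -- The shift by `2 ^ X` is injective on values of absolute value at most `2 ^ X`, so equal keys
  -- come from equal values.
  have hkb : ∀ i j, keyOf X (listVal a k g i) = keyOf X (listVal a k g j) →
      bucket r k X (listVal a k g i) = bucket r k X (listVal a k g j) := by
    intro i j hij
    have h2 := natCast_keyOf (abs_listVal_le ha k g i)
    have h3 := natCast_keyOf (abs_listVal_le ha k g j)
    rw [hij, h3] at h2
    rw [add_right_cancel h2]
  have hnew := hlst.insert_new
  have hold := hlst.insert_old hkb
  simp only [← hv] at hnew hold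
  have hB : (2 : ℤ) ^ 20 ≤ 2 ^ (2 * X + 20) := int_two_pow_le (by omega)
  norm_num at hB
  have hB2 : (2 : ℤ) ^ (2 * X + 20) = 2 ^ (2 * X) * 2 ^ 20 := pow_add _ _ _
  have hNB : (2 : ℤ) ^ (k + X) ≤ 2 ^ (2 * X) := int_two_pow_le (by omega)
  have hDB : (2 : ℤ) ^ X ≤ 2 ^ (2 * X) := int_two_pow_le (by omega)
  have hLB : (2 : ℤ) ^ (k + 1) ≤ 2 ^ (2 * X) * 2 := by
    rw [← pow_succ]; exact int_two_pow_le (by omega)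
  have hjB : (j : ℤ) < 2 ^ (k + 1) := by exact_mod_cast hj
  have hj0 : (0 : ℤ) ≤ j := Int.natCast_nonneg _
  have hva' := abs_le.1 hva
  have hb0 : (0 : ℤ) ≤ bucket r k X v := Int.natCast_nonneg _
  obtain ⟨σ', hσ'⟩ : ∃ σ', σ' = (insertBody hd nx).eval τ σ := ⟨_, rfl⟩
  have e := hσ'
  rw [← hσ']
  have hVn := hnx .V (by decide)
  have hXn := hnx .X (by decide)
  have hYn := hnx .Y (by decide)
  by_cases hpos : 0 < σ.A nx (keyOf X v)
  · simp only [insertBody, block, Code.eval, Store.set_S, h1, hD, hL, hjj, reduceCtorEq, if_true,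
      if_false, ne_eq, not_false_eq_true, Store.set_A, Int.toNat_natCast, hV, ← hkey, hpos] at e
    rw [e]
    refine ⟨?_, ⟨⟨lst, ?_⟩, ?_, h.frame.trans ?_⟩, ?_⟩
    · clear e
      repeat' first | apply Store.Bdd.set | apply Store.Bdd.put
      · exact hb
      · rw [abs_le]; constructor <;> linarith
      · rw [abs_le]; constructor <;> linarith
      · exact hb.2 _ _
      · rw [abs_le]; constructor <;> linarith
      · rw [abs_le]; constructor <;> linarith
    · exact hold hpos
    · simp [Store.set_S]
    · repeat' first | apply Frame.set | apply Frame.put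
      · exact Frame.refl _ _ _
      all_goals decide
    · simp [Store.set_S]
  · simp only [insertBody, block, Code.eval, Store.set_S, h1, hD, hL, hjj, reduceCtorEq, if_true,
      if_false, ne_eq, not_false_eq_true, Store.set_A, Int.toNat_natCast, hV, ← hkey, hpos, hX, hY,
      ← hbkt, Store.put_S, Store.put_A] at e
    rw [e]
    refine ⟨?_, ⟨⟨Function.update lst (bucket r k X v) (keyOf X v :: lst (bucket r k X v)), ?_⟩, ?_,
      h.frame.trans ?_⟩, ?_⟩
    · clear e
      repeat' first | apply Store.Bdd.set | apply Store.Bdd.put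
      · exact hb
      · rw [abs_le]; constructor <;> linarith
      · rw [abs_le]; constructor <;> linarith
      · exact hb.2 _ _
      · exact hX ▸ hb.2 .X j
      · exact hY ▸ hb.2 .Y j
      all_goals rw [abs_le]; constructor <;> linarith
    · simp only [Store.set_A, Store.put_A, hhn, hhn.symm, if_true, if_false]
      exact hnew hpos
    · simp [Store.set_S]
    · repeat' first | apply Frame.set | apply Frame.put
      · exact Frame.refl _ _ _
      all_goals first | decide | simp
    · simp [Store.set_S]

/-- The subset sums of a group are distributed to buckets. -/
theorem insertStages_ends (hkX : k ≤ X) (ha : ∀ I : Finset ℕ, ∑ i ∈ I, |a i| ≤ 2 ^ X)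
    (hhn : hd ≠ nx) (hhd : ∀ q ∈ [Arr.A, .XA, .YA, .V, .X, .Y], q ≠ hd)
    (hnx : ∀ q ∈ [Arr.A, .XA, .YA, .V, .X, .Y], q ≠ nx)
    (henv : Env X k r cnt a σ) (hl : Listed X k r a g σ) (h0 : σ.A hd = fun _ => 0)
    (h0' : σ.A nx = fun _ => 0) (hb : σ.Bdd (2 ^ (2 * X + 20))) :
    Ends τ (2 ^ (2 * X + 20)) (insertStages hd nx) (1 + 2 ^ (k + 1)) σ fun σ' =>
      (∃ lst, Bucketed (fun e => keyOf X (listVal a k g e))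
        (fun e => bucket r k X (listVal a k g e)) (2 ^ (k + 1)) (σ'.A hd) (σ'.A nx) lst) ∧
      Frame [.v, .t, .a, .b, .j, .ck] [hd, nx] σ σ' := by
  have hpos : 0 < 2 ^ (k + 1) := by positivity
  refine Ends.append (l := [(.const .j 0, .zero)])
    (Q := fun σ' => InsertInv X k r a g hd nx σ 0 σ') (Ends.code ?_ ?_ ?_) ?_
  · simp [Code.eval, Store.set_S, henv.zero]
  · exact hb.set (by simp)
  · refine ⟨⟨fun _ => [], ?_⟩, by simp [Code.eval], (Frame.refl _ _ _).set (by decide)⟩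
    simp only [Code.eval, Store.set_A, h0, h0']
    exact Bucketed.empty _ _
  · intro σ₁ hb₁ h₁
    obtain ⟨m, hm⟩ : ∃ m, 2 ^ (k + 1) = m + 1 := ⟨2 ^ (k + 1) - 1, by omega⟩
    have hm' : (2 : ℤ) ^ (k + 1) = m + 1 := by exact_mod_cast hm
    refine Ends.mono ?_ hm.ge
    refine Ends.loop (fun i s => InsertInv X k r a g hd nx σ i s) m h₁ hb₁ ?_ ?_
    · intro i hi s hb h
      obtain ⟨h2, h3, h4⟩ := insertBody_inv (τ := τ) hkX ha hhn hhd hnx henv hl (by omega) hb h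
      exact ⟨h2, h3, by rw [h4]; omega⟩
    · intro s hb h
      obtain ⟨h2, h3, h4⟩ := insertBody_inv (τ := τ) hkX ha hhn hhd hnx henv hl (by omega) hb h
      rw [← hm] at h3
      exact ⟨h2, ⟨h3.bucketed, h3.frame⟩, by rw [h4]; omega⟩

end

/-! ### Enumeration of pairs -/

/-- The variables that the enumeration changes. -/
abbrev enumRegs : List Reg := [.p, .j, .F, .v, .a, .b, .t, .q, .flag]

/-- After the sums in the set `Z` have been treated with the given action, `P Z` holds. -/
structure Treats (τ : Tapes) (X : ℕ) (action : Code) (σ₀ : Store) (P : Set ℤ → Store → Prop) :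
    Prop where
  step : ∀ Z σ z, σ.Bdd (2 ^ (2 * X + 20)) → Frame enumRegs [.mark] σ₀ σ → P Z σ → σ.S .a = z →
    0 ≤ z → z ≤ 3 * 2 ^ X → (action.eval τ σ).Bdd (2 ^ (2 * X + 20)) ∧
      Frame [.a, .b, .flag] [.mark] σ (action.eval τ σ) ∧ P (insert z Z) (action.eval τ σ)
  congr : ∀ Z σ σ', P Z σ → σ'.S .flag = σ.S .flag → σ'.A .mark = σ.A .mark → P Z σ'

/-- The bucket of the partners of the number `v`, if the sum of the buckets shall be `s`. -/
def partner (r k X : ℕ) (s v : ℤ) : ℕ := ((s - bucket r k X v) % 2 ^ (k + X)).toNat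

theorem natCast_partner (r k X : ℕ) (s v : ℤ) :
    (partner r k X s v : ℤ) = (s - bucket r k X v) % 2 ^ (k + X) := by
  unfold partner
  rw [Int.toNat_of_nonneg]
  exact Int.emod_nonneg _ (by positivity)

/-- The number of rounds for the first `m` elements of a list whose buckets of partners are
`lst (q j)`. -/
def workload (lst : ℕ → List ℕ) (q : ℕ → ℕ) (m : ℕ) : ℕ :=
  ∑ j ∈ Finset.range m, (1 + (lst (q j)).length)

theorem workload_succ (lst : ℕ → List ℕ) (q : ℕ → ℕ) (m : ℕ) :
    workload lst q (m + 1) = workload lst q m + (1 + (lst (q m)).length) :=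
  Finset.sum_range_succ _ _

theorem workload_mono (lst : ℕ → List ℕ) (q : ℕ → ℕ) {m n : ℕ} (h : m ≤ n) :
    workload lst q m ≤ workload lst q n :=
  Finset.sum_le_sum_of_subset (Finset.range_subset_range.2 h)

/-- The state of the enumeration after `i` rounds. The numbers `j < m` have been treated, except for
the partners `l` of the last one. -/
structure EnumInv (val : ℕ → ℤ) (lst : ℕ → List ℕ) (q : ℕ → ℕ) (fuel : ℤ) (nx : ℕ → ℤ)
    (P : Set ℤ → Store → Prop) (σ₀ : Store) (i m : ℕ) (l : List ℕ) (Z : Set ℤ) (σ : Store) :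
    Prop where
  treated : P Z σ
  sound : ∀ z ∈ Z, ∃ j, ∃ v ∈ lst (q j), z = val j + v
  complete : ∀ j < m, ∀ v ∈ lst (q j), val j + v ∈ Z ∨ (j + 1 = m ∧ v ∈ l)
  chain : Chained nx (σ.S .p) l
  rest : ∀ v ∈ l, 1 ≤ m ∧ v ∈ lst (q (m - 1))
  count : i + l.length = workload lst q m
  le : m ≤ i
  j_eq : σ.S .j = (m : ℤ) - 1
  F_eq : σ.S .F = fuel - i
  frame : Frame enumRegs [.mark] σ₀ σ

section
variable {τ : Tapes} {X k r cnt : ℕ} {a : ℕ → ℤ} {σ₀ σ : Store} {g : ℕ} {hd nx : Arr}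
  {lst : ℕ → List ℕ} {s : ℤ} {action : Code} {P : Set ℤ → Store → Prop}

-- When no partner is left, a round is spent on moving to the next entry and fetching the head of
-- its bucket. An entry thus costs one round plus the length of that bucket, as counted by
-- `workload`.
set_option maxHeartbeats 400000 in
theorem enumBody_next (hkX : k ≤ X)
    (hhd : hd ≠ .mark) (he₀ : Env X k r cnt a σ₀) (hl₀ : Listed X k r a g σ₀)
    (hs : σ₀.S .sg = s) (hs0 : 0 ≤ s) (hs1 : s < 2 ^ (k + X))
    (hchain : ∀ b, Chained (σ₀.A nx) (σ₀.A hd b) (lst b))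
    (hkey : ∀ b, ∀ u ∈ lst b, (u : ℤ) ≤ 2 * 2 ^ X) (hP : Treats τ X action σ₀ P) {i m : ℕ}
    {Z : Set ℤ} (hi : i < 64 * 2 ^ (k + 1)) (hb : σ.Bdd (2 ^ (2 * X + 20)))
    (h : EnumInv (listVal a k g) lst (fun j => partner r k X s (listVal a k g j))
      (64 * 2 ^ (k + 1)) (σ₀.A nx) P σ₀ i m [] Z σ) :
    ((enumBody hd nx action).eval τ σ).Bdd (2 ^ (2 * X + 20)) ∧
      ∃ m' l' Z', EnumInv (listVal a k g) lst (fun j => partner r k X s (listVal a k g j))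
        (64 * 2 ^ (k + 1)) (σ₀.A nx) P σ₀ (i + 1) m' l' Z' ((enumBody hd nx action).eval τ σ) := by
  have hB : (2 : ℤ) ^ 20 ≤ 2 ^ (2 * X + 20) := int_two_pow_le (by omega)
  norm_num at hB
  have hB2 : (2 : ℤ) ^ (2 * X + 20) = 2 ^ (2 * X) * 2 ^ 20 := pow_add _ _ _
  have hNB : (2 : ℤ) ^ (k + X) ≤ 2 ^ (2 * X) := int_two_pow_le (by omega)
  have hDB : (2 : ℤ) ^ X ≤ 2 ^ (2 * X) := int_two_pow_le (by omega)
  have hLB : (2 : ℤ) ^ (k + 1) ≤ 2 ^ (2 * X) * 2 := by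
    rw [← pow_succ]; exact int_two_pow_le (by omega)
  have hiB : (i : ℤ) < 64 * 2 ^ (k + 1) := by exact_mod_cast hi
  have hi0 : (0 : ℤ) ≤ i := Int.natCast_nonneg _
  have hmi : (m : ℤ) ≤ i := by exact_mod_cast h.le
  have hm0 : (0 : ℤ) ≤ m := Int.natCast_nonneg _
  have hz : σ.S .zero = 0 := by rw [h.frame.1 _ (by decide), he₀.zero]
  have h1 : σ.S .one = 1 := by rw [h.frame.1 _ (by decide), he₀.one]
  have hN : σ.S .N = 2 ^ (k + X) := by rw [h.frame.1 _ (by decide), he₀.N]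
  have hsg : σ.S .sg = s := by rw [h.frame.1 _ (by decide), hs]
  have hA : ∀ q, q ≠ .mark → σ.A q = σ₀.A q := fun q hq => h.frame.2 q (by simpa using hq)
  have hV : ∀ e, σ.A .V e = listVal a k g e := by rw [hA _ (by decide)]; exact hl₀.V_eq
  have hX : ∀ e, σ.A .X e = residue r (k + X) (listVal a k g e) := by
    rw [hA _ (by decide)]; exact hl₀.X_eq
  have hY : ∀ e, σ.A .Y e = residue r X (listVal a k g e) := by
    rw [hA _ (by decide)]; exact hl₀.Y_eq
  have hjj := h.j_eq
  have hF := h.F_eq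
  obtain ⟨σ', hσ'⟩ : ∃ σ', σ' = (enumBody hd nx action).eval τ σ := ⟨_, rfl⟩
  have e := hσ'
  rw [← hσ']
  have hp : ¬ 0 < σ.S .p := by rw [h.chain]; norm_num
  obtain ⟨v, hv⟩ : ∃ v, v = listVal a k g m := ⟨_, rfl⟩
  have hXm := hX m
  have hYm := hY m
  rw [← hv] at hXm hYm
  have hbkt := natCast_bucket r k X v
  have hbkt' := bucket_lt r k X v
  have hbkt0 : (0 : ℤ) ≤ bucket r k X v := Int.natCast_nonneg _
  have hj1 : (m : ℤ) - 1 + 1 = m := by ring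
  have hsub1 : -2 ^ (k + X) ≤ s - bucket r k X v := by linarith
  have hsub2 : s - bucket r k X v < 2 ^ (k + X) := by linarith
  have hpart := natCast_partner r k X s v
  have hpart2 : (partner r k X s v : ℤ) < 2 ^ (k + X) := by
    rw [hpart]; exact Int.emod_lt_of_pos _ (by positivity)
  have hpart0 : (0 : ℤ) ≤ partner r k X s v := Int.natCast_nonneg _
  have hhd0 := (hchain (partner r k X s v)).nonneg
  have hhd1 := (hchain (partner r k X s v)).le (by positivity) (hkey _)
  have hhd2 := hA hd hhd
  simp only [enumBody, block, Code.eval, Store.set_S, hp, h1, hz, hN, hsg, hjj, hj1, hF,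
    reduceCtorEq, if_true, if_false, ne_eq, not_false_eq_true, Store.set_A, Int.toNat_natCast,
    hXm, hYm, ← hbkt, subMod_eval, hsub1, hsub2, ← hpart, hhd2] at e
  rw [e]
  refine ⟨?_, m + 1, lst (partner r k X s v), Z, ?_⟩
  · clear e
    repeat' first | apply Store.Bdd.set | apply Store.Bdd.put
    · exact hb
    · rw [abs_le]; constructor <;>
        linarith only [hB, hB2, hNB, hDB, hLB, hiB, hi0, hmi, hm0, hbkt', hbkt0, hs0, hs1, hpart2, hpart0,
          hhd0, hhd1]
    · exact hXm ▸ hb.2 .X m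
    · exact hYm ▸ hb.2 .Y m
    all_goals rw [abs_le]; constructor <;>
        linarith only [hB, hB2, hNB, hDB, hLB, hiB, hi0, hmi, hm0, hbkt', hbkt0, hs0, hs1, hpart2, hpart0,
          hhd0, hhd1]
  · constructor
    case treated => exact hP.congr _ _ _ h.treated (by simp [Store.set_S]) rfl
    case sound => exact h.sound
    case complete =>
      intro j hj u hu
      obtain hj | rfl : j < m ∨ j = m := by omega
      · rcases h.complete j hj u hu with h2 | ⟨-, h2⟩
        · exact Or.inl h2
        · simp at h2
      · right
        rw [hv]
        exact ⟨rfl, hu⟩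
    case chain => simpa [Store.set_S] using hchain _
    case rest =>
      intro u hu
      rw [hv] at hu
      exact ⟨by omega, hu⟩
    case count =>
      rw [workload_succ, ← h.count, hv]
      simp only [List.length_nil]
      omega
    case le => have := h.le; omega
    case j_eq => simp [Store.set_S]
    case F_eq => simp [Store.set_S]; ring
    case frame =>
      refine h.frame.trans ?_
      repeat' first | apply Frame.set | apply Frame.put
      · exact Frame.refl _ _ _
      all_goals decide

-- The action may change only `a`, `b`, `flag` and the marks, so the pointer, the position and the
-- fuel survive it. The treated number is a subset sum plus a key, hence at most `2 ^ X + 2 * 2 ^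
-- X`.
set_option maxHeartbeats 400000 in
theorem enumBody_pair (hkX : k ≤ X) (ha : ∀ I : Finset ℕ, ∑ i ∈ I, |a i| ≤ 2 ^ X)
    (hnx : nx ≠ .mark) (he₀ : Env X k r cnt a σ₀) (hl₀ : Listed X k r a g σ₀)
    (hkey : ∀ b, ∀ u ∈ lst b, (u : ℤ) ≤ 2 * 2 ^ X)
    (hrange : ∀ j, ∀ u ∈ lst (partner r k X s (listVal a k g j)), 0 ≤ listVal a k g j + u)
    (hP : Treats τ X action σ₀ P) {i m : ℕ} {u : ℕ} {l : List ℕ} {Z : Set ℤ}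
    (hi : i < 64 * 2 ^ (k + 1)) (hb : σ.Bdd (2 ^ (2 * X + 20)))
    (h : EnumInv (listVal a k g) lst (fun j => partner r k X s (listVal a k g j))
      (64 * 2 ^ (k + 1)) (σ₀.A nx) P σ₀ i m (u :: l) Z σ) :
    ((enumBody hd nx action).eval τ σ).Bdd (2 ^ (2 * X + 20)) ∧
      ∃ m' l' Z', EnumInv (listVal a k g) lst (fun j => partner r k X s (listVal a k g j))
        (64 * 2 ^ (k + 1)) (σ₀.A nx) P σ₀ (i + 1) m' l' Z' ((enumBody hd nx action).eval τ σ) := by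
  have hB : (2 : ℤ) ^ 20 ≤ 2 ^ (2 * X + 20) := int_two_pow_le (by omega)
  norm_num at hB
  have hB2 : (2 : ℤ) ^ (2 * X + 20) = 2 ^ (2 * X) * 2 ^ 20 := pow_add _ _ _
  have hDB : (2 : ℤ) ^ X ≤ 2 ^ (2 * X) := int_two_pow_le (by omega)
  have hLB : (2 : ℤ) ^ (k + 1) ≤ 2 ^ (2 * X) * 2 := by
    rw [← pow_succ]; exact int_two_pow_le (by omega)
  have hiB : (i : ℤ) < 64 * 2 ^ (k + 1) := by exact_mod_cast hi
  have hi0 : (0 : ℤ) ≤ i := Int.natCast_nonneg _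
  have h1 : σ.S .one = 1 := by rw [h.frame.1 _ (by decide), he₀.one]
  have hA : ∀ q, q ≠ .mark → σ.A q = σ₀.A q := fun q hq => h.frame.2 q (by simpa using hq)
  have hV : ∀ e, σ.A .V e = listVal a k g e := by rw [hA _ (by decide)]; exact hl₀.V_eq
  have hjj := h.j_eq
  have hF := h.F_eq
  obtain ⟨σ', hσ'⟩ : ∃ σ', σ' = (enumBody hd nx action).eval τ σ := ⟨_, rfl⟩
  have e := hσ'
  rw [← hσ']
  obtain ⟨hp1, hp2⟩ := h.chain
  obtain ⟨hm1, hu⟩ := h.rest u List.mem_cons_self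
  have hp : 0 < (u : ℤ) + 1 := Int.lt_add_one_of_le (Int.natCast_nonneg u)
  have huK := hkey _ u hu
  have hu0 : (0 : ℤ) ≤ u := Int.natCast_nonneg _
  obtain ⟨j, rfl⟩ : ∃ j, m = j + 1 := ⟨m - 1, by omega⟩
  rw [Nat.add_sub_cancel] at hu
  have hj1 : ((j + 1 : ℕ) : ℤ) - 1 = j := by push_cast; ring
  rw [hj1] at hjj
  have hva := abs_le.1 (abs_listVal_le ha k g j)
  have hu1 : (u : ℤ) + 1 - 1 = u := by ring
  have hVj := hV j
  simp only [enumBody, block, Code.eval, Store.set_S, hp, h1, hjj, hF, hp1, hu1,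
    reduceCtorEq, if_true, if_false, ne_eq, not_false_eq_true, Store.set_A, Int.toNat_natCast,
    hVj] at e
  obtain ⟨σ₁, hσ₁⟩ : ∃ σ₁, σ₁ = ((σ.set .v u).set .a (listVal a k g j)).set .a
    (listVal a k g j + u) := ⟨_, rfl⟩
  rw [← hσ₁] at e
  have hb₁ : σ₁.Bdd (2 ^ (2 * X + 20)) := by
    rw [hσ₁]
    repeat' first | apply Store.Bdd.set | apply Store.Bdd.put
    · exact hb
    all_goals rw [abs_le]; constructor <;>
        linarith only [hB, hB2, hDB, hLB, hiB, hi0, huK, hu0, hva]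
  have hf₁ : Frame enumRegs [.mark] σ σ₁ := by
    rw [hσ₁]
    repeat' first | apply Frame.set | apply Frame.put
    · exact Frame.refl _ _ _
    all_goals decide
  have hP₁ : P Z σ₁ := hP.congr _ _ _ h.treated (by simp [hσ₁, Store.set_S]) (by simp [hσ₁])
  obtain ⟨hb₂, hf₂, hP₂⟩ := hP.step Z σ₁ _ hb₁ (h.frame.trans hf₁) hP₁
    (by rw [hσ₁, Store.set_S_self]) (hrange j u hu) (by linarith only [hva, huK])
  obtain ⟨σ₂, hσ₂⟩ : ∃ σ₂, σ₂ = action.eval τ σ₁ := ⟨_, rfl⟩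
  rw [← hσ₂] at e hb₂ hf₂ hP₂
  have hv₂ : σ₂.S .v = u := by rw [hf₂.1 _ (by decide), hσ₁]; simp [Store.set_S]
  have hF₂ : σ₂.S .F = 64 * 2 ^ (k + 1) - i := by
    rw [hf₂.1 _ (by decide), hσ₁]; simp [Store.set_S, hF]
  have hj₂ : σ₂.S .j = j := by rw [hf₂.1 _ (by decide), hσ₁]; simp [Store.set_S, hjj]
  have h1₂ : σ₂.S .one = 1 := by rw [hf₂.1 _ (by decide), hσ₁]; simp [Store.set_S, h1]
  have hn₂ : σ₂.A nx = σ₀.A nx := by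
    rw [hf₂.2 _ (by simpa using hnx), hσ₁]; exact hA nx hnx
  simp only [hv₂, hF₂, h1₂, hn₂, Int.toNat_natCast] at e
  have hl : ∀ w ∈ l, (w : ℤ) ≤ 2 * 2 ^ X := fun w hw =>
    hkey _ w (h.rest w (List.mem_cons_of_mem _ hw)).2
  have hp0 := hp2.nonneg
  have hp3 := hp2.le (by positivity) hl
  have hnb : |σ₀.A nx u| ≤ 2 ^ (2 * X + 20) := hn₂ ▸ hb₂.2 nx u
  rw [e]
  refine ⟨?_, j + 1, l, insert (listVal a k g j + u) Z, ?_⟩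
  · clear e
    repeat' first | apply Store.Bdd.set | apply Store.Bdd.put
    · exact hb₂
    · exact hnb
    all_goals rw [abs_le]; constructor <;>
        linarith only [hB, hB2, hDB, hLB, hiB, hi0, huK, hu0, hva, hp0, hp3]
  · constructor
    case treated => exact hP.congr _ _ _ hP₂ (by simp [Store.set_S]) rfl
    case sound =>
      rintro z (rfl | hz)
      · exact ⟨j, u, hu, rfl⟩
      · exact h.sound z hz
    case complete =>
      intro j' hj' w hw
      rcases h.complete j' hj' w hw with h2 | ⟨h2, h3⟩
      · exact Or.inl (Or.inr h2)
      · obtain rfl : j' = j := by omega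
        rcases List.mem_cons.1 h3 with rfl | h3
        · exact Or.inl (Or.inl rfl)
        · exact Or.inr ⟨rfl, h3⟩
    case chain => simpa [Store.set_S] using hp2
    case rest => exact fun w hw => h.rest w (List.mem_cons_of_mem _ hw)
    case count =>
      rw [← h.count, List.length_cons]
      omega
    case le => have := h.le; omega
    case j_eq => simp [Store.set_S, hj₂]
    case F_eq => simp [Store.set_S]; ring
    case frame =>
      have hf₂' : Frame enumRegs [.mark] σ₁ σ₂ := hf₂.mono (by decide) (by decide)
      refine ((h.frame.trans hf₁).trans hf₂').trans ?_
      repeat' first | apply Frame.set | apply Frame.put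
      · exact Frame.refl _ _ _
      all_goals decide

theorem enumBody_inv (hkX : k ≤ X) (ha : ∀ I : Finset ℕ, ∑ i ∈ I, |a i| ≤ 2 ^ X)
    (hhd : hd ≠ .mark) (hnx : nx ≠ .mark) (he₀ : Env X k r cnt a σ₀) (hl₀ : Listed X k r a g σ₀)
    (hs : σ₀.S .sg = s) (hs0 : 0 ≤ s) (hs1 : s < 2 ^ (k + X))
    (hchain : ∀ b, Chained (σ₀.A nx) (σ₀.A hd b) (lst b))
    (hkey : ∀ b, ∀ u ∈ lst b, (u : ℤ) ≤ 2 * 2 ^ X)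
    (hrange : ∀ j, ∀ u ∈ lst (partner r k X s (listVal a k g j)), 0 ≤ listVal a k g j + u)
    (hP : Treats τ X action σ₀ P) {i m : ℕ}
    {l : List ℕ} {Z : Set ℤ} (hi : i < 64 * 2 ^ (k + 1)) (hb : σ.Bdd (2 ^ (2 * X + 20)))
    (h : EnumInv (listVal a k g) lst (fun j => partner r k X s (listVal a k g j))
      (64 * 2 ^ (k + 1)) (σ₀.A nx) P σ₀ i m l Z σ) :
    ((enumBody hd nx action).eval τ σ).Bdd (2 ^ (2 * X + 20)) ∧
      ∃ m' l' Z', EnumInv (listVal a k g) lst (fun j => partner r k X s (listVal a k g j))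
        (64 * 2 ^ (k + 1)) (σ₀.A nx) P σ₀ (i + 1) m' l' Z' ((enumBody hd nx action).eval τ σ) := by
  cases l with
  | nil => exact enumBody_next hkX hhd he₀ hl₀ hs hs0 hs1 hchain hkey hP hi hb h
  | cons u l => exact enumBody_pair hkX ha hnx he₀ hl₀ hkey hrange hP hi hb h

/-- The enumeration treats only sums of partners, and all of them if the workload is not too large. -/
theorem enumStages_ends (hkX : k ≤ X) (ha : ∀ I : Finset ℕ, ∑ i ∈ I, |a i| ≤ 2 ^ X)
    (hhd : hd ≠ .mark) (hnx : nx ≠ .mark) (henv : Env X k r cnt a σ) (hl : Listed X k r a g σ)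
    (hs : σ.S .sg = s) (hs0 : 0 ≤ s) (hs1 : s < 2 ^ (k + X))
    (hchain : ∀ b, Chained (σ.A nx) (σ.A hd b) (lst b))
    (hkey : ∀ b, ∀ u ∈ lst b, (u : ℤ) ≤ 2 * 2 ^ X)
    (hrange : ∀ j, ∀ u ∈ lst (partner r k X s (listVal a k g j)), 0 ≤ listVal a k g j + u)
    (hP : Treats τ X action σ P)
    (hP0 : P ∅ σ) (hb : σ.Bdd (2 ^ (2 * X + 20))) :
    Ends τ (2 ^ (2 * X + 20)) (enumStages hd nx action) (1 + 64 * 2 ^ (k + 1)) σ fun σ' =>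
      (∃ Z, P Z σ' ∧
        (∀ z ∈ Z, ∃ j, ∃ v ∈ lst (partner r k X s (listVal a k g j)), z = listVal a k g j + v) ∧
        (workload lst (fun j => partner r k X s (listVal a k g j)) (2 ^ (k + 1))
            ≤ 64 * 2 ^ (k + 1) → ∀ j < 2 ^ (k + 1),
          ∀ v ∈ lst (partner r k X s (listVal a k g j)), listVal a k g j + v ∈ Z)) ∧
      Frame enumRegs [.mark] σ σ' := by
  have hL := henv.L
  have hpos : 0 < 2 ^ (k + 1) := by positivity
  have hB : (2 : ℤ) ^ 20 ≤ 2 ^ (2 * X + 20) := int_two_pow_le (by omega)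
  norm_num at hB
  have hB2 : (2 : ℤ) ^ (2 * X + 20) = 2 ^ (2 * X) * 2 ^ 20 := pow_add _ _ _
  have hLB : (2 : ℤ) ^ (k + 1) ≤ 2 ^ (2 * X) * 2 := by
    rw [← pow_succ]; exact int_two_pow_le (by omega)
  have hL0 : (0 : ℤ) < 2 ^ (k + 1) := by positivity
  obtain ⟨σ₁, hσ₁⟩ : ∃ σ₁, σ₁ = enumInit.eval τ σ := ⟨_, rfl⟩
  have e := hσ₁
  simp only [enumInit, block, Code.eval, Store.set_S, reduceCtorEq, if_true, if_false, hL] at e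
  have hf : Frame enumRegs [.mark] σ σ₁ := by
    rw [e]
    repeat' apply Frame.set
    · exact Frame.refl _ _ _
    all_goals decide
  refine Ends.append (l := [(enumInit, .zero)])
    (Q := fun σ' => EnumInv (listVal a k g) lst (fun j => partner r k X s (listVal a k g j))
      (64 * 2 ^ (k + 1)) (σ.A nx) P σ 0 0 [] ∅ σ') (Ends.code ?_ ?_ ?_) ?_
  · rw [← hσ₁, hf.1 _ (by decide), henv.zero]
  · rw [← hσ₁, e]
    repeat' apply Store.Bdd.set
    · exact hb
    all_goals rw [abs_le]; constructor <;> linarith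
  · rw [← hσ₁]
    constructor
    case treated => exact hP.congr _ _ _ hP0 (by simp [e, Store.set_S]) (by simp [e])
    case frame => exact hf
    case F_eq => simp [e, Store.set_S]; ring
    all_goals simp [e, Store.set_S, Chained, workload]
  · intro σ₂ hb₂ h₂
    obtain ⟨n, hn⟩ : ∃ n, 64 * 2 ^ (k + 1) = n + 1 := ⟨64 * 2 ^ (k + 1) - 1, by omega⟩
    have hn' : (64 : ℤ) * 2 ^ (k + 1) = n + 1 := by exact_mod_cast hn
    refine Ends.mono ?_ hn.ge
    -- The whole fuel is always used up. Beyond the end of the list the arrays read as zero, which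
    -- is the value of the empty sum, so the surplus rounds treat only genuine sums.
    refine Ends.loop (fun i s' => ∃ m l Z, EnumInv (listVal a k g) lst
      (fun j => partner r k X s (listVal a k g j)) (64 * 2 ^ (k + 1)) (σ.A nx) P σ i m l Z s') n
      ⟨0, [], ∅, h₂⟩ hb₂ ?_ ?_
    · rintro i hi s' hb ⟨m, l, Z, h⟩
      obtain ⟨h2, m', l', Z', h3⟩ := enumBody_inv (τ := τ) hkX ha hhd hnx henv hl hs hs0 hs1 hchain
        hkey hrange hP (by omega) hb h
      exact ⟨h2, ⟨m', l', Z', h3⟩, by rw [h3.F_eq, hn']; push_cast; omega⟩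
    · rintro s' hb ⟨m, l, Z, h⟩
      obtain ⟨h2, m', l', Z', h3⟩ := enumBody_inv (τ := τ) hkX ha hhd hnx henv hl hs hs0 hs1 hchain
        hkey hrange hP (by omega) hb h
      refine ⟨h2, ⟨⟨Z', h3.treated, h3.sound, ?_⟩, h3.frame⟩, by rw [h3.F_eq, hn']; push_cast; omega⟩
      intro hw j hj v hv
      have hcount := h3.count
      rw [← hn] at hcount
      -- If an entry had not been reached, the workload including it would be at least `i + l.length
      -- + 1`, more than the fuel spent.
      have hmL : 2 ^ (k + 1) ≤ m' := by
        by_contra hlt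
        have h4 := workload_mono lst (fun j => partner r k X s (listVal a k g j))
          (show m' + 1 ≤ 2 ^ (k + 1) by omega)
        rw [workload_succ] at h4
        omega
      rcases h3.complete j (by omega) v hv with h4 | ⟨h4, h5⟩
      · exact h4
      -- Pending partners of the last entry would likewise make the workload exceed the fuel.
      · exfalso
        obtain rfl : m' = 2 ^ (k + 1) := by omega
        have : 0 < l'.length := List.length_pos_of_mem h5
        omega

end

/-! ### The two halves -/

/-- The buckets of `v` and `w` add up to `s`. -/
def Fits (r k X : ℕ) (s v w : ℤ) : Prop :=
  ((bucket r k X v : ℤ) + bucket r k X w) % 2 ^ (k + X) = s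

theorem bucket_eq_partner_iff {r k X : ℕ} {s : ℤ} (hs0 : 0 ≤ s) (hs1 : s < 2 ^ (k + X)) (v w : ℤ) :
    partner r k X s v = bucket r k X w ↔ Fits r k X s v w := by
  have hw0 : (0 : ℤ) ≤ bucket r k X w := Int.natCast_nonneg _
  have hw1 := bucket_lt r k X w
  have e : (partner r k X s v = bucket r k X w) ↔
      (s - bucket r k X v) % 2 ^ (k + X) = (bucket r k X w : ℤ) % 2 ^ (k + X) := by
    rw [← Nat.cast_inj (R := ℤ), natCast_partner, Int.emod_eq_of_lt hw0 hw1]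
  unfold Fits
  rw [e]
  constructor
  · intro h
    have h' := Int.ModEq.add_left (bucket r k X v : ℤ) h
    rw [add_sub_cancel] at h'
    exact Eq.trans h'.symm (Int.emod_eq_of_lt hs0 hs1)
  · intro h
    have h' : s ≡ (bucket r k X v : ℤ) + bucket r k X w [ZMOD 2 ^ (k + X)] := by
      rw [← h]; exact Int.mod_modEq _ _
    have := h'.sub_right (bucket r k X v : ℤ)
    rwa [add_sub_cancel_left] at this

open Classical in
/-- The number of rounds that it takes to enumerate the pairs of subset sums of the groups `g` and
`g'` whose buckets add up to `s`. -/
noncomputable def pairLoad (r k X : ℕ) (a : ℕ → ℤ) (g g' : ℕ) (s : ℤ) : ℕ :=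
  ∑ j ∈ Finset.range (2 ^ (k + 1)),
    (1 + (((Finset.range (2 ^ (k + 1))).image (listVal a k g')).filter
      (Fits r k X s (listVal a k g j))).card)

section
variable {τ : Tapes} {X k r cnt : ℕ} {a : ℕ → ℤ} {σ₀ σ : Store} {g g' : ℕ} {hd nx : ℕ → ℤ}
  {lst : ℕ → List ℕ} {s : ℤ}

/-- Different groups use disjoint sets of indices, so the sum of two of their subset sums is still
bounded by `2 ^ X`. This keeps shifted sums nonnegative as array indices, and differences of sums at
most `2 ^ (X + 1)`. -/
theorem abs_listVal_add_le (ha : ∀ I : Finset ℕ, ∑ i ∈ I, |a i| ≤ 2 ^ X) (hg : g < 4) (hg' : g' < 4)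
    (hne : g ≠ g') (j j' : ℕ) : |listVal a k g j + listVal a k g' j'| ≤ 2 ^ X := by
  have key : ∀ j j', |groupSum a g j + groupSum a g' j'| ≤ 2 ^ X := by
    intro j j'
    refine le_trans ?_ (ha ((j.bitIndices.toFinset.image fun q => 1 + g + 4 * q) ∪
      (j'.bitIndices.toFinset.image fun q => 1 + g' + 4 * q)))
    rw [Finset.sum_union]
    · rw [Finset.sum_image (by intro x _ y _ h; simp only at h; omega),
        Finset.sum_image (by intro x _ y _ h; simp only at h; omega)]
      exact (abs_add_le _ _).trans
        (add_le_add (Finset.abs_sum_le_sum_abs _ _) (Finset.abs_sum_le_sum_abs _ _))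
    · rw [Finset.disjoint_left]
      intro x hx hx'
      rw [Finset.mem_image] at hx hx'
      obtain ⟨q, -, rfl⟩ := hx
      obtain ⟨q', -, h⟩ := hx'
      omega
  have h0 : ∀ g j, ∃ j', listVal a k g j = groupSum a g j' := by
    intro g j
    unfold listVal
    split_ifs
    · exact ⟨j, rfl⟩
    · exact ⟨0, (groupSum_zero a g).symm⟩
  obtain ⟨i, hi⟩ := h0 g j
  obtain ⟨i', hi'⟩ := h0 g' j'
  rw [hi, hi']
  exact key i i'

/-- The buckets contain all subset sums of the group `g`. -/
abbrev Sorted (X k r : ℕ) (a : ℕ → ℤ) (g : ℕ) (hd nx : ℕ → ℤ) (lst : ℕ → List ℕ) : Prop :=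
  Bucketed (fun e => keyOf X (listVal a k g e)) (fun e => bucket r k X (listVal a k g e))
    (2 ^ (k + 1)) hd nx lst

theorem Sorted.mem_partner_iff (h : Sorted X k r a g' hd nx lst)
    (ha : ∀ I : Finset ℕ, ∑ i ∈ I, |a i| ≤ 2 ^ X) (hs0 : 0 ≤ s) (hs1 : s < 2 ^ (k + X)) (v : ℤ)
    (u : ℕ) : u ∈ lst (partner r k X s v) ↔
      ∃ j < 2 ^ (k + 1), (u : ℤ) = listVal a k g' j + 2 ^ X ∧ Fits r k X s v (listVal a k g' j) := by
  rw [h.mem_iff]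
  refine exists_congr fun j => and_congr_right fun _ => and_congr ?_ (bucket_eq_partner_iff hs0 hs1 _ _)
  rw [← natCast_keyOf (abs_listVal_le ha k g' j), Nat.cast_inj]

theorem Sorted.le (h : Sorted X k r a g' hd nx lst) (ha : ∀ I : Finset ℕ, ∑ i ∈ I, |a i| ≤ 2 ^ X)
    (b u : ℕ) (hu : u ∈ lst b) : (u : ℤ) ≤ 2 * 2 ^ X := by
  obtain ⟨j, -, rfl, -⟩ := (h.mem_iff b u).1 hu
  have h1 := abs_listVal_le ha k g' j
  have h2 := natCast_keyOf h1
  have h3 := abs_le.1 h1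
  omega

/-- Only the sorted values are shifted by `2 ^ X`. A value plus a key is therefore the true sum
shifted once, which cannot be negative. -/
theorem Sorted.add_nonneg (h : Sorted X k r a g' hd nx lst)
    (ha : ∀ I : Finset ℕ, ∑ i ∈ I, |a i| ≤ 2 ^ X) (hg : g < 4) (hg' : g' < 4) (hne : g ≠ g')
    (j b u : ℕ) (hu : u ∈ lst b) : 0 ≤ listVal a k g j + u := by
  obtain ⟨j', -, rfl, -⟩ := (h.mem_iff b u).1 hu
  have h2 := natCast_keyOf (abs_listVal_le ha k g' j')
  have h3 := abs_le.1 (abs_listVal_add_le (k := k) ha hg hg' hne j j')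
  rw [h2]
  omega

/-- The lists have no repetitions, so undoing the shift maps a bucket injectively into the set of
distinct fitting values. -/
theorem Sorted.workload_le (h : Sorted X k r a g' hd nx lst)
    (ha : ∀ I : Finset ℕ, ∑ i ∈ I, |a i| ≤ 2 ^ X) (hs0 : 0 ≤ s) (hs1 : s < 2 ^ (k + X)) (g : ℕ) :
    workload lst (fun j => partner r k X s (listVal a k g j)) (2 ^ (k + 1)) ≤
      pairLoad r k X a g g' s := by
  classical
  unfold workload pairLoad
  refine Finset.sum_le_sum fun j _ => Nat.add_le_add_left ?_ 1
  rw [← List.toFinset_card_of_nodup (h.nodup _)]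
  refine Finset.card_le_card_of_injOn (fun u : ℕ => (u : ℤ) - 2 ^ X) ?_ ?_
  · intro u hu
    rw [Finset.mem_coe, List.mem_toFinset, h.mem_partner_iff ha hs0 hs1] at hu
    obtain ⟨j', hj', hu1, hu2⟩ := hu
    have : (u : ℤ) - 2 ^ X = listVal a k g' j' := by omega
    simp only [this]
    rw [Finset.mem_coe, Finset.mem_filter, Finset.mem_image]
    exact ⟨⟨j', Finset.mem_range.2 hj', rfl⟩, hu2⟩
  · intro u _ u' _ huu
    simp only at huu
    omega

/-! ### The table of marked sums and the search for complements. -/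

/-- The marks stand for the sums in `Z`. -/
def Marks (Z : Set ℤ) (σ : Store) : Prop :=
  σ.S .flag = 0 ∧ ∀ e, 0 < σ.A .mark e ↔ ∃ z ∈ Z, (e : ℤ) = z + 1

/-- Sums are marked in cell `z + 1` with `z ≥ 0`. Cell 0, to which every negative index is
redirected, thus stays unmarked and cannot cause false hits. -/
theorem treats_mark (henv : Env X k r cnt a σ₀) : Treats τ X markCode σ₀ Marks := by
  refine ⟨fun Z σ z hb hf hP hz h0 h1 => ?_, fun Z σ σ' h h1 h2 => ⟨h1 ▸ h.1, h2 ▸ h.2⟩⟩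
  have hone : σ.S .one = 1 := by rw [hf.1 _ (by decide), henv.one]
  have hB : (2 : ℤ) ^ 20 ≤ 2 ^ (2 * X + 20) := int_two_pow_le (by omega)
  norm_num at hB
  have hB2 : (2 : ℤ) ^ (2 * X + 20) = 2 ^ (2 * X) * 2 ^ 20 := pow_add _ _ _
  have hDB : (2 : ℤ) ^ X ≤ 2 ^ (2 * X) := int_two_pow_le (by omega)
  obtain ⟨σ', hσ'⟩ : ∃ σ', σ' = markCode.eval τ σ := ⟨_, rfl⟩
  have e := hσ'
  rw [← hσ']
  simp only [markCode, block, Code.eval, Store.set_S, hone, hz, reduceCtorEq, if_true, if_false] at e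
  rw [e]
  refine ⟨?_, ?_, ?_, ?_⟩
  · apply Store.Bdd.put
    · apply hb.set
      rw [abs_le]; constructor <;> linarith
    · rw [abs_le]; constructor <;> linarith
  · repeat' first | apply Frame.set | apply Frame.put
    · exact Frame.refl _ _ _
    all_goals decide
  · simpa [Store.set_S] using hP.1
  · intro e
    simp only [Store.put_A_self, Store.set_A, Function.update_apply]
    split_ifs with he
    · simp only [zero_lt_one, true_iff]
      exact ⟨z, Or.inl rfl, by omega⟩
    · rw [hP.2]
      constructor
      · rintro ⟨w, hw, h⟩
        exact ⟨w, Or.inr hw, h⟩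
      · rintro ⟨w, rfl | hw, h⟩
        · omega
        · exact ⟨w, hw, h⟩

/-- The flag is set if it was set or a mark was found for a sum in `Z`. -/
def Checks (X : ℕ) (T : ℤ) (M : ℕ → ℤ) (F : Prop) (Z : Set ℤ) (σ : Store) : Prop :=
  σ.A .mark = M ∧ (0 < σ.S .flag ↔ F ∨ ∃ z ∈ Z, 0 < M (T - z + 2 ^ X + 2 ^ X + 1).toNat)

/-- Here `z` is a sum of the second half shifted by `2 ^ X`. Its complement, shifted by `2 ^ X` as
well, is `a 0 - z + 2 ^ X + 2 ^ X`, and the last 1 is the offset of the marks. -/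
theorem treats_check (ha : ∀ I : Finset ℕ, ∑ i ∈ I, |a i| ≤ 2 ^ X) (henv : Env X k r cnt a σ₀)
    (M : ℕ → ℤ) (F : Prop) : Treats τ X checkCode σ₀ (Checks X (a 0) M F) := by
  unfold Checks
  refine ⟨fun Z σ z hb hf hP hz h0 h1 => ?_, fun Z σ σ' h h1 h2 => ⟨h2 ▸ h.1, h1 ▸ h.2⟩⟩
  have hone : σ.S .one = 1 := by rw [hf.1 _ (by decide), henv.one]
  have hzero : σ.S .zero = 0 := by rw [hf.1 _ (by decide), henv.zero]
  have hD : σ.S .D = 2 ^ X := by rw [hf.1 _ (by decide), henv.D]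
  have hA : σ.A .A = a := by rw [hf.2 _ (by decide), henv.A]
  have hT : |a 0| ≤ 2 ^ X := by simpa using ha {0}
  have hT' := abs_le.1 hT
  have hM := hP.1
  have hB : (2 : ℤ) ^ 20 ≤ 2 ^ (2 * X + 20) := int_two_pow_le (by omega)
  norm_num at hB
  have hB2 : (2 : ℤ) ^ (2 * X + 20) = 2 ^ (2 * X) * 2 ^ 20 := pow_add _ _ _
  have hDB : (2 : ℤ) ^ X ≤ 2 ^ (2 * X) := int_two_pow_le (by omega)
  generalize (2 : ℤ) ^ (2 * X + 20) = B at hb hB hB2 ⊢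
  generalize (2 : ℤ) ^ (2 * X) = D' at hB2 hDB
  generalize (2 : ℤ) ^ X = D at hP hD hT hT' h1 hDB ⊢
  have hbM : ∀ e, |M e| ≤ B := hM ▸ hb.2 .mark
  obtain ⟨σ', hσ'⟩ : ∃ σ', σ' = checkCode.eval τ σ := ⟨_, rfl⟩
  have e := hσ'
  rw [← hσ']
  simp only [checkCode, block, Code.eval, Store.set_S, Store.set_A, hone, hzero, hD, hA, hM, hz,
    reduceCtorEq, if_true, if_false, Int.toNat_zero] at e
  have hins : (∃ w ∈ insert z Z, 0 < M (a 0 - w + D + D + 1).toNat) ↔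
      0 < M (a 0 - z + D + D + 1).toNat ∨
        ∃ w ∈ Z, 0 < M (a 0 - w + D + D + 1).toNat := by
    simp only [Set.mem_insert_iff, exists_eq_or_imp]
  by_cases hpos : 0 < M (a 0 - z + D + D + 1).toNat
  · simp only [hpos, if_true] at e
    rw [e]
    refine ⟨?_, ?_, by simpa using hM, ?_⟩
    · clear e
      repeat' apply Store.Bdd.set
      · exact hb
      rotate_left 5
      · exact hbM _
      all_goals rw [abs_le]; constructor <;> linarith only [hT', h0, h1, hB, hB2, hDB]
    · repeat' apply Frame.set
      · exact Frame.refl _ _ _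
      all_goals decide
    · rw [hins]
      simp [hpos]
  · simp only [hpos, if_false] at e
    rw [e]
    refine ⟨?_, ?_, by simpa using hM, ?_⟩
    · clear e
      repeat' apply Store.Bdd.set
      · exact hb
      rotate_left 5
      · exact hbM _
      all_goals rw [abs_le]; constructor <;> linarith only [hT', h0, h1, hB, hB2, hDB]
    · repeat' apply Frame.set
      · exact Frame.refl _ _ _
      all_goals decide
    · rw [hins]
      simp only [hpos, false_or]
      simpa [Store.set_S] using hP.2

end

/-! ### The run of the verifier -/

section
variable {τ : Tapes} {X k r cnt : ℕ} {a : ℕ → ℤ} {σ₀ σ : Store} {g g' : ℕ} {hd nx : Arr}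
  {lst : ℕ → List ℕ} {s : ℤ} {action : Code} {P : Set ℤ → Store → Prop}

theorem listVal_of_lt {j : ℕ} (hj : j < 2 ^ (k + 1)) : listVal a k g j = groupSum a g j :=
  if_pos hj

/-- The padding zeros are subset sums too. This makes soundness hold even for rounds beyond the end
of a list. -/
theorem exists_listVal_eq (a : ℕ → ℤ) (k g j : ℕ) : ∃ j', listVal a k g j = groupSum a g j' := by
  unfold listVal
  split_ifs
  · exact ⟨j, rfl⟩
  · exact ⟨0, (groupSum_zero a g).symm⟩

/-- The lists of the subset sums of two groups are computed, and one of them is sorted. -/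
theorem prepare_ends (hkX : k ≤ X) (hg : g < 4) (hg' : g' < 4)
    (ha : ∀ I : Finset ℕ, ∑ i ∈ I, |a i| ≤ 2 ^ X) (hhn : hd ≠ nx)
    (hhd : ∀ q ∈ [Arr.A, .XA, .YA, .V, .X, .Y], q ≠ hd)
    (hnx : ∀ q ∈ [Arr.A, .XA, .YA, .V, .X, .Y], q ≠ nx) (henv : Env X k r cnt a σ)
    (ho : Outside k σ) (h0 : σ.A hd = fun _ => 0) (h0' : σ.A nx = fun _ => 0)
    (hb : σ.Bdd (2 ^ (2 * X + 20))) :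
    Ends τ (2 ^ (2 * X + 20)) (listStages g' ++ (insertStages hd nx ++ listStages g))
      (2 ^ (k + 1) + (1 + 2 ^ (k + 1) + 2 ^ (k + 1))) σ fun σ' =>
      (∃ lst, Sorted X k r a g' (σ'.A hd) (σ'.A nx) lst) ∧ Listed X k r a g σ' ∧
        Env X k r cnt a σ' ∧
        Frame [.i, .pw, .j, .t, .b, .a, .ck, .v] [.V, .X, .Y, hd, nx] σ σ' := by
  have hne : ∀ q ∈ [Arr.A, .XA, .YA, .V, .X, .Y], q ∉ [hd, nx] := by
    intro q hq
    simp [hhd q hq, hnx q hq]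
  have hhd' : hd ∉ [Arr.V, .X, .Y] := by
    intro h
    simp only [List.mem_cons, List.not_mem_nil, or_false] at h
    rcases h with rfl | rfl | rfl <;> exact hhd _ (by decide) rfl
  have hnx' : nx ∉ [Arr.V, .X, .Y] := by
    intro h
    simp only [List.mem_cons, List.not_mem_nil, or_false] at h
    rcases h with rfl | rfl | rfl <;> exact hnx _ (by decide) rfl
  refine Ends.append (listStages_ends hkX hg' ha henv ho hb) fun σ₁ hb₁ ⟨hl₁, hf₁⟩ => ?_
  have he₁ := henv.frame hf₁ (by decide) (by decide)
  refine Ends.append (insertStages_ends hkX ha hhn hhd hnx he₁ hl₁ ((hf₁.2 _ hhd').trans h0)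
    ((hf₁.2 _ hnx').trans h0') hb₁) fun σ₂ hb₂ ⟨⟨lst, hlst⟩, hf₂⟩ => ?_
  have he₂ := he₁.frame hf₂ (by decide) (fun q hq => hne q (by
    revert q; decide))
  have ho₂ : Outside k σ₂ := by
    intro e he
    rw [hf₂.2 _ (hne .V (by decide)), hf₂.2 _ (hne .X (by decide)), hf₂.2 _ (hne .Y (by decide))]
    exact hl₁.outside e he
  refine (listStages_ends hkX hg ha he₂ ho₂ hb₂).imp fun σ₃ ⟨hl₃, hf₃⟩ => ?_
  refine ⟨⟨lst, ?_⟩, hl₃, he₂.frame hf₃ (by decide) (by decide), ?_⟩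
  · rw [hf₃.2 _ hhd', hf₃.2 _ hnx']; exact hlst
  · have m₁ : Frame [.i, .pw, .j, .t, .b, .a, .ck, .v] [.V, .X, .Y, hd, nx] σ σ₁ :=
      hf₁.mono (by decide) (by simp)
    have m₂ : Frame [.i, .pw, .j, .t, .b, .a, .ck, .v] [.V, .X, .Y, hd, nx] σ₁ σ₂ :=
      hf₂.mono (by decide) (by simp)
    have m₃ : Frame [.i, .pw, .j, .t, .b, .a, .ck, .v] [.V, .X, .Y, hd, nx] σ₂ σ₃ :=
      hf₃.mono (by decide) (by simp)
    exact (m₁.trans m₂).trans m₃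

/-- The enumeration treats sums of two groups, and all fitting ones if the load is not too large. -/
theorem pairs_ends (hkX : k ≤ X) (hg : g < 4) (hg' : g' < 4) (hgg : g ≠ g')
    (ha : ∀ I : Finset ℕ, ∑ i ∈ I, |a i| ≤ 2 ^ X) (hhd : hd ≠ .mark) (hnx : nx ≠ .mark)
    (henv : Env X k r cnt a σ) (hl : Listed X k r a g σ) (hs : σ.S .sg = s) (hs0 : 0 ≤ s)
    (hs1 : s < 2 ^ (k + X)) (hlst : Sorted X k r a g' (σ.A hd) (σ.A nx) lst)
    (hP : Treats τ X action σ P) (hP0 : P ∅ σ) (hb : σ.Bdd (2 ^ (2 * X + 20))) :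
    Ends τ (2 ^ (2 * X + 20)) (enumStages hd nx action) (1 + 64 * 2 ^ (k + 1)) σ fun σ' =>
      (∃ Z, P Z σ' ∧ (∀ z ∈ Z, ∃ j j', z = groupSum a g j + groupSum a g' j' + 2 ^ X) ∧
        (pairLoad r k X a g g' s ≤ 64 * 2 ^ (k + 1) → ∀ j < 2 ^ (k + 1), ∀ j' < 2 ^ (k + 1),
          Fits r k X s (groupSum a g j) (groupSum a g' j') →
            groupSum a g j + groupSum a g' j' + 2 ^ X ∈ Z)) ∧
      Frame enumRegs [.mark] σ σ' := by
  refine (enumStages_ends hkX ha hhd hnx henv hl hs hs0 hs1 hlst.chain (hlst.le ha)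
    (fun j u hu => hlst.add_nonneg ha hg hg' hgg j _ u hu) hP hP0 hb).imp ?_
  rintro σ' ⟨⟨Z, hZ, hsound, hcomplete⟩, hf⟩
  refine ⟨⟨Z, hZ, ?_, ?_⟩, hf⟩
  · intro z hz
    obtain ⟨j, v, hv, rfl⟩ := hsound z hz
    obtain ⟨j', -, hv', -⟩ := (hlst.mem_partner_iff ha hs0 hs1 _ _).1 hv
    obtain ⟨i, hi⟩ := exists_listVal_eq a k g j
    obtain ⟨i', hi'⟩ := exists_listVal_eq a k g' j'
    exact ⟨i, i', by rw [hv', hi, hi']; ring⟩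
  · intro hload j hj j' hj' hfit
    rw [← listVal_of_lt (a := a) (g := g) hj, ← listVal_of_lt (a := a) (g := g') hj'] at hfit ⊢
    have hkey := natCast_keyOf (abs_listVal_le ha k g' j')
    have := hcomplete ((hlst.workload_le ha hs0 hs1 g).trans hload) j hj
      (keyOf X (listVal a k g' j')) ((hlst.mem_partner_iff ha hs0 hs1 _ _).2 ⟨j', hj', hkey, hfit⟩)
    rwa [hkey, ← add_assoc] at this

/-- The first half marks sums of the first two groups. -/
theorem firstStages_ends (hkX : k ≤ X) (ha : ∀ I : Finset ℕ, ∑ i ∈ I, |a i| ≤ 2 ^ X)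
    (henv : Env X k r cnt a σ) (h0 : ∀ q ∉ [Arr.A, .XA, .YA], σ.A q = fun _ => 0)
    (hflag : σ.S .flag = 0) (hs : σ.S .sg = s) (hs0 : 0 ≤ s) (hs1 : s < 2 ^ (k + X))
    (hb : σ.Bdd (2 ^ (2 * X + 20))) :
    Ends τ (2 ^ (2 * X + 20)) firstStages
      (2 ^ (k + 1) + (1 + 2 ^ (k + 1) + 2 ^ (k + 1)) + (1 + 64 * 2 ^ (k + 1))) σ fun σ' =>
      Env X k r cnt a σ' ∧ Outside k σ' ∧ σ'.S .sg = s ∧ σ'.A .hd1 = (fun _ => 0) ∧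
      σ'.A .nx1 = (fun _ => 0) ∧ ∃ Z, Marks Z σ' ∧
        (∀ z ∈ Z, ∃ j j', z = groupSum a 0 j + groupSum a 1 j' + 2 ^ X) ∧
        (pairLoad r k X a 0 1 s ≤ 64 * 2 ^ (k + 1) → ∀ j < 2 ^ (k + 1), ∀ j' < 2 ^ (k + 1),
          Fits r k X s (groupSum a 0 j) (groupSum a 1 j') →
            groupSum a 0 j + groupSum a 1 j' + 2 ^ X ∈ Z) := by
  have hsplit : firstStages = (listStages 1 ++ (insertStages .hd0 .nx0 ++ listStages 0)) ++
      enumStages .hd0 .nx0 markCode := by simp [firstStages]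
  rw [hsplit]
  have ho : Outside k σ := by
    intro e _
    rw [h0 _ (by decide), h0 _ (by decide), h0 _ (by decide)]
    exact ⟨rfl, rfl, rfl⟩
  refine Ends.append (prepare_ends hkX (by norm_num) (by norm_num) ha (by decide) (by decide)
    (by decide) henv ho (h0 _ (by decide)) (h0 _ (by decide)) hb) ?_
  rintro σ₁ hb₁ ⟨⟨lst, hlst⟩, hl₁, he₁, hf₁⟩
  have hM : Marks ∅ σ₁ := by
    refine ⟨by rw [hf₁.1 _ (by decide), hflag], fun e => ?_⟩
    rw [hf₁.2 _ (by decide), h0 _ (by decide)]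
    simp
  refine (pairs_ends hkX (by norm_num) (by norm_num) (by norm_num) ha (by decide) (by decide) he₁ hl₁
    (by rw [hf₁.1 _ (by decide), hs]) hs0 hs1 hlst (treats_mark he₁) hM hb₁).imp ?_
  rintro σ₂ ⟨hZ, hf₂⟩
  refine ⟨he₁.frame hf₂ (by decide) (by decide), ?_, ?_, ?_, ?_, hZ⟩
  · intro e he
    rw [hf₂.2 _ (by decide), hf₂.2 _ (by decide), hf₂.2 _ (by decide)]
    exact hl₁.outside e he
  · rw [hf₂.1 _ (by decide), hf₁.1 _ (by decide), hs]
  · rw [hf₂.2 _ (by decide), hf₁.2 _ (by decide), h0 _ (by decide)]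
  · rw [hf₂.2 _ (by decide), hf₁.2 _ (by decide), h0 _ (by decide)]

/-! ### The four possible carries in the second half. -/

/-- The `c`-th candidate for the sum of the buckets of the second half. -/
def candidate (k X : ℕ) (s : ℤ) (c : ℕ) : ℤ := (s - c * 2 ^ X) % 2 ^ (k + X)

theorem candidate_nonneg (k X : ℕ) (s : ℤ) (c : ℕ) : 0 ≤ candidate k X s c :=
  Int.emod_nonneg _ (by positivity)

theorem candidate_lt (k X : ℕ) (s : ℤ) (c : ℕ) : candidate k X s c < 2 ^ (k + X) :=
  Int.emod_lt_of_pos _ (by positivity)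

theorem candidate_succ (k X : ℕ) (s : ℤ) (c : ℕ) :
    candidate k X s (c + 1) = (candidate k X s c - 2 ^ X) % 2 ^ (k + X) := by
  unfold candidate
  have : s - (c + 1 : ℕ) * 2 ^ X = (s - c * 2 ^ X) - 2 ^ X := by push_cast; ring
  rw [this]
  exact (Int.ModEq.sub_right _ (Int.mod_modEq _ _)).symm

/-- There is a mark for the complement of a sum of the last two groups. -/
def Hit (X : ℕ) (a : ℕ → ℤ) (M : ℕ → ℤ) (j j' : ℕ) : Prop :=
  0 < M (a 0 - (groupSum a 2 j + groupSum a 3 j' + 2 ^ X) + 2 ^ X + 2 ^ X + 1).toNat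

/-- The store after checking the first `c` candidates. -/
structure CheckInv (X k r cnt : ℕ) (a : ℕ → ℤ) (s : ℤ) (M : ℕ → ℤ) (lst : ℕ → List ℕ) (c : ℕ)
    (σ : Store) : Prop where
  env : Env X k r cnt a σ
  listed : Listed X k r a 2 σ
  sorted : Sorted X k r a 3 (σ.A .hd1) (σ.A .nx1) lst
  mark : σ.A .mark = M
  sound : 0 < σ.S .flag → ∃ j j', Hit X a M j j'
  complete : ∀ c' < c, pairLoad r k X a 2 3 (candidate k X s c') ≤ 64 * 2 ^ (k + 1) →
    ∀ j < 2 ^ (k + 1), ∀ j' < 2 ^ (k + 1),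
      Fits r k X (candidate k X s c') (groupSum a 2 j) (groupSum a 3 j') → Hit X a M j j' →
        0 < σ.S .flag

/-- The flag is cumulative: taking its present state as the proposition `F` in `Checks` carries
earlier hits along. Candidates with too large a load are cut off without harm, since completeness is
claimed only for those with a bounded load. -/
theorem check_ends (hkX : k ≤ X) (ha : ∀ I : Finset ℕ, ∑ i ∈ I, |a i| ≤ 2 ^ X) {M : ℕ → ℤ} {c : ℕ}
    (h : CheckInv X k r cnt a s M lst c σ) (hs : σ.S .sg = candidate k X s c)
    (hb : σ.Bdd (2 ^ (2 * X + 20))) :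
    Ends τ (2 ^ (2 * X + 20)) (enumStages .hd1 .nx1 checkCode) (1 + 64 * 2 ^ (k + 1)) σ fun σ' =>
      CheckInv X k r cnt a s M lst (c + 1) σ' ∧ σ'.S .sg = candidate k X s c := by
  have hC : Checks X (a 0) M (0 < σ.S .flag) ∅ σ := ⟨h.mark, by simp⟩
  refine (pairs_ends hkX (by norm_num) (by norm_num) (by norm_num) ha (by decide) (by decide) h.env
    h.listed hs (candidate_nonneg _ _ _ _) (candidate_lt _ _ _ _) h.sorted
    (treats_check ha h.env M _) hC hb).imp ?_
  rintro σ' ⟨⟨Z, hZ, hsound, hcomplete⟩, hf⟩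
  refine ⟨?_, by rw [hf.1 _ (by decide), hs]⟩
  constructor
  case env => exact h.env.frame hf (by decide) (by decide)
  case listed =>
    constructor
    · rw [hf.2 _ (by decide)]; exact h.listed.V_eq
    · rw [hf.2 _ (by decide)]; exact h.listed.X_eq
    · rw [hf.2 _ (by decide)]; exact h.listed.Y_eq
  case sorted => rw [hf.2 _ (by decide), hf.2 _ (by decide)]; exact h.sorted
  case mark => exact hZ.1
  case sound =>
    rw [hZ.2]
    rintro (h' | ⟨z, hz, h'⟩)
    · exact h.sound h'
    · obtain ⟨j, j', rfl⟩ := hsound z hz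
      exact ⟨j, j', h'⟩
  case complete =>
    intro c' hc' hload j hj j' hj' hfit hhit
    rw [hZ.2]
    obtain hc' | rfl : c' < c ∨ c' = c := by omega
    · exact Or.inl (h.complete c' hc' hload j hj j' hj' hfit hhit)
    · exact Or.inr ⟨_, hcomplete hload j hj j' hj' hfit, hhit⟩

theorem shift_ends {M : ℕ → ℤ} {c d : ℕ} (h : CheckInv X k r cnt a s M lst c σ)
    (hs : σ.S .sg = candidate k X s d) (hb : σ.Bdd (2 ^ (2 * X + 20))) :
    Ends τ (2 ^ (2 * X + 20)) [(shiftCode, .zero)] 1 σ fun σ' =>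
      CheckInv X k r cnt a s M lst c σ' ∧ σ'.S .sg = candidate k X s (d + 1) := by
  have h0 := candidate_nonneg k X s d
  have h1 := candidate_lt k X s d
  have hND : (2 : ℤ) ^ X ≤ 2 ^ (k + X) := int_two_pow_le (by omega)
  have hD : (0 : ℤ) < 2 ^ X := by positivity
  have e : shiftCode.eval τ σ = (σ.set .sg (candidate k X s (d + 1))).set .t 0 := by
    unfold shiftCode
    rw [subMod_eval (by decide) (by decide) (by decide) (by decide) h.env.zero, hs, h.env.D, h.env.N,
      candidate_succ]
    · rw [h.env.N, hs, h.env.D]; linarith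
    · rw [h.env.N, hs, h.env.D]; linarith
  have hf : Frame [.sg, .t] [] σ (shiftCode.eval τ σ) := by
    rw [e]
    exact ((Frame.refl _ _ _).set (by decide)).set (by decide)
  have hN := h.env.N ▸ hb.1 .N
  have h2 := candidate_nonneg k X s (d + 1)
  have h3 := candidate_lt k X s (d + 1)
  apply Ends.code
  · rw [hf.1 _ (by decide), h.env.zero]
  · rw [e]
    refine (hb.set ?_).set (by simp)
    rw [abs_of_nonneg h2]
    exact h3.le.trans ((le_abs_self _).trans hN)
  · refine ⟨?_, by simp [e, Store.set_S]⟩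
    have hA : (shiftCode.eval τ σ).A = σ.A := by rw [e]; rfl
    have hflag : (shiftCode.eval τ σ).S .flag = σ.S .flag := hf.1 _ (by decide)
    constructor
    case env => exact h.env.frame hf (by decide) (by decide)
    case listed =>
      constructor
      · rw [hA]; exact h.listed.V_eq
      · rw [hA]; exact h.listed.X_eq
      · rw [hA]; exact h.listed.Y_eq
    case sorted => rw [hA]; exact h.sorted
    case mark => rw [hA]; exact h.mark
    case sound => rw [hflag]; exact h.sound
    case complete => rw [hflag]; exact h.complete

/-- The second half looks for the complements of sums of the last two groups. -/
theorem secondStages_ends (hkX : k ≤ X) (ha : ∀ I : Finset ℕ, ∑ i ∈ I, |a i| ≤ 2 ^ X)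
    (henv : Env X k r cnt a σ) (ho : Outside k σ) (h0 : σ.A .hd1 = fun _ => 0)
    (h0' : σ.A .nx1 = fun _ => 0) (hflag : σ.S .flag = 0) (hs : σ.S .sg = s) (hs0 : 0 ≤ s)
    (hs1 : s < 2 ^ (k + X)) (hb : σ.Bdd (2 ^ (2 * X + 20))) :
    Ends τ (2 ^ (2 * X + 20)) secondStages
      (2 ^ (k + 1) + (1 + 2 ^ (k + 1) + 2 ^ (k + 1)) + (8 + 256 * 2 ^ (k + 1))) σ fun σ' =>
      Env X k r cnt a σ' ∧ ∃ lst, CheckInv X k r cnt a (bucket r k X (a 0) - s) (σ.A .mark) lst 4 σ' := by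
  have hsplit : secondStages = (listStages 3 ++ (insertStages .hd1 .nx1 ++ listStages 2)) ++
      ([(complementCode, .zero)] ++ (enumStages .hd1 .nx1 checkCode ++
      ([(shiftCode, .zero)] ++ (enumStages .hd1 .nx1 checkCode ++
        ([(shiftCode, .zero)] ++ (enumStages .hd1 .nx1 checkCode ++
          ([(shiftCode, .zero)] ++ enumStages .hd1 .nx1 checkCode))))))) := by simp [secondStages]
  rw [hsplit]
  refine Ends.append (prepare_ends hkX (by norm_num) (by norm_num) ha (by decide) (by decide)
    (by decide) henv ho h0 h0' hb) ?_
  rintro σ₁ hb₁ ⟨⟨lst, hlst⟩, hl₁, he₁, hf₁⟩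
  have hs₁ : σ₁.S .sg = s := by rw [hf₁.1 _ (by decide), hs]
  have hXA : σ₁.A .XA 0 = residue r (k + X) (a 0) := by rw [he₁.XA]
  have hYA : σ₁.A .YA 0 = residue r X (a 0) := by rw [he₁.YA]
  have hz := he₁.zero
  have hN := he₁.N
  have hbk := natCast_bucket r k X (a 0)
  have hbk0 : (0 : ℤ) ≤ bucket r k X (a 0) := Int.natCast_nonneg _
  have hbk1 := bucket_lt r k X (a 0)
  have hNb := hN ▸ hb₁.1 .N
  have hc0 : (bucket r k X (a 0) - s) % 2 ^ (k + X) = candidate k X (bucket r k X (a 0) - s) 0 := by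
    simp [candidate]
  have hsub1 : -2 ^ (k + X) ≤ (bucket r k X (a 0) : ℤ) - s := by linarith
  have hsub2 : (bucket r k X (a 0) : ℤ) - s < 2 ^ (k + X) := by linarith
  obtain ⟨σ₂, hσ₂⟩ : ∃ σ₂, σ₂ = complementCode.eval τ σ₁ := ⟨_, rfl⟩
  have e := hσ₂
  simp only [complementCode, block, Code.eval, Store.set_S, Store.set_A, hz, hN, hs₁, hXA, hYA,
    ← hbk, Int.toNat_zero, reduceCtorEq, if_true, if_false, ne_eq, not_false_eq_true, subMod_eval,
    hsub1, hsub2, hc0] at e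
  have hc1 := candidate_nonneg k X (bucket r k X (a 0) - s) 0
  have hc2 := candidate_lt k X (bucket r k X (a 0) - s) 0
  have hb₂ : σ₂.Bdd (2 ^ (2 * X + 20)) := by
    have hle := (le_abs_self _).trans hNb
    have hX' := hXA ▸ hb₁.2 .XA 0
    have hY' := hYA ▸ hb₁.2 .YA 0
    rw [e]
    refine ((((hb₁.set hX').set hY').set ?_).set ?_).set (by simp)
    · rw [abs_of_nonneg hbk0]; exact hbk1.le.trans hle
    · rw [abs_of_nonneg hc1]; exact hc2.le.trans hle
  have hf₂ : Frame [.a, .b, .sg, .t] [] σ₁ σ₂ := by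
    rw [e]
    repeat' apply Frame.set
    · exact Frame.refl _ _ _
    all_goals decide
  have hA₂ : σ₂.A = σ₁.A := by rw [e]; rfl
  have hflag₂ : σ₂.S .flag = 0 := by rw [hf₂.1 _ (by decide), hf₁.1 _ (by decide), hflag]
  have hinit : CheckInv X k r cnt a (bucket r k X (a 0) - s) (σ.A .mark) lst 0 σ₂ := by
    constructor
    case env => exact he₁.frame hf₂ (by decide) (by decide)
    case listed =>
      constructor
      · rw [hA₂]; exact hl₁.V_eq
      · rw [hA₂]; exact hl₁.X_eq
      · rw [hA₂]; exact hl₁.Y_eq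
    case sorted => rw [hA₂]; exact hlst
    case mark => rw [hA₂, hf₁.2 _ (by decide)]
    case sound => rw [hflag₂]; exact fun h => absurd h (lt_irrefl 0)
    case complete => intro c hc; omega
  have hsg₂ : σ₂.S .sg = candidate k X (bucket r k X (a 0) - s) 0 := by simp [e, Store.set_S]
  refine Ends.mono (n := 1 + (1 + 64 * 2 ^ (k + 1) + (1 + (1 + 64 * 2 ^ (k + 1) + (1 +
    (1 + 64 * 2 ^ (k + 1) + (1 + (1 + 64 * 2 ^ (k + 1))))))))) ?_ (by omega)
  refine Ends.append (Q := fun σ' =>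
    CheckInv X k r cnt a (bucket r k X (a 0) - s) (σ.A .mark) lst 0 σ' ∧
      σ'.S .sg = candidate k X (bucket r k X (a 0) - s) 0) (Ends.code ?_ ?_ ?_) ?_
  · rw [← hσ₂, hinit.env.zero]
  · rw [← hσ₂]; exact hb₂
  · rw [← hσ₂]; exact ⟨hinit, hsg₂⟩
  rintro σ₃ hb₃ ⟨h₃, hs₃⟩
  refine Ends.append (check_ends hkX ha h₃ hs₃ hb₃) ?_
  rintro σ₄ hb₄ ⟨h₄, hs₄⟩
  refine Ends.append (shift_ends h₄ hs₄ hb₄) ?_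
  rintro σ₅ hb₅ ⟨h₅, hs₅⟩
  refine Ends.append (check_ends hkX ha h₅ hs₅ hb₅) ?_
  rintro σ₆ hb₆ ⟨h₆, hs₆⟩
  refine Ends.append (shift_ends h₆ hs₆ hb₆) ?_
  rintro σ₇ hb₇ ⟨h₇, hs₇⟩
  refine Ends.append (check_ends hkX ha h₇ hs₇ hb₇) ?_
  rintro σ₈ hb₈ ⟨h₈, hs₈⟩
  refine Ends.append (shift_ends h₈ hs₈ hb₈) ?_
  rintro σ₉ hb₉ ⟨h₉, hs₉⟩
  exact (check_ends hkX ha h₉ hs₉ hb₉).imp fun σ' h => ⟨h.1.env, lst, h.1⟩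

end

/-- The buckets of the parts of a sum add up to the bucket of the sum, up to a small multiple of
`2 ^ X`. -/
theorem exists_candidate (r k X : ℕ) (v₀ v₁ v₂ v₃ s : ℤ)
    (hs : Fits r k X s v₀ v₁) : ∃ c < 4,
      Fits r k X (candidate k X (bucket r k X (v₀ + v₁ + v₂ + v₃) - s) c) v₂ v₃ := by
  obtain ⟨T, hT⟩ : ∃ T, T = v₀ + v₁ + v₂ + v₃ := ⟨_, rfl⟩
  rw [← hT]
  obtain ⟨y, hy⟩ : ∃ y, y = residue r X v₀ + residue r X v₁ + residue r X v₂ + residue r X v₃ :=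
    ⟨_, rfl⟩
  -- Rounding down loses `y` in total on the four parts and `residue r X T` on the target; by
  -- linearity these agree modulo `2 ^ X`.
  have hmod : y ≡ residue r X T [ZMOD 2 ^ X] := by
    have h : ∀ v, residue r X v ≡ r * v [ZMOD 2 ^ X] := fun v => Int.mod_modEq _ _
    have h1 := (((h v₀).add (h v₁)).add (h v₂)).add (h v₃)
    have h2 : (r : ℤ) * v₀ + r * v₁ + r * v₂ + r * v₃ = r * T := by rw [hT]; ring
    rw [h2, ← hy] at h1
    exact h1.trans (h T).symm
  have hD : (0 : ℤ) < 2 ^ X := by positivity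
  have hyT : residue r X T = y % 2 ^ X := by
    rw [← Int.emod_eq_of_lt (residue_nonneg r X T) (residue_lt r X T)]
    exact hmod.symm
  have b0 := residue_nonneg r X v₀
  have b1 := residue_nonneg r X v₁
  have b2 := residue_nonneg r X v₂
  have b3 := residue_nonneg r X v₃
  have c0 := residue_lt r X v₀
  have c1 := residue_lt r X v₁
  have c2 := residue_lt r X v₂
  have c3 := residue_lt r X v₃
  have hdiv := Int.emod_add_mul_ediv y (2 ^ X)
  -- Four low parts below `2 ^ X` add up to less than `4 * 2 ^ X`, so the carry `c` is one of 0, 1,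
  -- 2, 3.
  have hd0 : 0 ≤ y / 2 ^ X := Int.ediv_nonneg (by linarith) hD.le
  have hd4 : y / 2 ^ X < 4 := Int.ediv_lt_of_lt_mul hD (by linarith)
  obtain ⟨c, hc⟩ := Int.eq_ofNat_of_zero_le hd0
  refine ⟨c, by omega, ?_⟩
  unfold Fits candidate
  rw [hc, ← hyT] at hdiv
  have hx : ∀ v, residue r (k + X) v ≡ r * v [ZMOD 2 ^ (k + X)] := fun v => Int.mod_modEq _ _
  have key : (bucket r k X v₀ : ℤ) + bucket r k X v₁ + bucket r k X v₂ + bucket r k X v₃ ≡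
      bucket r k X T - c * 2 ^ X [ZMOD 2 ^ (k + X)] := by
    have h1 := ((((hx v₀).add (hx v₁)).add (hx v₂)).add (hx v₃)).sub_right y
    have h2 : (r : ℤ) * v₀ + r * v₁ + r * v₂ + r * v₃ = r * T := by rw [hT]; ring
    rw [h2] at h1
    have h3 := h1.trans ((hx T).symm.sub_right y)
    rw [natCast_bucket, natCast_bucket, natCast_bucket, natCast_bucket, natCast_bucket]
    convert h3 using 1
    · rw [hy]; ring
    · linarith
  have hs' : (bucket r k X v₀ : ℤ) + bucket r k X v₁ ≡ s [ZMOD 2 ^ (k + X)] := by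
    unfold Fits at hs
    rw [← hs]
    exact (Int.mod_modEq _ _).symm
  have h5 := key.sub hs'
  refine Eq.trans ?_ (Eq.trans h5 ?_)
  · congr 1; ring
  · congr 1; ring

/-- The run of the verifier: it accepts only if the target is a sum of four subset sums, and it
accepts if there is such a representation that agrees with the message and for which the load is not
too large. -/
theorem verifierStages_ends {τ : Tapes} (hkX : τ.proof.length ≤ τ.input.length) {X k r : ℕ} {a : ℕ → ℤ}
    (hX : X = τ.input.length) (hk : k = τ.proof.length) (hr : r = coinNum τ.coins (k + X))
    (haa : a = fun i => (decode τ.input).getD i 0) (ha : ∀ I : Finset ℕ, ∑ i ∈ I, |a i| ≤ 2 ^ X) :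
    Ends τ (2 ^ (2 * X + 20)) verifierStages (3 * X + 20 + 326 * 2 ^ (k + 1)) Store.init fun σ =>
      (0 < σ.S .flag → decode τ.input ≠ [] ∧ ∃ j₀ j₁ j₂ j₃,
        a 0 = groupSum a 0 j₀ + groupSum a 1 j₁ + groupSum a 2 j₂ + groupSum a 3 j₃) ∧
      (decode τ.input ≠ [] → ∀ j₀ < 2 ^ (k + 1), ∀ j₁ < 2 ^ (k + 1), ∀ j₂ < 2 ^ (k + 1),
        ∀ j₃ < 2 ^ (k + 1),
        a 0 = groupSum a 0 j₀ + groupSum a 1 j₁ + groupSum a 2 j₂ + groupSum a 3 j₃ →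
        Fits r k X (natOfBits τ.proof * 2 ^ X) (groupSum a 0 j₀) (groupSum a 1 j₁) →
        (∀ s, Fits r k X s (groupSum a 0 j₀) (groupSum a 1 j₁) →
          pairLoad r k X a 0 1 s ≤ 64 * 2 ^ (k + 1)) →
        (∀ s, Fits r k X s (groupSum a 2 j₂) (groupSum a 3 j₃) →
          pairLoad r k X a 2 3 s ≤ 64 * 2 ^ (k + 1)) → 0 < σ.S .flag) := by
  have hread := readStages_ends hkX
  rw [← hX, ← hk, ← hr, ← haa] at hread
  rw [← hX, ← hk] at hkX
  have hs0 : (0 : ℤ) ≤ natOfBits τ.proof * 2 ^ X := mul_nonneg (Int.natCast_nonneg _) (by positivity)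
  have hs1 : (natOfBits τ.proof : ℤ) * 2 ^ X < 2 ^ (k + X) := by
    rw [pow_add, hk]
    have : (natOfBits τ.proof : ℤ) < 2 ^ τ.proof.length := by exact_mod_cast natOfBits_lt _
    exact mul_lt_mul_of_pos_right this (by positivity)
  refine Ends.mono (n := 3 * X + 5 + (2 ^ (k + 1) + (1 + 2 ^ (k + 1) + 2 ^ (k + 1)) +
    (1 + 64 * 2 ^ (k + 1)) + (2 ^ (k + 1) + (1 + 2 ^ (k + 1) + 2 ^ (k + 1)) +
      (8 + 256 * 2 ^ (k + 1)) + 1))) ?_ (by omega)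
  refine Ends.append hread ?_
  rintro σ₁ hb₁ ⟨he₁, hsg₁, hflag₁, hz₁⟩
  refine Ends.append (firstStages_ends hkX ha he₁ hz₁ hflag₁ hsg₁ hs0 hs1 hb₁) ?_
  rintro σ₂ hb₂ ⟨he₂, ho₂, hsg₂, hhd₂, hnx₂, Z, hM, hsound, hcomplete⟩
  refine Ends.append (secondStages_ends hkX ha he₂ ho₂ hhd₂ hnx₂ hM.1 hsg₂ hs0 hs1 hb₂) ?_
  rintro σ₃ hb₃ ⟨he₃, lst, h₃⟩
  have hcnt := he₃.cnt
  have hne : decode τ.input ≠ [] ↔ 0 < (((decode τ.input).length : ℕ) : ℤ) := by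
    rw [Nat.cast_pos, List.length_pos_iff]
  -- An input without any integer has no target and is not in the language, but its entries read as
  -- zero and the empty sums would represent zero. The last stage excludes it.
  obtain ⟨σ₄, hσ₄⟩ : ∃ σ₄, σ₄ = (Code.ifpos .cnt .skip (.const .flag 0)).eval τ σ₃ := ⟨_, rfl⟩
  have hflag : σ₄.S .flag = if decode τ.input ≠ [] then σ₃.S .flag else 0 := by
    rw [hσ₄]
    simp only [Code.eval, hcnt, ← hne]
    split_ifs <;> simp
  have hhit : ∀ j₂ j₃, Hit X a (σ₂.A .mark) j₂ j₃ ↔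
      a 0 - groupSum a 2 j₂ - groupSum a 3 j₃ + 2 ^ X ∈ Z := by
    intro j₂ j₃
    unfold Hit
    rw [hM.2]
    have hZ0 : ∀ z ∈ Z, 0 ≤ z := by
      intro z hz
      obtain ⟨j, j', rfl⟩ := hsound z hz
      -- The bound does not involve the list length, so a length is chosen for which both indices
      -- lie within the lists.
      have h1 := abs_listVal_add_le (k := max j j') ha (g := 0) (g' := 1) (by norm_num) (by norm_num)
        (by norm_num) j j'
      have h2 : max j j' < 2 ^ (max j j' + 1) :=
        Nat.lt_two_pow_self.trans (Nat.pow_lt_pow_right (by norm_num) (Nat.lt_succ_self _))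
      rw [listVal_of_lt ((le_max_left _ _).trans_lt h2),
        listVal_of_lt ((le_max_right _ _).trans_lt h2)] at h1
      have := (abs_le.1 h1).1
      linarith
    constructor
    · rintro ⟨z, hz, h⟩
      have h0 := hZ0 z hz
      convert hz using 1
      omega
    · intro hz
      have h0 := hZ0 _ hz
      refine ⟨_, hz, ?_⟩
      omega
  apply Ends.code
  · rw [← hσ₄, hσ₄]
    simp only [Code.eval]
    split_ifs <;> simp [Store.set_S, he₃.zero]
  · simp only [Code.eval]
    split_ifs
    · exact hb₃
    · exact hb₃.set (by simp)
  · rw [← hσ₄, hflag]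
    constructor
    · intro h
      split_ifs at h with hd
      · refine ⟨hd, ?_⟩
        obtain ⟨j₂, j₃, hj⟩ := h₃.sound h
        rw [hhit] at hj
        obtain ⟨j₀, j₁, h01⟩ := hsound _ hj
        exact ⟨j₀, j₁, j₂, j₃, by linarith⟩
      · exact absurd h (lt_irrefl 0)
    · intro hd j₀ hj₀ j₁ hj₁ j₂ hj₂ j₃ hj₃ hsum hfit hl01 hl23
      rw [if_pos hd]
      -- The actual carry of the solution selects the candidate for which the load of the second
      -- half is assumed to be bounded.
      obtain ⟨c, hc, hfit'⟩ := exists_candidate r k X _ _ (groupSum a 2 j₂) (groupSum a 3 j₃) _ hfit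
      rw [← hsum] at hfit'
      refine h₃.complete c hc (hl23 _ hfit') j₂ hj₂ j₃ hj₃ hfit' ?_
      rw [hhit]
      have := hcomplete (hl01 _ hfit) j₀ hj₀ j₁ hj₁ hfit
      convert this using 1
      rw [hsum]
      ring

/-! ### Collisions of a random multiplier -/

open Classical in
/-- For few multipliers `r`, the residue of `r * d` modulo `2 ^ m` is small. -/
theorem card_small_residue_le (m X : ℕ) {d : ℤ} (hd : d ≠ 0) (hdX : |d| ≤ 2 ^ (X + 1)) :
    ((Finset.range (2 ^ m)).filter fun r : ℕ =>
      ∃ e : ℤ, |e| < 2 ^ (X + 1) ∧ r * d ≡ e [ZMOD 2 ^ m]).card ≤ 2 ^ (X + 2) := by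
  -- Multiplication by `d` is a bijection modulo a power of two only for odd `d`, so the power of
  -- two in `d` is split off.
  obtain ⟨κ, u, hu, hκ⟩ := Nat.exists_eq_two_pow_mul_odd (Int.natAbs_ne_zero.2 hd)
  have hκX : 2 ^ κ ≤ 2 ^ (X + 1) := by
    have h1 : d.natAbs ≤ 2 ^ (X + 1) := by zify; exact hdX
    rw [hκ] at h1
    exact le_trans (Nat.le_mul_of_pos_right _ hu.pos) h1
  have hκX' : κ ≤ X + 1 := (Nat.pow_le_pow_iff_right (by norm_num)).1 hκX
  obtain ⟨w, hw, hdw⟩ : ∃ w : ℤ, Odd w ∧ d = 2 ^ κ * w := by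
    have hu' : Odd (u : ℤ) := by exact_mod_cast hu
    rcases Int.natAbs_eq d with h | h
    · exact ⟨u, hu', by rw [h, hκ]; push_cast; ring⟩
    · exact ⟨-u, hu'.neg, by rw [h, hκ]; push_cast; ring⟩
  -- Here `d` vanishes modulo `2 ^ m` and every `r` counts; but `m < κ ≤ X + 1`, so there are few
  -- `r` at all.
  by_cases hm : m < κ
  · refine (Finset.card_filter_le _ _).trans ?_
    rw [Finset.card_range]
    exact Nat.pow_le_pow_right (by norm_num) (by omega)
  obtain ⟨p, rfl⟩ : ∃ p, m = κ + p := ⟨m - κ, by omega⟩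
  obtain ⟨q, hq⟩ : ∃ q, X + 1 = κ + q := ⟨X + 1 - κ, by omega⟩
  have h2κ : (0 : ℤ) < 2 ^ κ := by positivity
  -- Both `r * d` and the modulus are divisible by `2 ^ κ`, hence so is `e`. After division fewer
  -- than `2 ^ (q + 1)` values of `f` remain.
  have hex : ∀ r : ℕ, (∃ e : ℤ, |e| < 2 ^ (X + 1) ∧ r * d ≡ e [ZMOD 2 ^ (κ + p)]) →
      ∃ f : ℤ, f ∈ Finset.Ioo (-(2 ^ q : ℤ)) (2 ^ q) ∧ r * w ≡ f [ZMOD 2 ^ p] := by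
    rintro r ⟨e, he, h⟩
    have h1 : (2 : ℤ) ^ κ ∣ e - r * d := dvd_trans (pow_dvd_pow 2 (by omega)) h.dvd
    have h2 : (2 : ℤ) ^ κ ∣ e := by
      have h3 : (2 : ℤ) ^ κ ∣ r * d := by rw [hdw]; exact Dvd.intro (r * w) (by ring)
      simpa using dvd_add h1 h3
    obtain ⟨f, rfl⟩ := h2
    refine ⟨f, ?_, ?_⟩
    · rw [hq, pow_add, abs_mul, abs_of_pos h2κ] at he
      have := abs_lt.1 (lt_of_mul_lt_mul_left he h2κ.le)
      exact Finset.mem_Ioo.2 this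
    · rw [hdw, pow_add, show (r : ℤ) * (2 ^ κ * w) = 2 ^ κ * (r * w) by ring] at h
      exact Int.ModEq.mul_left_cancel' h2κ.ne' h
  choose! f hf hfr using hex
  have hcard : (Finset.range (2 ^ κ) ×ˢ Finset.Ioo (-(2 ^ q : ℤ)) (2 ^ q)).card ≤ 2 ^ (X + 2) := by
    rw [Finset.card_product, Finset.card_range, Int.card_Ioo]
    have h1 : ((2 : ℤ) ^ q - -2 ^ q - 1).toNat ≤ 2 ^ (q + 1) := by
      rw [Int.toNat_le]
      push_cast
      rw [pow_succ]
      linarith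
    calc _ ≤ 2 ^ κ * 2 ^ (q + 1) := Nat.mul_le_mul_left _ h1
      _ = 2 ^ (X + 2) := by rw [← pow_add]; congr 1; omega
  -- As `w` is invertible modulo `2 ^ p`, the number `f` determines the low `p` bits of `r`; the
  -- quotient gives the other `κ` bits. The counts `2 ^ κ` and `2 ^ (q + 1)` multiply to `2 ^ (X +
  -- 2)`.
  refine le_trans (Finset.card_le_card_of_injOn (fun r => (r / 2 ^ p, f r)) ?_ ?_) hcard
  · intro r hr
    rw [Finset.mem_coe, Finset.mem_filter, Finset.mem_range] at hr
    rw [Finset.mem_coe, Finset.mem_product]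
    refine ⟨Finset.mem_range.2 ?_, hf r hr.2⟩
    rw [Nat.div_lt_iff_lt_mul (by positivity), ← pow_add]
    exact hr.1
  · intro r hr r' hr' h
    rw [Finset.mem_coe, Finset.mem_filter, Finset.mem_range] at hr hr'
    obtain ⟨h1, h2⟩ := Prod.mk.inj h
    have h3 := hfr r hr.2
    have h4 := hfr r' hr'.2
    rw [h2] at h3
    have h5 : (r : ℤ) ≡ r' [ZMOD 2 ^ p] := by
      have hg : Int.gcd (2 ^ p) w = 1 := by
        rw [← Int.isCoprime_iff_gcd_eq_one]
        refine IsCoprime.pow_left ?_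
        obtain ⟨t, rfl⟩ := hw
        exact ⟨-t, 1, by ring⟩
      have h6 := Int.ModEq.cancel_right_div_gcd (by positivity) (h3.trans h4.symm)
      rw [hg] at h6
      simpa using h6
    have h7 : r % 2 ^ p = r' % 2 ^ p := by
      have : (r : ℤ) % ((2 ^ p : ℕ) : ℤ) = r' % ((2 ^ p : ℕ) : ℤ) := by push_cast; exact h5
      exact_mod_cast this
    rw [← Nat.div_add_mod r (2 ^ p), ← Nat.div_add_mod r' (2 ^ p), h7, h1]

/-- The buckets of `v` and `w` have the same sum as those of `v₀` and `w₀`. -/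
theorem Fits.small {r k X : ℕ} {s v w v₀ w₀ : ℤ} (h : Fits r k X s v w) (h₀ : Fits r k X s v₀ w₀) :
    ∃ e : ℤ, |e| < 2 ^ (X + 1) ∧ r * (v + w - v₀ - w₀) ≡ e [ZMOD 2 ^ (k + X)] := by
  -- Each residue is a bucket plus a low part. The buckets cancel by assumption, and two low parts
  -- minus two others remain.
  refine ⟨residue r X v + residue r X w - residue r X v₀ - residue r X w₀, ?_, ?_⟩
  · have b0 := residue_nonneg r X v
    have b1 := residue_nonneg r X w
    have b2 := residue_nonneg r X v₀
    have b3 := residue_nonneg r X w₀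
    have c0 := residue_lt r X v
    have c1 := residue_lt r X w
    have c2 := residue_lt r X v₀
    have c3 := residue_lt r X w₀
    rw [pow_succ, abs_lt]
    constructor <;> linarith
  · have hx : ∀ v, (r : ℤ) * v ≡ residue r (k + X) v [ZMOD 2 ^ (k + X)] :=
      fun v => (Int.mod_modEq _ _).symm
    have h1 : (bucket r k X v : ℤ) + bucket r k X w ≡ bucket r k X v₀ + bucket r k X w₀
        [ZMOD 2 ^ (k + X)] := Eq.trans h h₀.symm
    rw [natCast_bucket, natCast_bucket, natCast_bucket, natCast_bucket] at h1
    have h2 := (((hx v).add (hx w)).sub (hx v₀)).sub (hx w₀)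
    have h3 := h1.add_right
      (residue r X v + residue r X w - residue r (k + X) v₀ - residue r (k + X) w₀)
    convert h2.trans (Eq.trans (congrArg (· % 2 ^ (k + X)) ?_) (Eq.trans h3
      (congrArg (· % 2 ^ (k + X)) ?_))) using 1 <;> ring

section
variable (k X : ℕ) (a : ℕ → ℤ) (g g' : ℕ) (V : ℤ)

open Classical in
/-- The number of pairs with a sum different from `V` but with the same hash value. -/
noncomputable def collisions (r : ℕ) : ℕ :=
  ∑ j ∈ Finset.range (2 ^ (k + 1)), (((Finset.range (2 ^ (k + 1))).image (listVal a k g')).filter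
    fun w => listVal a k g j + w ≠ V ∧ ∃ e : ℤ, |e| < 2 ^ (X + 1) ∧
      r * (listVal a k g j + w - V) ≡ e [ZMOD 2 ^ (k + X)]).card

/-- Each entry `j` is charged one round for itself and at most one for the single value completing
it to `V`, which makes `2 * 2 ^ (k + 1)`. All other partners are collisions by `Fits.small`, and
their number does not involve `s`. -/
theorem pairLoad_le {r : ℕ} {s v₀ w₀ : ℤ} (hV : V = v₀ + w₀) (h₀ : Fits r k X s v₀ w₀) :
    pairLoad r k X a g g' s ≤ 2 * 2 ^ (k + 1) + collisions k X a g g' V r := by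
  classical
  unfold pairLoad collisions
  have h1 : 2 * 2 ^ (k + 1) = ∑ j ∈ Finset.range (2 ^ (k + 1)), 2 := by simp [mul_comm]
  rw [h1, ← Finset.sum_add_distrib]
  refine Finset.sum_le_sum fun j _ => ?_
  have h2 : ((Finset.range (2 ^ (k + 1))).image (listVal a k g')).filter
      (Fits r k X s (listVal a k g j)) ⊆ insert (V - listVal a k g j)
      (((Finset.range (2 ^ (k + 1))).image (listVal a k g')).filter
        fun w => listVal a k g j + w ≠ V ∧ ∃ e : ℤ, |e| < 2 ^ (X + 1) ∧
          r * (listVal a k g j + w - V) ≡ e [ZMOD 2 ^ (k + X)]) := by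
    intro w hw
    rw [Finset.mem_filter] at hw
    rw [Finset.mem_insert, Finset.mem_filter]
    by_cases hwV : listVal a k g j + w = V
    · left; linarith
    · refine Or.inr ⟨hw.1, hwV, ?_⟩
      have := hw.2.small h₀
      rwa [sub_sub, ← hV] at this
  have h3 := (Finset.card_le_card h2).trans (Finset.card_insert_le _ _)
  omega

/-- Exchanging the sums, each pair with a sum other than `V` is counted for at most `2 ^ (X + 2)`
multipliers. -/
theorem sum_collisions_le (hV : |V| ≤ 2 ^ X) (ha : ∀ I : Finset ℕ, ∑ i ∈ I, |a i| ≤ 2 ^ X)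
    (hg : g < 4) (hg' : g' < 4) (hne : g ≠ g') :
    ∑ r ∈ Finset.range (2 ^ (k + X)), collisions k X a g g' V r ≤
      2 ^ (k + 1) * (2 ^ (k + 1) * 2 ^ (X + 2)) := by
  classical
  unfold collisions
  rw [Finset.sum_comm]
  refine (Finset.sum_le_card_nsmul _ _ (2 ^ (k + 1) * 2 ^ (X + 2)) fun j _ => ?_).trans (by simp)
  simp only [Finset.card_filter]
  rw [Finset.sum_comm]
  refine (Finset.sum_le_card_nsmul _ _ (2 ^ (X + 2)) fun w hw => ?_).trans ?_
  · rw [← Finset.card_filter]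
    obtain ⟨j', -, rfl⟩ := Finset.mem_image.1 hw
    by_cases hd : listVal a k g j + listVal a k g' j' = V
    · simp [hd]
    · refine le_trans (Finset.card_le_card ?_) (card_small_residue_le (k + X) X
        (d := listVal a k g j + listVal a k g' j' - V) (sub_ne_zero.2 hd) ?_)
      · exact Finset.monotone_filter_right _ fun r _ h => h.2
      · have h1 := abs_le.1 (abs_listVal_add_le (k := k) ha hg hg' hne j j')
        have h2 := abs_le.1 hV
        rw [pow_succ, abs_le]
        constructor <;> linarith
  · rw [smul_eq_mul]
    refine Nat.mul_le_mul_right _ (Finset.card_image_le.trans ?_)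
    rw [Finset.card_range]

open Classical in
/-- For most multipliers there are few collisions. -/
theorem card_many_collisions_le (hV : |V| ≤ 2 ^ X) (ha : ∀ I : Finset ℕ, ∑ i ∈ I, |a i| ≤ 2 ^ X)
    (hg : g < 4) (hg' : g' < 4) (hne : g ≠ g') :
    6 * ((Finset.range (2 ^ (k + X))).filter
      fun r => 62 * 2 ^ (k + 1) < collisions k X a g g' V r).card ≤ 2 ^ (k + X) := by
  have h1 := sum_collisions_le k X a g g' V hV ha hg hg' hne
  -- Markov's inequality. The mean number of collisions is at most `8 * 2 ^ (k + 1)`, and `6 * 8 ≤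
  -- 62`; the threshold 62 is the fuel factor 64 less the 2 of `pairLoad_le`.
  have h2 : ((Finset.range (2 ^ (k + X))).filter
      fun r => 62 * 2 ^ (k + 1) < collisions k X a g g' V r).card * (62 * 2 ^ (k + 1)) ≤
      ∑ r ∈ Finset.range (2 ^ (k + X)), collisions k X a g g' V r := by
    refine le_trans ?_ (Finset.sum_le_sum_of_subset (Finset.filter_subset
      (fun r => 62 * 2 ^ (k + 1) < collisions k X a g g' V r) _))
    rw [← smul_eq_mul]
    exact Finset.card_nsmul_le_sum _ _ _ fun r hr => (Finset.mem_filter.1 hr).2.le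
  have h3 := h2.trans h1
  have h4 : 2 ^ (k + 1) * (2 ^ (k + 1) * 2 ^ (X + 2)) = (8 * 2 ^ (k + X)) * 2 ^ (k + 1) := by
    rw [pow_add 2 k X]; ring
  rw [h4, ← mul_assoc] at h3
  have h5 := Nat.le_of_mul_le_mul_right h3 (by positivity)
  omega

end

/-! ### Probabilities -/

open MeasureTheory ENNReal in
theorem coinLaw_cylinder (m : ℕ) (β : ℕ → Bool) :
    coinLaw (Set.pi (Finset.range m) fun i => {β i}) = (2⁻¹ : ℝ≥0∞) ^ m := by
  unfold coinLaw
  rw [Measure.infinitePi_pi _ (fun _ _ => MeasurableSet.singleton _)]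
  simp [PMF.toMeasure_apply_singleton, PMF.uniformOfFintype_apply]

theorem coinNum_congr {ω ω' : ℕ → Bool} {m : ℕ} (h : ∀ i < m, ω i = ω' i) :
    coinNum ω m = coinNum ω' m := by
  induction m with
  | zero => rfl
  | succ m ih => rw [coinNum, coinNum, ih fun i hi => h i (by omega), h m (by omega)]

theorem exists_coinNum_eq {m r : ℕ} (hr : r < 2 ^ m) : ∃ ω, coinNum ω m = r := by
  induction m generalizing r with
  | zero => exact ⟨fun _ => false, by simp at hr; simp [coinNum, hr]⟩
  | succ m ih =>
    obtain ⟨ω, hω⟩ := ih (r := r / 2) (by rw [pow_succ] at hr; omega)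
    refine ⟨Function.update ω m (r % 2 = 1), ?_⟩
    rw [coinNum, Function.update_self, coinNum_congr (ω' := ω), hω]
    · rcases Nat.mod_two_eq_zero_or_one r with h | h <;> simp [h] <;> omega
    · intro i hi
      rw [Function.update_of_ne (by omega)]

/-- The number given by the first `m` coins is uniformly distributed. -/
theorem le_coinLaw_coinNum (m : ℕ) (G : Finset ℕ) (hG : ∀ r ∈ G, r < 2 ^ m) :
    (G.card : ENNReal) * 2⁻¹ ^ m ≤ coinLaw {ω | coinNum ω m ∈ G} := by
  have hex : ∀ r, r ∈ G → ∃ ω, coinNum ω m = r := fun r hr => exists_coinNum_eq (hG r hr)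
  choose! β hβ using hex
  -- Each value is taken on a whole cylinder of measure `2⁻¹ ^ m`, and cylinders of different values
  -- are disjoint.
  have hmem : ∀ r ∈ G, ∀ ω ∈ Set.pi (Finset.range m : Set ℕ) (fun i => {β r i}),
      coinNum ω m = r := by
    intro r hr ω hω
    rw [← hβ r hr]
    refine coinNum_congr fun i hi => ?_
    simpa using hω i (by simpa using hi)
  have hsub : (⋃ r ∈ G, Set.pi (Finset.range m : Set ℕ) fun i => {β r i}) ⊆
      {ω | coinNum ω m ∈ G} := by
    intro ω hω
    simp only [Set.mem_iUnion] at hω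
    obtain ⟨r, hr, hω⟩ := hω
    rw [Set.mem_ofPred_eq, hmem r hr ω hω]
    exact hr
  refine le_trans (le_of_eq ?_) (MeasureTheory.measure_mono hsub)
  rw [MeasureTheory.measure_biUnion_finset]
  · rw [Finset.sum_congr rfl fun r _ => coinLaw_cylinder m (β r), Finset.sum_const, nsmul_eq_mul]
  · intro r hr r' hr' hne
    rw [Function.onFun, Set.disjoint_left]
    intro ω h h'
    exact hne ((hmem r hr ω h).symm.trans (hmem r' hr' ω h'))
  · intro r _
    exact MeasurableSet.pi (Finset.range m).countable_toSet fun i _ => MeasurableSet.singleton _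

/-- An event that contains most values of the first `m` coins has probability at least `2 / 3`. -/
theorem two_thirds_le_coinLaw {m : ℕ} {G : Finset ℕ} (hG : ∀ r ∈ G, r < 2 ^ m)
    (hcard : 2 * 2 ^ m ≤ 3 * G.card) {S : Set (ℕ → Bool)} (hS : ∀ ω, coinNum ω m ∈ G → ω ∈ S) :
    2 / 3 ≤ coinLaw S := by
  refine le_trans ?_ ((le_coinLaw_coinNum m G hG).trans (MeasureTheory.measure_mono hS))
  rw [← ENNReal.inv_pow, ← div_eq_mul_inv, ENNReal.le_div_iff_mul_le (Or.inl (by simp))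
    (Or.inl (by simp)), div_eq_mul_inv, mul_right_comm, ← div_eq_mul_inv]
  refine ENNReal.div_le_of_le_mul ?_
  rw [mul_comm (G.card : ENNReal)]
  exact_mod_cast hcard

/-! ### Sums of subsequences and groups -/

theorem natOfBits_surj {k s : ℕ} (hs : s < 2 ^ k) : ∃ π : List Bool, π.length = k ∧ natOfBits π = s := by
  induction k generalizing s with
  | zero => exact ⟨[], rfl, by simp at hs; simp [natOfBits, hs]⟩
  | succ k ih =>
    obtain ⟨π, h1, h2⟩ := ih (s := s / 2) (by rw [pow_succ] at hs; omega)
    refine ⟨π ++ [decide (s % 2 = 1)], by simp [h1], ?_⟩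
    rw [natOfBits_append_singleton, h2]
    rcases Nat.mod_two_eq_zero_or_one s with h | h <;> simp [h] <;> omega

theorem sum_range_abs_getD (l : List ℤ) : ∑ i ∈ Finset.range l.length, |l.getD i 0| = (l.map abs).sum := by
  induction l with
  | nil => simp
  | cons z l ih =>
    rw [List.length_cons, Finset.sum_range_succ', List.map_cons, List.sum_cons, ← ih]
    simp [add_comm]

theorem sum_abs_getD_le (l : List ℤ) (I : Finset ℕ) : ∑ i ∈ I, |l.getD i 0| ≤ (l.map abs).sum := by
  rw [← sum_range_abs_getD]
  rw [← Finset.sum_filter_add_sum_filter_not I (· < l.length)]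
  have h0 : ∑ i ∈ I.filter (¬ · < l.length), |l.getD i 0| = 0 := by
    refine Finset.sum_eq_zero fun i hi => ?_
    rw [List.getD_eq_default _ _ (by have := (Finset.mem_filter.1 hi).2; omega), abs_zero]
  rw [h0, add_zero]
  refine Finset.sum_le_sum_of_subset_of_nonneg ?_ fun i _ _ => abs_nonneg _
  intro i hi
  exact Finset.mem_range.2 (Finset.mem_filter.1 hi).2

/-- The sums of subsequences are the sums over sets of indices. -/
theorem exists_sublist_sum_iff (A : List ℤ) (t : ℤ) :
    (∃ B : List ℤ, B.Sublist A ∧ B.sum = t) ↔ ∃ I : Finset ℕ, ∑ i ∈ I, A.getD i 0 = t := by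
  induction A generalizing t with
  | nil => simp [eq_comm]
  | cons z A ih =>
    constructor
    · rintro ⟨B, hB, rfl⟩
      cases hB with
      | cons _ h =>
        obtain ⟨I, hI⟩ := (ih _).1 ⟨_, h, rfl⟩
        refine ⟨I.map ⟨Nat.succ, Nat.succ_injective⟩, ?_⟩
        rw [Finset.sum_map, ← hI]
        rfl
      | cons_cons _ h =>
        obtain ⟨I, hI⟩ := (ih _).1 ⟨_, h, rfl⟩
        refine ⟨insert 0 (I.map ⟨Nat.succ, Nat.succ_injective⟩), ?_⟩
        rw [Finset.sum_insert (by simp), Finset.sum_map, List.sum_cons, ← hI]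
        rfl
    · rintro ⟨I, rfl⟩
      obtain ⟨J, hJ⟩ : ∃ J : Finset ℕ, ∑ i ∈ I.erase 0, (z :: A).getD i 0 = ∑ i ∈ J, A.getD i 0 := by
        refine ⟨(I.erase 0).image Nat.pred, ?_⟩
        rw [Finset.sum_image]
        · refine Finset.sum_congr rfl fun i hi => ?_
          obtain ⟨j, rfl⟩ := Nat.exists_eq_succ_of_ne_zero (Finset.ne_of_mem_erase hi)
          rfl
        · intro i hi j hj h
          have h1 := Finset.ne_of_mem_erase hi
          have h2 := Finset.ne_of_mem_erase hj
          simp only [Nat.pred_eq_sub_one] at h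
          omega
      obtain ⟨B, hB, hs⟩ := (ih _).2 ⟨J, hJ.symm⟩
      by_cases h0 : 0 ∈ I
      · refine ⟨z :: B, hB.cons_cons z, ?_⟩
        rw [List.sum_cons, hs, ← Finset.add_sum_erase _ _ h0]
        rfl
      · refine ⟨B, hB.cons z, ?_⟩
        rw [hs, Finset.erase_eq_of_notMem h0]

theorem exists_groupSum_eq (a : ℕ → ℤ) (g : ℕ) (I : Finset ℕ) {k : ℕ} (hI : ∀ q ∈ I, q ≤ k) :
    ∃ j < 2 ^ (k + 1), groupSum a g j = ∑ q ∈ I, a (1 + g + 4 * q) := by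
  refine ⟨∑ q ∈ I, 2 ^ q, ?_, ?_⟩
  · exact Nat.geomSum_lt le_rfl fun q hq => Nat.lt_succ_of_le (hI q hq)
  · rw [groupSum, Finset.toFinset_bitIndices_sum_two_pow]

theorem sum_eq_sum_groups (b : ℕ → ℤ) (I : Finset ℕ) :
    ∃ J : ℕ → Finset ℕ, (∀ g < 4, ∀ q ∈ J g, 4 * q + g ∈ I) ∧
      ∑ i ∈ I, b i = ∑ q ∈ J 0, b (0 + 4 * q) + ∑ q ∈ J 1, b (1 + 4 * q) + ∑ q ∈ J 2, b (2 + 4 * q)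
        + ∑ q ∈ J 3, b (3 + 4 * q) := by
  refine ⟨fun g => (I.filter (· % 4 = g)).image (· / 4), ?_, ?_⟩
  · intro g _ q hq
    obtain ⟨i, hi, rfl⟩ := Finset.mem_image.1 hq
    obtain ⟨hi, rfl⟩ := Finset.mem_filter.1 hi
    rwa [Nat.div_add_mod]
  · have key : ∀ g, ∑ q ∈ (I.filter (· % 4 = g)).image (· / 4), b (g + 4 * q) =
        ∑ i ∈ I.filter (· % 4 = g), b i := by
      intro g
      rw [Finset.sum_image]
      · refine Finset.sum_congr rfl fun i hi => ?_
        rw [← (Finset.mem_filter.1 hi).2, Nat.mod_add_div]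
      · intro i hi j hj h
        have h1 := (Finset.mem_filter.1 hi).2
        have h2 := (Finset.mem_filter.1 hj).2
        simp only at h
        omega
    rw [key, key, key, key, ← Finset.sum_fiberwise_of_maps_to (t := Finset.range 4)
      (g := (· % 4)) (fun i _ => Finset.mem_range.2 (Nat.mod_lt _ (by norm_num)))]
    simp [Finset.sum_range_succ]

theorem exists_sum_eq_groupSums (b : ℕ → ℤ) (j₀ j₁ j₂ j₃ : ℕ) :
    ∃ I : Finset ℕ, ∑ i ∈ I, b (1 + i) =
      groupSum b 0 j₀ + groupSum b 1 j₁ + groupSum b 2 j₂ + groupSum b 3 j₃ := by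
  have key : ∀ g j, groupSum b g j =
      ∑ i ∈ j.bitIndices.toFinset.image (fun q => g + 4 * q), b (1 + i) := by
    intro g j
    rw [Finset.sum_image (by intro x _ y _ h; simp only at h; omega), groupSum]
    simp [add_assoc]
  have hdisj : ∀ g g' j j' : ℕ, g < 4 → g' < 4 → g ≠ g' →
      Disjoint (j.bitIndices.toFinset.image (fun q => g + 4 * q))
        (j'.bitIndices.toFinset.image (fun q => g' + 4 * q)) := by
    intro g g' j j' hg hg' hne
    rw [Finset.disjoint_left]
    intro x hx hx'
    obtain ⟨q, -, rfl⟩ := Finset.mem_image.1 hx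
    obtain ⟨q', -, h⟩ := Finset.mem_image.1 hx'
    omega
  rw [key, key, key, key,
    ← Finset.sum_union (hdisj 0 1 _ _ (by norm_num) (by norm_num) (by norm_num)),
    ← Finset.sum_union, ← Finset.sum_union]
  · exact ⟨_, rfl⟩
  · rw [Finset.disjoint_union_left, Finset.disjoint_union_left]
    exact ⟨⟨hdisj 0 3 _ _ (by norm_num) (by norm_num) (by norm_num),
      hdisj 1 3 _ _ (by norm_num) (by norm_num) (by norm_num)⟩,
      hdisj 2 3 _ _ (by norm_num) (by norm_num) (by norm_num)⟩
  · rw [Finset.disjoint_union_left]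
    exact ⟨hdisj 0 2 _ _ (by norm_num) (by norm_num) (by norm_num),
      hdisj 1 2 _ _ (by norm_num) (by norm_num) (by norm_num)⟩

/-! ### The protocol -/

/-- The exponent of the value bound must also dominate the constants of the program, so it is
enlarged by `verifierBound` before `compileProgram_correct` is applied. -/
theorem RunsAll.mono {τ : Tapes} {B B' : ℤ} (hB : B ≤ B') {l : List Stage} {n : ℕ} {σ σ' : Store}
    (h : RunsAll τ B l n σ σ') : RunsAll τ B' l n σ σ' := by
  have hb : ∀ σ : Store, σ.Bdd B → σ.Bdd B' := fun σ h =>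
    ⟨fun r => (h.1 r).trans hB, fun k e => (h.2 k e).trans hB⟩
  induction h with
  | nil σ => exact RunsAll.nil σ
  | cons h hb' _ ih =>
    obtain ⟨m, h1, h2, h3, h4⟩ := h
    exact RunsAll.cons ⟨m, h1, h2, h3, fun i hi => ⟨(h4 i hi).1, hb _ (h4 i hi).2⟩⟩ (hb _ hb') ih

theorem RunsWithin.mono {P : Program} {τ : Tapes} {T T' S S' : ℝ} (h : RunsWithin P τ T S)
    (hT : T ≤ T') (hS : S ≤ S') : RunsWithin P τ T' S' := by
  obtain ⟨m, h1, h2, h3⟩ := h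
  exact ⟨m, h1, h2.trans hT, fun j hj => (h3 j hj).trans hS⟩

/-- A bound for the constants in the program of the verifier. -/
def verifierBound : ℕ := (verifier.map Instr.magnitude).sum

theorem magnitude_le_verifierBound : ∀ i ∈ verifier, i.magnitude ≤ verifierBound := fun _ hi =>
  List.le_sum_of_mem (List.mem_map_of_mem hi)

/-- The factor in the bound for time and space. -/
def timeFactor : ℕ :=
  673 * ((verifier.length + 1) * (2 * (20 + verifierBound + (verifier.length + 1)) + 8))

/-- The bound for time and space. -/
noncomputable def timeBound (x : List Bool) : ℝ :=
  timeFactor * ((x.length : ℝ) + 1) ^ 2 * 2 ^ ((itemCount x : ℝ) / 4)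

theorem isOStar_timeBound : IsOStar timeBound fun x => (2 : ℝ) ^ ((itemCount x : ℝ) / 4) :=
  ⟨timeFactor, 2, fun _ => le_rfl⟩

theorem itemCount_le (x : List Bool) : itemCount x ≤ x.length :=
  (Nat.sub_le _ _).trans (length_decode_le x)

theorem length_proof_le {x π : List Bool} (hπ : (π.length : ℝ) ≤ (itemCount x : ℝ) / 4) :
    π.length ≤ x.length := by
  have h1 : 4 * π.length ≤ itemCount x := by
    have : (4 * π.length : ℝ) ≤ itemCount x := by linarith
    exact_mod_cast this
  have h2 := itemCount_le x
  omega

/-- The number of rounds contributes `673 = 21 + 2 * 326` with a factor `X + 1`. The cost of a round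
is linear in `X`, which contributes the second factor `X + 1`. -/
theorem cost_le (l G X k : ℕ) {w : ℝ} (hw : (2 : ℝ) ^ k ≤ w) :
    (((3 * X + 20 + 326 * 2 ^ (k + 1) + 1) * ((l + 1) * (2 * (2 * X + 20 + G + (l + 1)) + 4)) : ℕ) : ℝ) ≤
      ((673 * ((l + 1) * (2 * (20 + G + (l + 1)) + 8)) : ℕ) : ℝ) * ((X : ℝ) + 1) ^ 2 * w := by
  have hw2 : 1 ≤ w := (one_le_pow₀ (by norm_num)).trans hw
  have hX : (0 : ℝ) ≤ X := Nat.cast_nonneg _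
  have h1 : ((3 * X + 20 + 326 * 2 ^ (k + 1) + 1 : ℕ) : ℝ) ≤ 673 * (((X : ℝ) + 1) * w) := by
    push_cast
    rw [pow_succ]
    have h2 : (X : ℝ) * 1 ≤ X * w := mul_le_mul_of_nonneg_left hw2 hX
    linarith
  have h3 : (l + 1) * (2 * (2 * X + 20 + G + (l + 1)) + 4) ≤
      ((l + 1) * (2 * (20 + G + (l + 1)) + 8)) * (X + 1) := by
    rw [mul_assoc]
    refine Nat.mul_le_mul_left _ ?_
    have h4 : (2 * (20 + G + (l + 1)) + 8) * (X + 1) =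
        2 * (20 + G + (l + 1)) * X + 8 * X + (2 * (20 + G + (l + 1)) + 8) := by ring
    rw [h4]
    omega
  have h4 : (((l + 1) * (2 * (2 * X + 20 + G + (l + 1)) + 4) : ℕ) : ℝ) ≤
      (((l + 1) * (2 * (20 + G + (l + 1)) + 8) : ℕ) : ℝ) * ((X : ℝ) + 1) := by
    exact_mod_cast h3
  rw [Nat.cast_mul]
  refine (mul_le_mul h1 h4 (Nat.cast_nonneg _) (by positivity)).trans (le_of_eq ?_)
  rw [Nat.cast_mul 673]
  push_cast
  ring

theorem cost_le_timeBound {x π : List Bool} (hπ : (π.length : ℝ) ≤ (itemCount x : ℝ) / 4) :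
    (((3 * x.length + 20 + 326 * 2 ^ (π.length + 1) + 1) *
      roundCost verifier (2 * x.length + 20 + verifierBound) : ℕ) : ℝ) ≤ timeBound x := by
  refine cost_le verifier.length verifierBound x.length π.length ?_
  rw [← Real.rpow_natCast]
  exact Real.rpow_le_rpow_of_exponent_le (by norm_num) hπ

/-- The numbers of an instance, with the target first, followed by zeros. -/
def entries (x : List Bool) (i : ℕ) : ℤ := (decode x).getD i 0

theorem sum_abs_entries_le (x : List Bool) (I : Finset ℕ) :
    ∑ i ∈ I, |entries x i| ≤ 2 ^ x.length :=
  (sum_abs_getD_le _ I).trans (sum_abs_decode_le x)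

theorem mem_subsetSum_of_groupSums {x : List Bool} (hx : decode x ≠ []) {j₀ j₁ j₂ j₃ : ℕ}
    (h : entries x 0 = groupSum (entries x) 0 j₀ + groupSum (entries x) 1 j₁ +
      groupSum (entries x) 2 j₂ + groupSum (entries x) 3 j₃) : x ∈ subsetSum := by
  obtain ⟨t, A, hA⟩ := List.exists_cons_of_ne_nil hx
  refine ⟨t, A, hA, (exists_sublist_sum_iff A t).2 ?_⟩
  obtain ⟨I, hI⟩ := exists_sum_eq_groupSums (entries x) j₀ j₁ j₂ j₃
  refine ⟨I, ?_⟩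
  rw [← h] at hI
  simpa [entries, hA, add_comm 1] using hI

/-- An index `4 * q + g` below `n` has `q ≤ n / 4` in integer division. A group thus has up to `n /
4 + 1` members, which is why lists have length `2 ^ (k + 1)` although the message has only `k` bits.
-/
theorem exists_groupSums {x : List Bool} (hx : x ∈ subsetSum) :
    decode x ≠ [] ∧ ∃ j₀ < 2 ^ (itemCount x / 4 + 1), ∃ j₁ < 2 ^ (itemCount x / 4 + 1),
      ∃ j₂ < 2 ^ (itemCount x / 4 + 1), ∃ j₃ < 2 ^ (itemCount x / 4 + 1),
      entries x 0 = groupSum (entries x) 0 j₀ + groupSum (entries x) 1 j₁ +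
        groupSum (entries x) 2 j₂ + groupSum (entries x) 3 j₃ := by
  obtain ⟨t, A, hA, hB⟩ := hx
  refine ⟨by simp [hA], ?_⟩
  obtain ⟨I, hI⟩ := (exists_sublist_sum_iff A t).1 hB
  have hn : itemCount x = A.length := by simp [itemCount, hA]
  -- Indices beyond the list contribute the default value 0 and are dropped, so that the bound on
  -- `q` applies.
  have hI' : ∑ i ∈ I.filter (· < A.length), entries x (1 + i) = t := by
    rw [← hI, Finset.sum_filter]
    refine Finset.sum_congr rfl fun i _ => ?_
    split_ifs with hi
    · simp [entries, hA, add_comm 1]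
    · rw [List.getD_eq_default _ _ (by omega)]
  obtain ⟨J, hJ, hsum⟩ := sum_eq_sum_groups (fun i => entries x (1 + i)) (I.filter (· < A.length))
  have hle : ∀ g < 4, ∀ q ∈ J g, q ≤ itemCount x / 4 := by
    intro g hg q hq
    have := (Finset.mem_filter.1 (hJ g hg q hq)).2
    omega
  obtain ⟨j₀, h₀, e₀⟩ := exists_groupSum_eq (entries x) 0 (J 0) (hle 0 (by norm_num))
  obtain ⟨j₁, h₁, e₁⟩ := exists_groupSum_eq (entries x) 1 (J 1) (hle 1 (by norm_num))
  obtain ⟨j₂, h₂, e₂⟩ := exists_groupSum_eq (entries x) 2 (J 2) (hle 2 (by norm_num))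
  obtain ⟨j₃, h₃, e₃⟩ := exists_groupSum_eq (entries x) 3 (J 3) (hle 3 (by norm_num))
  refine ⟨j₀, h₀, j₁, h₁, j₂, h₂, j₃, h₃, ?_⟩
  rw [e₀, e₁, e₂, e₃]
  have ht : entries x 0 = t := by simp [entries, hA]
  rw [ht, ← hI', hsum]
  simp only [add_assoc]

/-- Buckets are multiples of `2 ^ X`, and so is their sum reduced modulo `2 ^ (k + X)`. Only `2 ^ k`
values are possible, hence `k` bits suffice. -/
theorem exists_message (r k X : ℕ) (v w : ℤ) :
    ∃ π : List Bool, π.length = k ∧ Fits r k X (natOfBits π * 2 ^ X) v w := by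
  have hD : (0 : ℤ) < 2 ^ X := by positivity
  have hdvd : ∀ v, (2 : ℤ) ^ X ∣ bucket r k X v := by
    intro v
    rw [natCast_bucket, ← residue_emod r k X v]
    exact Int.dvd_self_sub_emod
  obtain ⟨s, hs⟩ : (2 : ℤ) ^ X ∣ ((bucket r k X v : ℤ) + bucket r k X w) % 2 ^ (k + X) :=
    (EuclideanDomain.dvd_mod_iff (pow_dvd_pow 2 (Nat.le_add_left X k))).2
      (dvd_add (hdvd v) (hdvd w))
  have h0 : 0 ≤ ((bucket r k X v : ℤ) + bucket r k X w) % 2 ^ (k + X) :=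
    Int.emod_nonneg _ (by positivity)
  have h1 : ((bucket r k X v : ℤ) + bucket r k X w) % 2 ^ (k + X) < 2 ^ (k + X) :=
    Int.emod_lt_of_pos _ (by positivity)
  rw [hs] at h0 h1
  have hs0 : 0 ≤ s := nonneg_of_mul_nonneg_right h0 hD
  rw [pow_add, mul_comm ((2 : ℤ) ^ k)] at h1
  have hs1 := lt_of_mul_lt_mul_left h1 hD.le
  obtain ⟨m, rfl⟩ := Int.eq_ofNat_of_zero_le hs0
  obtain ⟨π, h2, h3⟩ := natOfBits_surj (k := k) (s := m) (by exact_mod_cast hs1)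
  refine ⟨π, h2, ?_⟩
  unfold Fits
  rw [hs, h3, mul_comm]

/-- The verifier runs in the time bound. It accepts only if the target is a sum of four subset sums,
and it accepts if the message agrees with such a representation and there are few collisions. -/
theorem verifier_spec {x : List Bool} (ω : ℕ → Bool) {π : List Bool}
    (hπ : (π.length : ℝ) ≤ (itemCount x : ℝ) / 4) :
    RunsWithin verifier ⟨x, ω, π⟩ (timeBound x) (timeBound x) ∧
    (Accepts verifier ⟨x, ω, π⟩ → x ∈ subsetSum) ∧
    (decode x ≠ [] → ∀ j₀ < 2 ^ (π.length + 1), ∀ j₁ < 2 ^ (π.length + 1),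
      ∀ j₂ < 2 ^ (π.length + 1), ∀ j₃ < 2 ^ (π.length + 1),
      entries x 0 = groupSum (entries x) 0 j₀ + groupSum (entries x) 1 j₁ +
        groupSum (entries x) 2 j₂ + groupSum (entries x) 3 j₃ →
      Fits (coinNum ω (π.length + x.length)) π.length x.length (natOfBits π * 2 ^ x.length)
        (groupSum (entries x) 0 j₀) (groupSum (entries x) 1 j₁) →
      collisions π.length x.length (entries x) 0 1
        (groupSum (entries x) 0 j₀ + groupSum (entries x) 1 j₁)
        (coinNum ω (π.length + x.length)) ≤ 62 * 2 ^ (π.length + 1) →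
      collisions π.length x.length (entries x) 2 3
        (groupSum (entries x) 2 j₂ + groupSum (entries x) 3 j₃)
        (coinNum ω (π.length + x.length)) ≤ 62 * 2 ^ (π.length + 1) →
      Accepts verifier ⟨x, ω, π⟩) := by
  obtain ⟨σ, ⟨n, hn, hrun⟩, -, hsound, hcomplete⟩ := verifierStages_ends (τ := ⟨x, ω, π⟩)
    (X := x.length) (k := π.length) (r := coinNum ω (π.length + x.length)) (a := entries x)
    (length_proof_le hπ) rfl rfl rfl rfl (sum_abs_entries_le x)
  have hrun' : RunsAll ⟨x, ω, π⟩ (2 ^ (2 * x.length + 20 + verifierBound)) verifierStages n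
      Store.init σ := hrun.mono (int_two_pow_le (by omega))
  obtain ⟨h1, h2⟩ := compileProgram_correct (fun i hi => by
    have := magnitude_le_verifierBound i hi
    omega) hrun'
  have hcost : (((n + 1) * roundCost (compileProgram verifierStages)
      (2 * x.length + 20 + verifierBound) : ℕ) : ℝ) ≤ timeBound x := by
    refine le_trans ?_ (cost_le_timeBound hπ)
    exact_mod_cast Nat.mul_le_mul_right _ (Nat.succ_le_succ hn)
  refine ⟨h1.mono hcost hcost, ?_, ?_⟩
  · intro h
    obtain ⟨hd, j₀, j₁, j₂, j₃, hj⟩ := hsound (h2.1 h)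
    exact mem_subsetSum_of_groupSums hd hj
  · intro hd j₀ hj₀ j₁ hj₁ j₂ hj₂ j₃ hj₃ hsum hfit hc hc'
    refine h2.2 (hcomplete hd j₀ hj₀ j₁ hj₁ j₂ hj₂ j₃ hj₃ hsum hfit ?_ ?_)
    · intro s hs
      have := pairLoad_le π.length x.length (entries x) 0 1 _ rfl hs
      exact this.trans (by omega)
    · intro s hs
      have := pairLoad_le π.length x.length (entries x) 2 3 _ rfl hs
      exact this.trans (by omega)

/-- The solution is fixed before the coins, and only the message depends on them. So just two bad
events matter, too many collisions with the sum of the first half or of the second, each of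
probability at most `1/6`. -/
theorem two_thirds_le_coinLaw_accepts {x : List Bool} (hx : x ∈ subsetSum) :
    2 / 3 ≤ coinLaw {ω | ∃ π : List Bool, (π.length : ℝ) ≤ (itemCount x : ℝ) / 4 ∧
      Accepts verifier ⟨x, ω, π⟩} := by
  classical
  obtain ⟨hd, j₀, hj₀, j₁, hj₁, j₂, hj₂, j₃, hj₃, hsum⟩ := exists_groupSums hx
  obtain ⟨k, hk⟩ : ∃ k, k = itemCount x / 4 := ⟨_, rfl⟩
  rw [← hk] at hj₀ hj₁ hj₂ hj₃
  have hkn : (k : ℝ) ≤ (itemCount x : ℝ) / 4 := by rw [hk]; exact_mod_cast Nat.cast_div_le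
  have ha := sum_abs_entries_le x
  have hV : |groupSum (entries x) 0 j₀ + groupSum (entries x) 1 j₁| ≤ 2 ^ x.length := by
    rw [← listVal_of_lt (g := 0) hj₀, ← listVal_of_lt (g := 1) hj₁]
    exact abs_listVal_add_le ha (by norm_num) (by norm_num) (by norm_num) _ _
  have hV' : |groupSum (entries x) 2 j₂ + groupSum (entries x) 3 j₃| ≤ 2 ^ x.length := by
    rw [← listVal_of_lt (g := 2) hj₂, ← listVal_of_lt (g := 3) hj₃]
    exact abs_listVal_add_le ha (by norm_num) (by norm_num) (by norm_num) _ _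
  have h01 := card_many_collisions_le k x.length _ 0 1 _ hV ha (by norm_num) (by norm_num)
    (by norm_num)
  have h23 := card_many_collisions_le k x.length _ 2 3 _ hV' ha (by norm_num) (by norm_num)
    (by norm_num)
  obtain ⟨f, hf⟩ : ∃ f, f = collisions k x.length (entries x) 0 1
    (groupSum (entries x) 0 j₀ + groupSum (entries x) 1 j₁) := ⟨_, rfl⟩
  obtain ⟨f', hf'⟩ : ∃ f', f' = collisions k x.length (entries x) 2 3
    (groupSum (entries x) 2 j₂ + groupSum (entries x) 3 j₃) := ⟨_, rfl⟩
  rw [← hf] at h01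
  rw [← hf'] at h23
  refine two_thirds_le_coinLaw (m := k + x.length) (G := (Finset.range (2 ^ (k + x.length))).filter
    fun r => f r ≤ 62 * 2 ^ (k + 1) ∧ f' r ≤ 62 * 2 ^ (k + 1)) ?_ ?_ ?_
  · intro r hr
    exact Finset.mem_range.1 (Finset.mem_filter.1 hr).1
  · have h1 := Finset.card_filter_add_card_filter_not (s := Finset.range (2 ^ (k + x.length)))
      (fun r => f r ≤ 62 * 2 ^ (k + 1) ∧ f' r ≤ 62 * 2 ^ (k + 1))
    rw [Finset.card_range] at h1
    have h2 : ((Finset.range (2 ^ (k + x.length))).filter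
        fun r => ¬ (f r ≤ 62 * 2 ^ (k + 1) ∧ f' r ≤ 62 * 2 ^ (k + 1))).card ≤
        ((Finset.range (2 ^ (k + x.length))).filter fun r => 62 * 2 ^ (k + 1) < f r).card +
        ((Finset.range (2 ^ (k + x.length))).filter fun r => 62 * 2 ^ (k + 1) < f' r).card := by
      refine le_trans (Finset.card_le_card ?_) (Finset.card_union_le _ _)
      intro r hr
      rw [Finset.mem_filter] at hr
      rw [Finset.mem_union, Finset.mem_filter, Finset.mem_filter]
      rcases not_and_or.1 hr.2 with h | h
      · exact Or.inl ⟨hr.1, not_le.1 h⟩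
      · exact Or.inr ⟨hr.1, not_le.1 h⟩
    omega
  · intro ω hω
    obtain ⟨-, h1, h2⟩ := Finset.mem_filter.1 hω
    obtain ⟨π, hπ, hfit⟩ := exists_message (coinNum ω (k + x.length)) k x.length
      (groupSum (entries x) 0 j₀) (groupSum (entries x) 1 j₁)
    subst hπ
    refine ⟨π, hkn, ?_⟩
    rw [hf] at h1
    rw [hf'] at h2
    exact (verifier_spec ω hkn).2.2 hd j₀ hj₀ j₁ hj₁ j₂ hj₂ j₃ hj₃ hsum hfit h1 h2

end AMProtocol

theorem mainTheorem2 :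
    ∃ t : List Bool → ℝ,
      AMProtocol.IsOStar t (fun x => (2 : ℝ) ^ ((AMProtocol.itemCount x : ℝ) / 4)) ∧
      AMProtocol.subsetSum ∈ AMProtocol.AM (fun x => (AMProtocol.itemCount x : ℝ) / 4) t := by
  refine ⟨AMProtocol.timeBound, AMProtocol.isOStar_timeBound, AMProtocol.verifier, fun x => ⟨?_, ?_, ?_⟩⟩
  · exact fun ω π hπ => (AMProtocol.verifier_spec ω hπ).1
  · exact AMProtocol.two_thirds_le_coinLaw_accepts
  · exact fun hx ω π hπ h => hx ((AMProtocol.verifier_spec ω hπ).2.1 h)
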